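/- Let $q:\mathbb{R}\to\mathbb{C}$ be continuous and $2\pi$-periodic, and let $H=-\frac{d^2}{dx^2}+q(x)$ be the corresponding Hill operator acting in $L^2(\mathbb{R})$ (with its maximal domain: all $y\in L^2(\mathbb{R})$ such that $y$ and $y'$ are locally absolutely continuous and $-y''+qy\in L^2(\mathbb{R})$). We say that there is coexistence at $\lambda\in\mathbb{C}$ if the equation $-y''+qy=\lambda y$ on $\mathbb{R}$ has two linearly independent solutions that are both $2\pi$-periodic, or two linearly independent solutions that are both $2\pi$-antiperiodic ($y(x+2\pi)=-y(x)$). Suppose that the spectrum of $H$ is $\sigma(H)=[0,\infty)$, and that for some integer $m\ge 1$ there is coexistence at $\lambda=n^2/4$ for every integer $n\ge 1$ with $n\ne m$, but there is no coexistence at $\lambda=m^2/4$. Then there is a complex number $a$ with $a\neq 0$ and $|a|\ne 1$ such that $$q(x)=q_m(x)=\frac{2m^2a\,e^{imx}}{(a\,e^{imx}+1)^2}\qquad\text{for all } x\in\mathbb{R}.$$ In particular, $q$ has only positive or only negative Fourier frequencies: either $q(x)=\sum_{n=1}^\infty B_n e^{inx}$ for all $x\in\mathbb{R}$, or $q(x)=\sum_{n=1}^\infty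 A_n e^{-inx}$ for all $x\in\mathbb{R}$, with complex coefficients and absolutely convergent series. -/

import Mathlib

open MeasureTheory

noncomputable section

namespace ComplexHill

/-- The Hilbert space `L²(ℝ)` of complex-valued functions. -/
abbrev L2 : Type := Lp ℂ 2 (volume : Measure ℝ)

/-- `HillRel q f g` says that `f` lies in the (maximal) domain of `H = -d²/dx² + q` in `L²(ℝ)` and
that `H f = g`. In detail: `f` is represented by a differentiable function `y` whose derivative `p`
is locally absolutely continuous with `p' = q y - g` almost everywhere (written in integrated
form), that is, `-y'' + q y = g`. -/
def HillRel (q : ℝ → ℂ) (f g : L2) : Prop :=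
  ∃ y p : ℝ → ℂ, (f : ℝ → ℂ) =ᵐ[volume] y ∧ (∀ x, HasDerivAt y (p x) x) ∧
    ∀ a b : ℝ, IntervalIntegrable (fun t => q t * y t - g t) volume a b ∧
      p b - p a = ∫ t in a..b, (q t * y t - g t)

/-- The graph of the Hill operator, as a linear subspace of `L²(ℝ) × L²(ℝ)`. -/
def hillGraph (q : ℝ → ℂ) : Submodule ℂ (L2 × L2) where
  carrier := {z | HillRel q z.1 z.2}
  zero_mem' := by
    refine ⟨fun _ => 0, fun _ => 0, Lp.coeFn_zero ℂ 2 volume,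
      fun x => hasDerivAt_const x (0 : ℂ), fun a b => ?_⟩
    have h : (fun t => q t * (0 : ℂ) - ((0 : L2) : ℝ → ℂ) t) =ᵐ[volume] fun _ => (0 : ℂ) :=
      Filter.Eventually.of_forall fun t => by simp
    refine ⟨(intervalIntegrable_const (c := (0 : ℂ))).congr_ae (ae_restrict_of_ae h.symm), ?_⟩
    simp
  add_mem' := by
    rintro ⟨f₁, g₁⟩ ⟨f₂, g₂⟩ ⟨y₁, p₁, hf₁, hy₁, hp₁⟩ ⟨y₂, p₂, hf₂, hy₂, hp₂⟩
    refine ⟨fun x => y₁ x + y₂ x, fun x => p₁ x + p₂ x, ?_,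
      fun x => (hy₁ x).add (hy₂ x), fun a b => ?_⟩
    · filter_upwards [Lp.coeFn_add f₁ f₂, hf₁, hf₂] with t h h₁ h₂
      exact h.trans (congrArg₂ (· + ·) h₁ h₂)
    have h : (fun t => (q t * y₁ t - g₁ t) + (q t * y₂ t - g₂ t)) =ᵐ[volume]
        fun t => q t * (y₁ t + y₂ t) - ((g₁ + g₂ : L2) : ℝ → ℂ) t := by
      filter_upwards [Lp.coeFn_add g₁ g₂] with t ht
      simp only [ht, Pi.add_apply]
      ring
    have hi := ((hp₁ a b).1.add (hp₂ a b).1)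
    refine ⟨hi.congr_ae (ae_restrict_of_ae h), ?_⟩
    have h2 := intervalIntegral.integral_congr_ae (μ := volume) (a := a) (b := b)
      (h.mono fun t ht _ => ht)
    rw [intervalIntegral.integral_add (hp₁ a b).1 (hp₂ a b).1, ← (hp₁ a b).2,
      ← (hp₂ a b).2] at h2
    refine Eq.trans ?_ h2
    ring
  smul_mem' := by
    rintro c ⟨f, g⟩ ⟨y, p, hf, hy, hp⟩
    refine ⟨fun x => c * y x, fun x => c * p x, ?_, fun x => (hy x).const_mul c, fun a b => ?_⟩
    · filter_upwards [Lp.coeFn_smul c f, hf] with t h h₁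
      simp [h, h₁]
    have h : (fun t => c * (q t * y t - g t)) =ᵐ[volume]
        fun t => q t * (c * y t) - ((c • g : L2) : ℝ → ℂ) t := by
      filter_upwards [Lp.coeFn_smul c g] with t ht
      simp only [ht, Pi.smul_apply, smul_eq_mul]
      ring
    refine ⟨((hp a b).1.const_mul c).congr_ae (ae_restrict_of_ae h), ?_⟩
    have h2 := intervalIntegral.integral_congr_ae (μ := volume) (a := a) (b := b)
      (h.mono fun t ht _ => ht)
    rw [intervalIntegral.integral_const_mul, ← (hp a b).2] at h2
    refine Eq.trans ?_ h2
    ring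

/-- The Hill operator `H = -d²/dx² + q(x)` as an unbounded operator in `L²(ℝ)`. -/
def hillOperator (q : ℝ → ℂ) : L2 →ₗ.[ℂ] L2 := (hillGraph q).toLinearPMap

/-- The relation `H f = g` is single-valued. -/
theorem hillGraph_single_valued (q : ℝ → ℂ) (z : L2 × L2) (hz : z ∈ hillGraph q)
    (h0 : z.1 = 0) : z.2 = 0 := by
  obtain ⟨f, g⟩ := z
  obtain ⟨y, p, hf, hy, hp⟩ := hz
  simp only at h0 hf hp ⊢
  subst h0
  have hyc : Continuous y := continuous_iff_continuousAt.2 fun x => (hy x).continuousAt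
  have hy0 : y = fun _ => 0 := by
    refine Continuous.ae_eq_iff_eq volume hyc continuous_const |>.1 ?_
    exact hf.symm.trans (Lp.coeFn_zero ℂ 2 volume)
  subst hy0
  have hp0 : ∀ x, p x = 0 := fun x => (hy x).unique (hasDerivAt_const x (0 : ℂ))
  have hg : LocallyIntegrable (g : ℝ → ℂ) volume :=
    (Lp.memLp g).locallyIntegrable (by norm_num)
  have hint : ∀ b : ℝ, ∫ t in (0 : ℝ)..b, (g : ℝ → ℂ) t = 0 := by
    intro b
    have h := (hp 0 b).2
    simp only [hp0, mul_zero, zero_sub, intervalIntegral.integral_neg, sub_zero] at h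
    exact neg_eq_zero.1 h.symm
  have hae : (g : ℝ → ℂ) =ᵐ[volume] 0 := by
    filter_upwards [LocallyIntegrable.ae_hasDerivAt_integral hg] with x hx
    have h := hx 0
    simp only [hint] at h
    exact h.unique (hasDerivAt_const x (0 : ℂ))
  exact Lp.ext (hae.trans (Lp.coeFn_zero ℂ 2 volume).symm)

/-- The graph of `hillOperator q` is the relation `HillRel q`. -/
theorem mem_graph_hillOperator (q : ℝ → ℂ) (f g : L2) :
    (f, g) ∈ (hillOperator q).graph ↔ HillRel q f g := by
  have h := Submodule.toLinearPMap_graph_eq (hillGraph q)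
    (fun z hz h0 => hillGraph_single_valued q z hz h0)
  rw [hillOperator, h]
  rfl

/-- The resolvent set of an unbounded operator `T`: the set of `z` such that `T - z` maps the
domain of `T` bijectively onto the whole space, with bounded inverse `R`. -/
def resolventSet {E : Type*} [NormedAddCommGroup E] [NormedSpace ℂ E] (T : E →ₗ.[ℂ] E) : Set ℂ :=
  {z | ∃ R : E →L[ℂ] E, (∀ x : T.domain, R (T x - z • (x : E)) = x) ∧
    ∀ w : E, ∃ h : R w ∈ T.domain, T ⟨R w, h⟩ - z • R w = w}

/-- The spectrum of an unbounded operator. -/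
def spectrum {E : Type*} [NormedAddCommGroup E] [NormedSpace ℂ E] (T : E →ₗ.[ℂ] E) : Set ℂ :=
  (resolventSet T)ᶜ

/-- `y` is a classical solution of `-y'' + q y = lam y` on `ℝ`. -/
def IsSolution (q : ℝ → ℂ) (lam : ℂ) (y : ℝ → ℂ) : Prop :=
  Differentiable ℝ y ∧ Differentiable ℝ (deriv y) ∧
    ∀ x, -deriv (deriv y) x + q x * y x = lam * y x

/-- Coexistence at `lam`: the equation `-y'' + q y = lam y` has two linearly independent
`2π`-periodic solutions (`ρ = 1`), or two linearly independent `2π`-antiperiodic solutions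
(`ρ = -1`). -/
def Coexistence (q : ℝ → ℂ) (lam : ℂ) : Prop :=
  ∃ ρ : ℂ, (ρ = 1 ∨ ρ = -1) ∧ ∃ φ₁ φ₂ : ℝ → ℂ,
    IsSolution q lam φ₁ ∧ IsSolution q lam φ₂ ∧
    (∀ x, φ₁ (x + 2 * Real.pi) = ρ * φ₁ x) ∧ (∀ x, φ₂ (x + 2 * Real.pi) = ρ * φ₂ x) ∧
    LinearIndependent ℂ ![φ₁, φ₂]

/-- The potential `q_m(x) = 2 m² a e^{imx} / (a e^{imx} + 1)²` with parameter `a`. -/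
def gasymovExample (m : ℕ) (a : ℂ) (x : ℝ) : ℂ :=
  2 * (m : ℂ) ^ 2 * a * Complex.exp (Complex.I * m * x) /
    (a * Complex.exp (Complex.I * m * x) + 1) ^ 2

/-- `q` is the sum of a Fourier series with only positive frequencies, or of one with only negative
frequencies: `q(x) = ∑_{n ≥ 1} B_n e^{inx}` for all `x`, or `q(x) = ∑_{n ≥ 1} A_n e^{-inx}` for
all `x` (the series converging absolutely). The coefficient of index `n + 1` is `B n`. -/
def HasOneSidedFourierSeries (q : ℝ → ℂ) : Prop :=
  (∃ B : ℕ → ℂ, ∀ x : ℝ,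
    HasSum (fun n : ℕ => B n * Complex.exp (Complex.I * ((n : ℂ) + 1) * x)) (q x)) ∨
  (∃ A : ℕ → ℂ, ∀ x : ℝ,
    HasSum (fun n : ℕ => A n * Complex.exp (-(Complex.I * ((n : ℂ) + 1) * x))) (q x))

end ComplexHill

end

/-!
Write `θ`, `φ` (`cosSol`, `sinSol`) for the solutions of `-y'' + q y = λ y` with the initial data of
cosine and sine at `0`, and `Δ(λ)` (`discriminant`) for the trace of the monodromy matrix over a
period. The proof recovers `q` from the zeros of two entire functions of `λ`.

*The spectrum determines the discriminant.* If `Δ(λ) = ± 2`, there is a bounded Floquet solution,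
and cutting it off produces approximate eigenfunctions, so `λ ∈ σ(H)` (`mem_spectrum_of_floquet`).
If the monodromy matrix has no eigenvalue of modulus one, two exponentially decaying solutions give
a Green function, bounded on `L²` by Schur's test, so `λ ∉ σ(H)` (`mem_resolventSet_of_multiplier`).
Hence, if `σ(H) = [0, ∞)`, all points with `Δ = ± 2` lie on `[0, ∞)`, and as `-2 ≤ Δ ≤ 2` there,
`Δ'` vanishes at those that are positive. So for `D(w) = Δ(w²)` the quotient `D'² / (4 - D²)` is
entire. Since `D` is asymptotic to `2 cos (2πw)`, the quotient tends to `4π²` along the boundaries of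
a sequence of growing squares, and is constant (`differential_identity`). Therefore
`4 - Δ(w²)² = 4 sin² (2πw)` (`four_sub_discriminant_sq`).

*Coexistence leaves one free zero.* Let `b(x, λ)` (`offDiag`) be the upper right entry of the
monodromy matrix with base point `x`. It vanishes where there is coexistence, and `w b(x, w²)` is
asymptotic to `sin (2πw)`. Comparison on the same squares gives
`w b(x, w²) (w² - m²/4) = sin (2πw) (w² - μ(x))` (`exists_offDiag_eq`). As a function of `x`, `b`
satisfies `b'² + 4 (q - λ) b² - 2 b b'' = Δ² - 4` (`exists_deriv_offDiag`). Comparing powers of `λ`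
yields `q = m²/2 - 2 μ` and two differential equations for `μ` (`exists_mu`).

*Integration.* With `r = q / 2` these equations are `r'² = 4 r³ - m² r²` and `r'' = 6 r² - m² r`. If
`r` has a zero, then `q = 0` by Grönwall's inequality, and there would be coexistence at `m²/4`.
Otherwise `1 / r` satisfies a linear equation with constant coefficients, whose solutions give the
potentials `q_m` (`exists_eq_of_deriv_sq`). The parameter cannot have modulus one because `1 / r`
has no zero. The Fourier series is the expansion of `u / (1 + u)²` in powers of `u` or of `1 / u`.
-/

namespace ComplexHill

open Set Filter Topology intervalIntegral Interval

/-! ### Linear differential equations -/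

section LinearODE

variable {E : Type*} [NormedAddCommGroup E] [NormedSpace ℝ E]

/-- The `n`-th term of the Picard series for `u' = A u`, `u 0 = v`. -/
noncomputable def picardTerm (A : ℝ → E →L[ℝ] E) (v : E) : ℕ → ℝ → E
  | 0 => fun _ => v
  | n + 1 => fun x => ∫ t in (0 : ℝ)..x, A t (picardTerm A v n t)

theorem continuous_picardTerm [CompleteSpace E] {A : ℝ → E →L[ℝ] E} (hA : Continuous A) (v : E)
    (n : ℕ) : Continuous (picardTerm A v n) := by
  induction n with
  | zero => exact continuous_const
  | succ n ih =>
    exact intervalIntegral.continuous_primitive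
      (fun a b => (hA.clm_apply ih).intervalIntegrable a b) 0

theorem norm_picardTerm_le [CompleteSpace E] {A : ℝ → E →L[ℝ] E} (hA : Continuous A) {L : ℝ}
    (hL : ∀ t, ‖A t‖ ≤ L) (v : E) (n : ℕ) (x : ℝ) :
    ‖picardTerm A v n x‖ ≤ ‖v‖ * ((L * |x|) ^ n / n.factorial) := by
  have hL0 : 0 ≤ L := (norm_nonneg _).trans (hL 0)
  induction n generalizing x with
  | zero => simp [picardTerm]
  | succ n ih =>
    have hint : IntegrableOn (fun t : ℝ => L * (‖v‖ * ((L * |t - 0|) ^ n / n.factorial))) (Ι 0 x) :=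
      (by fun_prop : Continuous fun t : ℝ => L * (‖v‖ * ((L * |t - 0|) ^ n / n.factorial))
        ).integrableOn_uIoc
    calc ‖picardTerm A v (n + 1) x‖ ≤ ∫ t in Ι 0 x, ‖A t (picardTerm A v n t)‖ :=
          norm_integral_le_integral_norm_uIoc
      _ ≤ ∫ t in Ι 0 x, L * (‖v‖ * ((L * |t - 0|) ^ n / n.factorial)) := by
          refine setIntegral_mono_on
            ((hA.clm_apply (continuous_picardTerm hA v n)).norm.integrableOn_uIoc) hint
            measurableSet_uIoc fun t _ => ?_
          rw [sub_zero]
          exact ((A t).le_opNorm _).trans (mul_le_mul (hL t) (ih t) (norm_nonneg _) hL0)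
      _ = L * (‖v‖ * (L ^ n / n.factorial)) * ∫ t in Ι 0 x, |t - 0| ^ n := by
          rw [← MeasureTheory.integral_const_mul]
          congr 1
          ext t
          rw [mul_pow]
          ring
      _ = ‖v‖ * ((L * |x|) ^ (n + 1) / (n + 1).factorial) := by
          rw [integral_pow_abs_sub_uIoc, sub_zero, Nat.factorial_succ, mul_pow]
          push_cast
          field_simp
          ring

/-- A linear differential equation with bounded continuous coefficient has a global solution with
prescribed value at `0`. -/
theorem exists_hasDerivAt_linear [CompleteSpace E] {A : ℝ → E →L[ℝ] E} (hA : Continuous A) {L : ℝ}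
    (hL : ∀ t, ‖A t‖ ≤ L) (v : E) :
    ∃ u : ℝ → E, u 0 = v ∧ ∀ x, HasDerivAt u (A x (u x)) x := by
  have hL0 : 0 ≤ L := (norm_nonneg _).trans (hL 0)
  have hsum : ∀ X : ℝ, Summable fun n : ℕ => ‖v‖ * ((L * |X|) ^ n / n.factorial) := fun X =>
    (Real.summable_pow_div_factorial (L * |X|)).mul_left _
  have hs : ∀ x, Summable fun n => picardTerm A v n x := fun x =>
    Summable.of_norm_bounded (hsum x) fun n => norm_picardTerm_le hA hL v n x
  -- the sum of the Picard series, differentiated term by term on the ball of radius `|x| + 1`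
  refine ⟨fun x => ∑' n, picardTerm A v n x, ?_, fun x => ?_⟩
  · beta_reduce
    rw [tsum_eq_single 0 fun n hn => ?_]
    · rfl
    · obtain ⟨k, rfl⟩ := Nat.exists_eq_succ_of_ne_zero hn
      simp [picardTerm]
  · set X : ℝ := |x| + 1
    let g' : ℕ → ℝ → E := fun n y => match n with
      | 0 => 0
      | n + 1 => A y (picardTerm A v n y)
    let b : ℕ → ℝ := fun n => match n with
      | 0 => 0
      | n + 1 => L * (‖v‖ * ((L * |X|) ^ n / n.factorial))
    have hb : Summable b := (summable_nat_add_iff 1).1 ((hsum X).mul_left L)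
    have hX : 0 ≤ X := by positivity
    have h := hasDerivAt_tsum_of_isPreconnected (g := fun n => picardTerm A v n) (g' := g')
      (t := Metric.ball (0 : ℝ) X) (y₀ := 0) (y := x) hb Metric.isOpen_ball
      (convex_ball _ _).isPreconnected ?_ ?_ ?_ (hs 0) ?_
    · convert! h using 1
      have hg' : Summable fun n => g' n x :=
        (summable_nat_add_iff 1).1 ((hs x).mapL (A x))
      rw [hg'.tsum_eq_zero_add, (A x).map_tsum (hs x)]
      simp [g']
    · rintro (_ | n) y _
      · exact hasDerivAt_const _ _
      · exact (hA.clm_apply (continuous_picardTerm hA v n)).integral_hasStrictDerivAt 0 y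
          |>.hasDerivAt
    · rintro (_ | n) y hy
      · simp [g', b]
      · refine ((A y).le_opNorm _).trans (mul_le_mul (hL y) ?_ (norm_nonneg _) hL0)
        refine (norm_picardTerm_le hA hL v n y).trans ?_
        have : |y| ≤ |X| := by
          rw [abs_of_nonneg hX]
          simpa using (mem_ball_zero_iff.1 hy).le
        gcongr
    · simpa using (by positivity : 0 < X)
    · simp [X]

end LinearODE

/-! ### Solutions of the Hill equation -/

/-- `y` is a solution of `-y'' + q y = lam y` and `p` is its derivative. -/
structure IsSol (q : ℝ → ℂ) (lam : ℂ) (y p : ℝ → ℂ) : Prop where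
  hasDerivAt : ∀ x, HasDerivAt y (p x) x
  hasDerivAt_deriv : ∀ x, HasDerivAt p ((q x - lam) * y x) x

namespace IsSol

variable {q : ℝ → ℂ} {lam : ℂ} {y p y₁ p₁ y₂ p₂ : ℝ → ℂ}

theorem continuous (h : IsSol q lam y p) : Continuous y :=
  continuous_iff_continuousAt.2 fun x => (h.hasDerivAt x).continuousAt

theorem continuous_deriv (h : IsSol q lam y p) : Continuous p :=
  continuous_iff_continuousAt.2 fun x => (h.hasDerivAt_deriv x).continuousAt

theorem comb (h₁ : IsSol q lam y₁ p₁) (h₂ : IsSol q lam y₂ p₂) (a b : ℂ) :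
    IsSol q lam (fun x => a * y₁ x + b * y₂ x) (fun x => a * p₁ x + b * p₂ x) where
  hasDerivAt x := ((h₁.hasDerivAt x).const_mul a).add ((h₂.hasDerivAt x).const_mul b)
  hasDerivAt_deriv x := by
    refine (((h₁.hasDerivAt_deriv x).const_mul a).add
      ((h₂.hasDerivAt_deriv x).const_mul b)).congr_deriv ?_
    ring

theorem comp_add (h : IsSol q lam y p) (s : ℝ) :
    IsSol (fun x => q (x + s)) lam (fun x => y (x + s)) (fun x => p (x + s)) where
  hasDerivAt x := (h.hasDerivAt (x + s)).comp_add_const x s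
  hasDerivAt_deriv x := (h.hasDerivAt_deriv (x + s)).comp_add_const x s

theorem shift (h : IsSol q lam y p) {T : ℝ} (hT : Function.Periodic q T) :
    IsSol q lam (fun x => y (x + T)) (fun x => p (x + T)) := by
  have h1 := h.comp_add T
  rwa [show (fun x => q (x + T)) = q from funext hT] at h1

theorem wronskian (h₁ : IsSol q lam y₁ p₁) (h₂ : IsSol q lam y₂ p₂) (x : ℝ) :
    y₁ x * p₂ x - p₁ x * y₂ x = y₁ 0 * p₂ 0 - p₁ 0 * y₂ 0 := by
  refine is_const_of_deriv_eq_zero (f := fun x => y₁ x * p₂ x - p₁ x * y₂ x) ?_ ?_ x 0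
  · intro x
    exact (((h₁.hasDerivAt x).mul (h₂.hasDerivAt_deriv x)).sub
      ((h₁.hasDerivAt_deriv x).mul (h₂.hasDerivAt x))).differentiableAt
  · intro x
    refine (((h₁.hasDerivAt x).mul (h₂.hasDerivAt_deriv x)).sub
      ((h₁.hasDerivAt_deriv x).mul (h₂.hasDerivAt x))).deriv.trans ?_
    ring

end IsSol

/-- The equation has a solution for every choice of initial data at `0`. -/
theorem exists_isSol {q : ℝ → ℂ} (hq : Continuous q) {K : ℝ} (hK : ∀ x, ‖q x‖ ≤ K) (lam α β : ℂ) :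
    ∃ s : (ℝ → ℂ) × (ℝ → ℂ), IsSol q lam s.1 s.2 ∧ s.1 0 = α ∧ s.2 0 = β := by
  -- the first-order system `(y, p)' = (p, (q - lam) y)`
  let B : ℂ × ℂ →L[ℝ] ℂ × ℂ :=
    (ContinuousLinearMap.snd ℝ ℂ ℂ).prod 0
  let C : ℂ →L[ℝ] (ℂ × ℂ →L[ℝ] ℂ × ℂ) :=
    ((ContinuousLinearMap.compL ℝ (ℂ × ℂ) ℂ (ℂ × ℂ)).flip (ContinuousLinearMap.fst ℝ ℂ ℂ)).comp
      (((ContinuousLinearMap.compL ℝ ℂ ℂ (ℂ × ℂ)) (ContinuousLinearMap.inr ℝ ℂ ℂ)).comp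
        (ContinuousLinearMap.mul ℝ ℂ))
  have hC : ∀ (c : ℂ) (z : ℂ × ℂ), C c z = (0, c * z.1) := fun c z => by simp [C]
  let A : ℝ → (ℂ × ℂ →L[ℝ] ℂ × ℂ) := fun x => B + C (q x - lam)
  have hA : Continuous A := by fun_prop
  obtain ⟨u, hu0, hu⟩ := exists_hasDerivAt_linear (A := A) hA
    (L := ‖B‖ + ‖C‖ * (K + ‖lam‖)) (fun t => by
      refine (norm_add_le _ _).trans (add_le_add le_rfl ((C.le_opNorm _).trans ?_))
      gcongr
      exact (norm_sub_le _ _).trans (add_le_add (hK t) le_rfl)) (α, β)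
  refine ⟨(fun x => (u x).1, fun x => (u x).2), ⟨fun x => ?_, fun x => ?_⟩, ?_, ?_⟩
  · have := (ContinuousLinearMap.fst ℝ ℂ ℂ).hasFDerivAt.comp_hasDerivAt x (hu x)
    refine this.congr_deriv ?_
    simp [A, B, hC]
  · have := (ContinuousLinearMap.snd ℝ ℂ ℂ).hasFDerivAt.comp_hasDerivAt x (hu x)
    refine this.congr_deriv ?_
    simp [A, B, hC, sub_mul]
  · simp [hu0]
  · simp [hu0]

/-! ### Fundamental solutions and the monodromy matrix -/

/-- The solution `(y, y')` with `y 0 = α` and `y' 0 = β`. It is chosen with `epsilon`, and is a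
solution whenever `q` is continuous and periodic, see `initSol_spec`. -/
noncomputable def initSol (q : ℝ → ℂ) (lam α β : ℂ) : (ℝ → ℂ) × (ℝ → ℂ) :=
  Classical.epsilon fun s => IsSol q lam s.1 s.2 ∧ s.1 0 = α ∧ s.2 0 = β

/-- The solution `θ` with `θ 0 = 1` and `θ' 0 = 0`. -/
noncomputable def cosSol (q : ℝ → ℂ) (lam : ℂ) : ℝ → ℂ := (initSol q lam 1 0).1

/-- The derivative `θ'` of `cosSol`. -/
noncomputable def cosSolDeriv (q : ℝ → ℂ) (lam : ℂ) : ℝ → ℂ := (initSol q lam 1 0).2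

/-- The solution `φ` with `φ 0 = 0` and `φ' 0 = 1`. -/
noncomputable def sinSol (q : ℝ → ℂ) (lam : ℂ) : ℝ → ℂ := (initSol q lam 0 1).1

/-- The derivative `φ'` of `sinSol`. -/
noncomputable def sinSolDeriv (q : ℝ → ℂ) (lam : ℂ) : ℝ → ℂ := (initSol q lam 0 1).2

/-- The Hill discriminant, the trace of the monodromy matrix. -/
noncomputable def discriminant (q : ℝ → ℂ) (lam : ℂ) : ℂ :=
  cosSol q lam (2 * Real.pi) + sinSolDeriv q lam (2 * Real.pi)

theorem exists_bound_of_continuous_periodic {f : ℝ → ℂ} {T : ℝ} (hf : Continuous f)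
    (hper : Function.Periodic f T) (hT : T ≠ 0) : ∃ K : ℝ, 0 < K ∧ ∀ x, ‖f x‖ ≤ K := by
  obtain ⟨K, hK⟩ := (hper.isBounded_of_continuous hT hf).exists_norm_le
  exact ⟨max K 1, by positivity, fun x => (hK _ (mem_range_self x)).trans (le_max_left _ _)⟩

section

variable {q : ℝ → ℂ} {lam : ℂ} {y p : ℝ → ℂ}

theorem initSol_spec (hq : Continuous q) (hper : Function.Periodic q (2 * Real.pi))
    (lam α β : ℂ) :
    IsSol q lam (initSol q lam α β).1 (initSol q lam α β).2 ∧ (initSol q lam α β).1 0 = α ∧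
      (initSol q lam α β).2 0 = β := by
  obtain ⟨K, -, hK⟩ := exists_bound_of_continuous_periodic hq hper (by positivity)
  exact Classical.epsilon_spec (exists_isSol hq hK lam α β)

theorem isSol_cosSol (hq : Continuous q) (hper : Function.Periodic q (2 * Real.pi)) (lam : ℂ) :
    IsSol q lam (cosSol q lam) (cosSolDeriv q lam) := (initSol_spec hq hper lam 1 0).1

theorem isSol_sinSol (hq : Continuous q) (hper : Function.Periodic q (2 * Real.pi)) (lam : ℂ) :
    IsSol q lam (sinSol q lam) (sinSolDeriv q lam) := (initSol_spec hq hper lam 0 1).1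

theorem cosSol_zero (hq : Continuous q) (hper : Function.Periodic q (2 * Real.pi)) (lam : ℂ) :
    cosSol q lam 0 = 1 := (initSol_spec hq hper lam 1 0).2.1

theorem cosSolDeriv_zero (hq : Continuous q) (hper : Function.Periodic q (2 * Real.pi)) (lam : ℂ) :
    cosSolDeriv q lam 0 = 0 := (initSol_spec hq hper lam 1 0).2.2

theorem sinSol_zero (hq : Continuous q) (hper : Function.Periodic q (2 * Real.pi)) (lam : ℂ) :
    sinSol q lam 0 = 0 := (initSol_spec hq hper lam 0 1).2.1

theorem sinSolDeriv_zero (hq : Continuous q) (hper : Function.Periodic q (2 * Real.pi)) (lam : ℂ) :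
    sinSolDeriv q lam 0 = 1 := (initSol_spec hq hper lam 0 1).2.2

theorem cosSol_mul_sinSolDeriv_sub (hq : Continuous q) (hper : Function.Periodic q (2 * Real.pi))
    (lam : ℂ) (x : ℝ) :
    cosSol q lam x * sinSolDeriv q lam x - cosSolDeriv q lam x * sinSol q lam x = 1 := by
  rw [(isSol_cosSol hq hper lam).wronskian (isSol_sinSol hq hper lam), cosSol_zero hq hper,
    cosSolDeriv_zero hq hper, sinSol_zero hq hper, sinSolDeriv_zero hq hper]
  ring

/-- Every solution is the combination of `θ` and `φ` given by its initial data: compare the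
Wronskians. -/
theorem IsSol.eq_comb (hq : Continuous q) (hper : Function.Periodic q (2 * Real.pi))
    (h : IsSol q lam y p) (x : ℝ) :
    y x = y 0 * cosSol q lam x + p 0 * sinSol q lam x ∧
      p x = y 0 * cosSolDeriv q lam x + p 0 * sinSolDeriv q lam x := by
  have h1 := h.wronskian (isSol_sinSol hq hper lam) x
  have h2 := (isSol_cosSol hq hper lam).wronskian h x
  have h3 := cosSol_mul_sinSolDeriv_sub hq hper lam x
  rw [sinSol_zero hq hper, sinSolDeriv_zero hq hper] at h1
  rw [cosSol_zero hq hper, cosSolDeriv_zero hq hper] at h2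
  constructor
  · linear_combination (-y x) * h3 + cosSol q lam x * h1 + sinSol q lam x * h2
  · linear_combination (-p x) * h3 + cosSolDeriv q lam x * h1 + sinSolDeriv q lam x * h2

theorem IsSol.eq_zero (hq : Continuous q) (hper : Function.Periodic q (2 * Real.pi))
    (h : IsSol q lam y p) (h0 : y 0 = 0) (h1 : p 0 = 0) (x : ℝ) : y x = 0 := by
  rw [(h.eq_comb hq hper x).1, h0, h1]
  ring

/-- The Cayley-Hamilton theorem for the monodromy matrix. -/
theorem IsSol.cayleyHamilton (hq : Continuous q) (hper : Function.Periodic q (2 * Real.pi))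
    (h : IsSol q lam y p) (x : ℝ) :
    y (x + 2 * Real.pi + 2 * Real.pi) - discriminant q lam * y (x + 2 * Real.pi) + y x = 0 := by
  have hs := h.shift hper
  have hz := (hs.shift hper).comb (hs.comb h (-discriminant q lam) 1) 1 1
  have h1 := h.eq_comb hq hper (2 * Real.pi)
  have h2 := hs.eq_comb hq hper (2 * Real.pi)
  have h3 := cosSol_mul_sinSolDeriv_sub hq hper lam (2 * Real.pi)
  simp only [zero_add] at h2
  have key := hz.eq_zero hq hper (by
    simp only [zero_add, discriminant]
    rw [h2.1, h1.1, h1.2]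
    linear_combination (-y 0) * h3) (by
    simp only [zero_add, discriminant]
    rw [h2.2, h1.1, h1.2]
    linear_combination (-p 0) * h3) x
  linear_combination key

/-- For each root `ρ` of `ρ² - Δ ρ + 1` there is a nonzero Floquet solution with multiplier `ρ`. -/
theorem exists_floquet (hq : Continuous q) (hper : Function.Periodic q (2 * Real.pi))
    {ρ σ : ℂ} (hmul : ρ * σ = 1) (hadd : ρ + σ = discriminant q lam) :
    ∃ y p : ℝ → ℂ, IsSol q lam y p ∧ (∃ x, y x ≠ 0) ∧ ∀ x, y (x + 2 * Real.pi) = ρ * y x := by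
  -- by Cayley-Hamilton, `z (· + 2π) - σ z` has multiplier `ρ` for every solution `z`
  by_cases H : ∃ z p : ℝ → ℂ, IsSol q lam z p ∧ ∃ x, z (x + 2 * Real.pi) - σ * z x ≠ 0
  · obtain ⟨z, p, hz, x, hx⟩ := H
    refine ⟨_, _, (hz.shift hper).comb hz 1 (-σ), ⟨x, ?_⟩, fun x => ?_⟩
    · intro h0
      exact hx (by linear_combination h0)
    · have := hz.cayleyHamilton hq hper x
      rw [← hadd] at this
      linear_combination this + z x * hmul
  · push Not at H
    have h1 := (isSol_cosSol hq hper lam)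
    have h2 := (isSol_sinSol hq hper lam)
    have e1 := H _ _ h1 0
    have e3 := H _ _ h2 0
    rw [zero_add, cosSol_zero hq hper] at e1
    rw [zero_add, sinSol_zero hq hper] at e3
    have h3 := cosSol_mul_sinSolDeriv_sub hq hper lam (2 * Real.pi)
    unfold discriminant at hadd
    have e4 : sinSolDeriv q lam (2 * Real.pi) = ρ := by linear_combination -e1 - hadd
    -- all solutions have multiplier `σ`, so the derivative of `φ` at `2π` is `σ` as well
    have e5 : sinSolDeriv q lam (2 * Real.pi) = σ := by
      have hd : HasDerivAt (fun x => sinSol q lam (x + 2 * Real.pi))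
          (σ * sinSolDeriv q lam 0) 0 := by
        rw [show (fun x => sinSol q lam (x + 2 * Real.pi)) = fun x => σ * sinSol q lam x from
          funext fun x => sub_eq_zero.1 (H _ _ h2 x)]
        exact (h2.hasDerivAt 0).const_mul σ
      have := ((h2.shift hper).hasDerivAt 0).unique hd
      rwa [zero_add, sinSolDeriv_zero hq hper, mul_one] at this
    refine ⟨_, _, h1, ⟨0, by simp [cosSol_zero hq hper]⟩, fun x => ?_⟩
    rw [← e4, e5]
    exact sub_eq_zero.1 (H _ _ h1 x)

/-- Dependence on the spectral parameter (variation of constants). -/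
theorem IsSol.sub_eq (hq : Continuous q) (hper : Function.Periodic q (2 * Real.pi))
    {lam₀ : ℂ} {y₀ p₀ : ℝ → ℂ} (h : IsSol q lam y p) (h₀ : IsSol q lam₀ y₀ p₀)
    (hy : y 0 = y₀ 0) (hp : p 0 = p₀ 0) (x : ℝ) :
    y x - y₀ x = (lam - lam₀) * (cosSol q lam₀ x * (∫ t in (0 : ℝ)..x, sinSol q lam₀ t * y t) -
        sinSol q lam₀ x * ∫ t in (0 : ℝ)..x, cosSol q lam₀ t * y t) ∧
    p x - p₀ x = (lam - lam₀) *
      (cosSolDeriv q lam₀ x * (∫ t in (0 : ℝ)..x, sinSol q lam₀ t * y t) -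
        sinSolDeriv q lam₀ x * ∫ t in (0 : ℝ)..x, cosSol q lam₀ t * y t) := by
  have hc := isSol_cosSol hq hper lam₀
  have hs := isSol_sinSol hq hper lam₀
  have key : ∀ u u' : ℝ → ℂ, IsSol q lam₀ u u' →
      (lam - lam₀) * (∫ t in (0 : ℝ)..x, u t * y t) =
        u' x * (y x - y₀ x) - u x * (p x - p₀ x) := by
    intro u u' hu
    rw [← intervalIntegral.integral_const_mul,
      integral_eq_sub_of_hasDerivAt (f := fun t => u' t * (y t - y₀ t) - u t * (p t - p₀ t))]
    · simp [hy, hp]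
    · intro t _
      refine (((hu.hasDerivAt_deriv t).mul ((h.hasDerivAt t).sub (h₀.hasDerivAt t))).sub
        ((hu.hasDerivAt t).mul
          ((h.hasDerivAt_deriv t).sub (h₀.hasDerivAt_deriv t)))).congr_deriv ?_
      simp only [Pi.sub_apply]
      ring
    · exact ((hu.continuous.mul h.continuous).const_mul _).intervalIntegrable _ _
  have k1 := key _ _ hs
  have k2 := key _ _ hc
  have h3 := cosSol_mul_sinSolDeriv_sub hq hper lam₀ x
  constructor
  · linear_combination (-(y x - y₀ x)) * h3 - cosSol q lam₀ x * k1 + sinSol q lam₀ x * k2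
  · linear_combination (-(p x - p₀ x)) * h3 - cosSolDeriv q lam₀ x * k1 +
      sinSolDeriv q lam₀ x * k2

end

/-! ### Dependence on the spectral parameter -/

section

variable {q : ℝ → ℂ}

/-- Local Lipschitz dependence of a solution on the spectral parameter, uniformly on `[0, x]`. -/
theorem exists_norm_initSol_sub_le (hq : Continuous q)
    (hper : Function.Periodic q (2 * Real.pi)) (α β lam₀ : ℂ) {x : ℝ} (hx : 0 ≤ x) :
    ∃ C : ℝ, ∀ᶠ lam in 𝓝 lam₀, ∀ t ∈ Icc 0 x,
      ‖(initSol q lam α β).1 t - (initSol q lam₀ α β).1 t‖ ≤ C * ‖lam - lam₀‖ := by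
  have hc := isSol_cosSol hq hper lam₀
  have hs := isSol_sinSol hq hper lam₀
  obtain ⟨h₀, h₀0, h₀1⟩ := initSol_spec hq hper lam₀ α β
  obtain ⟨M₁, hM₁⟩ := isCompact_Icc.exists_bound_of_continuousOn
    (s := Icc 0 x) hc.continuous.continuousOn
  obtain ⟨M₂, hM₂⟩ := isCompact_Icc.exists_bound_of_continuousOn
    (s := Icc 0 x) hs.continuous.continuousOn
  obtain ⟨G₀, hG₀⟩ := isCompact_Icc.exists_bound_of_continuousOn
    (s := Icc 0 x) h₀.continuous.continuousOn
  have hM₁0 : 0 ≤ M₁ := (norm_nonneg _).trans (hM₁ 0 ⟨le_rfl, hx⟩)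
  have hM₂0 : 0 ≤ M₂ := (norm_nonneg _).trans (hM₂ 0 ⟨le_rfl, hx⟩)
  have hG₀0 : 0 ≤ G₀ := (norm_nonneg _).trans (hG₀ 0 ⟨le_rfl, hx⟩)
  set C : ℝ := M₁ * (M₂ * x) + M₂ * (M₁ * x) with hC
  have hC0 : 0 ≤ C := by positivity
  have hlim : Tendsto (fun lam : ℂ => ‖lam - lam₀‖ * C) (𝓝 lam₀) (𝓝 0) := by
    have : Continuous fun lam : ℂ => ‖lam - lam₀‖ * C := by fun_prop
    simpa using this.tendsto lam₀
  refine ⟨C * (2 * G₀), ?_⟩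
  filter_upwards [hlim.eventually (ge_mem_nhds (by norm_num : (0 : ℝ) < 1 / 2))] with lam hlam
  obtain ⟨h, h0, h1⟩ := initSol_spec hq hper lam α β
  -- with `G` the maximum of `|y|` on `[0, x]`, variation of constants gives `G ≤ G₀ + G / 2`
  obtain ⟨t₁, ht₁, hmax⟩ := isCompact_Icc.exists_isMaxOn (s := Icc 0 x) ⟨0, le_rfl, hx⟩
    h.continuous.norm.continuousOn
  set G : ℝ := ‖(initSol q lam α β).1 t₁‖ with hG
  have hG0 : 0 ≤ G := norm_nonneg _
  have hint : ∀ (u : ℝ → ℂ) (M : ℝ), 0 ≤ M → (∀ t ∈ Icc 0 x, ‖u t‖ ≤ M) → ∀ t ∈ Icc 0 x,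
      ‖∫ s in (0 : ℝ)..t, u s * (initSol q lam α β).1 s‖ ≤ M * x * G := by
    intro u M hM0 hM t ht
    have := norm_integral_le_of_norm_le_const (a := (0 : ℝ)) (b := t) (C := M * G)
      (f := fun s => u s * (initSol q lam α β).1 s) (fun s hs => by
        rw [uIoc_of_le ht.1] at hs
        have hs' : s ∈ Icc 0 x := ⟨hs.1.le, hs.2.trans ht.2⟩
        rw [norm_mul]
        exact mul_le_mul (hM s hs') (hmax hs') (norm_nonneg _) hM0)
    rw [sub_zero, abs_of_nonneg ht.1] at this
    refine this.trans ?_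
    calc M * G * t ≤ M * G * x := by
          have := ht.2
          gcongr
      _ = M * x * G := by ring
  have hdiff : ∀ t ∈ Icc 0 x, ‖(initSol q lam α β).1 t - (initSol q lam₀ α β).1 t‖ ≤
      ‖lam - lam₀‖ * C * G := by
    intro t ht
    rw [(h.sub_eq hq hper h₀ (h0.trans h₀0.symm) (h1.trans h₀1.symm) t).1, norm_mul, mul_assoc]
    refine mul_le_mul_of_nonneg_left ((norm_sub_le _ _).trans ?_) (norm_nonneg _)
    rw [norm_mul, norm_mul, hC, add_mul]
    refine add_le_add ?_ ?_
    · rw [mul_assoc]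
      exact mul_le_mul (hM₁ t ht) (hint _ _ hM₂0 hM₂ t ht) (norm_nonneg _) hM₁0
    · rw [mul_assoc]
      exact mul_le_mul (hM₂ t ht) (hint _ _ hM₁0 hM₁ t ht) (norm_nonneg _) hM₂0
  have hGle : G ≤ 2 * G₀ := by
    have e1 := hdiff t₁ ht₁
    have e2 := norm_sub_norm_le ((initSol q lam α β).1 t₁) ((initSol q lam₀ α β).1 t₁)
    have e3 := hG₀ t₁ ht₁
    have e4 : ‖lam - lam₀‖ * C * G ≤ 1 / 2 * G := by gcongr
    linarith
  intro t ht
  calc _ ≤ ‖lam - lam₀‖ * C * G := hdiff t ht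
    _ ≤ ‖lam - lam₀‖ * C * (2 * G₀) := by gcongr
    _ = _ := by ring

theorem continuousAt_integral_mul_initSol (hq : Continuous q)
    (hper : Function.Periodic q (2 * Real.pi)) (α β lam₀ : ℂ) {x : ℝ} (hx : 0 ≤ x) {u : ℝ → ℂ}
    (hu : Continuous u) :
    ContinuousAt (fun lam => ∫ t in (0 : ℝ)..x, u t * (initSol q lam α β).1 t) lam₀ := by
  obtain ⟨C, hC⟩ := exists_norm_initSol_sub_le hq hper α β lam₀ hx
  obtain ⟨M, hM⟩ := isCompact_Icc.exists_bound_of_continuousOn (s := Icc 0 x) hu.continuousOn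
  have hM0 : 0 ≤ M := (norm_nonneg _).trans (hM 0 ⟨le_rfl, hx⟩)
  rw [ContinuousAt, tendsto_iff_norm_sub_tendsto_zero]
  have hlim : Tendsto (fun lam : ℂ => M * (C * ‖lam - lam₀‖) * x) (𝓝 lam₀) (𝓝 0) := by
    have : Continuous fun lam : ℂ => M * (C * ‖lam - lam₀‖) * x := by fun_prop
    simpa using this.tendsto lam₀
  refine squeeze_zero' (Eventually.of_forall fun _ => norm_nonneg _) ?_ hlim
  filter_upwards [hC] with lam hlam
  have hi : ∀ lam, IntervalIntegrable (fun t => u t * (initSol q lam α β).1 t) volume 0 x :=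
    fun lam => (hu.mul (initSol_spec hq hper lam α β).1.continuous).intervalIntegrable _ _
  rw [← integral_sub (hi _) (hi _)]
  have := norm_integral_le_of_norm_le_const (a := (0 : ℝ)) (b := x) (C := M * (C * ‖lam - lam₀‖))
    (f := fun t => u t * (initSol q lam α β).1 t - u t * (initSol q lam₀ α β).1 t)
    (fun t ht => by
      rw [uIoc_of_le hx] at ht
      have ht' : t ∈ Icc 0 x := ⟨ht.1.le, ht.2⟩
      rw [← mul_sub, norm_mul]
      exact mul_le_mul (hM t ht') (hlam t ht') (norm_nonneg _) hM0)
  rwa [sub_zero, abs_of_nonneg hx] at this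

theorem hasDerivAt_of_sub_eq_mul {f F : ℂ → ℂ} {z₀ : ℂ} (h : ∀ z, f z - f z₀ = (z - z₀) * F z)
    (hF : ContinuousAt F z₀) : HasDerivAt f (F z₀) z₀ := by
  rw [hasDerivAt_iff_tendsto_slope]
  refine (hF.tendsto.mono_left nhdsWithin_le_nhds).congr' ?_
  filter_upwards [self_mem_nhdsWithin] with z hz
  rw [slope_def_field, h, mul_div_cancel_left₀ _ (sub_ne_zero.2 hz)]

/-- Solutions with fixed initial data are entire functions of the spectral parameter. -/
theorem differentiable_initSol (hq : Continuous q)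
    (hper : Function.Periodic q (2 * Real.pi)) (α β : ℂ) {x : ℝ} (hx : 0 ≤ x) :
    (Differentiable ℂ fun lam => (initSol q lam α β).1 x) ∧
      Differentiable ℂ fun lam => (initSol q lam α β).2 x := by
  have hs := fun lam₀ => continuousAt_integral_mul_initSol hq hper α β lam₀ hx
    (isSol_sinSol hq hper lam₀).continuous
  have hc := fun lam₀ => continuousAt_integral_mul_initSol hq hper α β lam₀ hx
    (isSol_cosSol hq hper lam₀).continuous
  have key := fun lam₀ lam => (initSol_spec hq hper lam α β).1.sub_eq hq hper
    (initSol_spec hq hper lam₀ α β).1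
    ((initSol_spec hq hper lam α β).2.1.trans (initSol_spec hq hper lam₀ α β).2.1.symm)
    ((initSol_spec hq hper lam α β).2.2.trans (initSol_spec hq hper lam₀ α β).2.2.symm) x
  exact ⟨fun lam₀ => (hasDerivAt_of_sub_eq_mul (fun lam => (key lam₀ lam).1)
      (((hs lam₀).const_mul _).sub ((hc lam₀).const_mul _))).differentiableAt,
    fun lam₀ => (hasDerivAt_of_sub_eq_mul (fun lam => (key lam₀ lam).2)
      (((hs lam₀).const_mul _).sub ((hc lam₀).const_mul _))).differentiableAt⟩

theorem differentiable_discriminant (hq : Continuous q)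
    (hper : Function.Periodic q (2 * Real.pi)) : Differentiable ℂ (discriminant q) :=
  (differentiable_initSol hq hper 1 0 Real.two_pi_pos.le).1.add
    (differentiable_initSol hq hper 0 1 Real.two_pi_pos.le).2

/-! ### Asymptotics for large spectral parameter -/

theorem norm_exp_mul_I_le (z : ℂ) : ‖Complex.exp (z * Complex.I)‖ ≤ Real.exp |z.im| := by
  rw [Complex.norm_exp]
  simpa using neg_le_abs z.im

theorem norm_cos_le (z : ℂ) : ‖Complex.cos z‖ ≤ Real.exp |z.im| := by
  have h1 := norm_exp_mul_I_le z
  have h2 := norm_exp_mul_I_le (-z)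
  rw [Complex.neg_im, abs_neg] at h2
  rw [Complex.cos, norm_div, Complex.norm_ofNat, div_le_iff₀ two_pos]
  exact (norm_add_le _ _).trans (by linarith)

theorem norm_sin_le (z : ℂ) : ‖Complex.sin z‖ ≤ Real.exp |z.im| := by
  have h1 := norm_exp_mul_I_le z
  have h2 := norm_exp_mul_I_le (-z)
  rw [Complex.neg_im, abs_neg] at h2
  rw [Complex.sin, norm_div, norm_mul, Complex.norm_I, Complex.norm_ofNat, div_le_iff₀ two_pos]
  refine (mul_one _).le.trans ((norm_sub_le _ _).trans (by linarith))

variable {w : ℂ} {y p : ℝ → ℂ}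

/-- The Volterra integral equation satisfied by a solution of `-y'' + q y = w² y`. -/
theorem IsSol.volterra (hq : Continuous q) (hw : w ≠ 0) (h : IsSol q (w ^ 2) y p) (x : ℝ) :
    y x = Complex.cos (w * x) * y 0 + Complex.sin (w * x) / w * p 0 +
        ∫ t in (0 : ℝ)..x, Complex.sin (w * (x - t)) / w * (q t * y t) ∧
    p x = -w * Complex.sin (w * x) * y 0 + Complex.cos (w * x) * p 0 +
        ∫ t in (0 : ℝ)..x, Complex.cos (w * (x - t)) * (q t * y t) := by
  have hyc := h.continuous
  have ht : ∀ t : ℝ, HasDerivAt (fun t : ℝ => w * ((x : ℂ) - t)) (-w) t := fun t =>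
    (((Complex.ofRealCLM.hasDerivAt (x := t)).const_sub (x : ℂ)).const_mul w).congr_deriv
      (by simp)
  have hcos := fun t : ℝ => (Complex.hasDerivAt_cos (w * ((x : ℂ) - t))).comp t (ht t)
  have hsin := fun t : ℝ => (Complex.hasDerivAt_sin (w * ((x : ℂ) - t))).comp t (ht t)
  constructor
  · rw [integral_eq_sub_of_hasDerivAt (f := fun t : ℝ => Complex.cos (w * (x - t)) * y t +
      Complex.sin (w * (x - t)) / w * p t)]
    · simp
    · intro t _
      refine (((hcos t).mul (h.hasDerivAt t)).add
        (((hsin t).div_const w).mul (h.hasDerivAt_deriv t))).congr_deriv ?_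
      simp only [Function.comp_apply]
      field_simp
      ring
    · exact (by fun_prop : Continuous fun t : ℝ =>
        Complex.sin (w * (x - t)) / w * (q t * y t)).intervalIntegrable _ _
  · rw [integral_eq_sub_of_hasDerivAt (f := fun t : ℝ => -w * Complex.sin (w * (x - t)) * y t +
      Complex.cos (w * (x - t)) * p t)]
    · simp
    · intro t _
      refine ((((hsin t).const_mul (-w)).mul (h.hasDerivAt t)).add
        ((hcos t).mul (h.hasDerivAt_deriv t))).congr_deriv ?_
      simp only [Function.comp_apply]
      ring
    · exact (by fun_prop : Continuous fun t : ℝ =>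
        Complex.cos (w * (x - t)) * (q t * y t)).intervalIntegrable _ _

theorem abs_im_mul_real (w : ℂ) {x : ℝ} (hx : 0 ≤ x) : |(w * x).im| = |w.im| * x := by
  simp [abs_mul, abs_of_nonneg hx]

/-- If the initial part of the Volterra equation is at most `c e^{|Im w| x}`, so is `y / 2` for
large `w`. -/
theorem IsSol.norm_le (hq : Continuous q) {K : ℝ} (hK : ∀ x, ‖q x‖ ≤ K) (hw : w ≠ 0)
    (hwK : 4 * Real.pi * K ≤ ‖w‖) (h : IsSol q (w ^ 2) y p) {c : ℝ}
    (hc : ∀ x : ℝ, 0 ≤ x → ‖Complex.cos (w * x) * y 0 + Complex.sin (w * x) / w * p 0‖ ≤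
      c * Real.exp (|w.im| * x)) {x : ℝ} (hx : x ∈ Icc 0 (2 * Real.pi)) :
    ‖y x‖ ≤ 2 * c * Real.exp (|w.im| * x) := by
  have hw0 : 0 < ‖w‖ := norm_pos_iff.2 hw
  have hK0 : 0 ≤ K := (norm_nonneg _).trans (hK 0)
  have hyc := h.continuous
  -- with `G` the maximum of `|y| e^{-|Im w| x}`, the Volterra equation gives `G ≤ c + G / 2`
  obtain ⟨x₁, hx₁, hmax⟩ := isCompact_Icc.exists_isMaxOn (s := Icc 0 (2 * Real.pi))
    ⟨0, le_rfl, Real.two_pi_pos.le⟩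
    (f := fun x => ‖y x‖ * Real.exp (-(|w.im| * x))) (by fun_prop)
  set G : ℝ := ‖y x₁‖ * Real.exp (-(|w.im| * x₁)) with hG
  have hG0 : 0 ≤ G := by positivity
  have hyG : ∀ t ∈ Icc 0 (2 * Real.pi), ‖y t‖ ≤ G * Real.exp (|w.im| * t) := by
    intro t ht
    have := hmax ht
    simp only [mem_ofPred_eq] at this
    calc ‖y t‖ = ‖y t‖ * Real.exp (-(|w.im| * t)) * Real.exp (|w.im| * t) := by
          rw [mul_assoc, ← Real.exp_add]; simp
      _ ≤ _ := by gcongr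
  have hint : ‖∫ t in (0 : ℝ)..x₁, Complex.sin (w * (x₁ - t)) / w * (q t * y t)‖ ≤
      Real.exp (|w.im| * x₁) * (K * G) / ‖w‖ * x₁ := by
    have := norm_integral_le_of_norm_le_const (a := (0 : ℝ)) (b := x₁)
      (C := Real.exp (|w.im| * x₁) * (K * G) / ‖w‖)
      (f := fun t : ℝ => Complex.sin (w * (x₁ - t)) / w * (q t * y t)) (fun t ht => by
        rw [uIoc_of_le hx₁.1] at ht
        have ht' : t ∈ Icc 0 (2 * Real.pi) := ⟨ht.1.le, ht.2.trans hx₁.2⟩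
        have e1 : ‖Complex.sin (w * (x₁ - t))‖ ≤ Real.exp (|w.im| * (x₁ - t)) := by
          rw [← abs_im_mul_real w (sub_nonneg.2 ht.2)]
          push_cast
          exact norm_sin_le _
        rw [norm_mul, norm_div, norm_mul]
        calc ‖Complex.sin (w * (x₁ - t))‖ / ‖w‖ * (‖q t‖ * ‖y t‖)
            ≤ Real.exp (|w.im| * (x₁ - t)) / ‖w‖ * (K * (G * Real.exp (|w.im| * t))) := by
              gcongr
              · exact hK t
              · exact hyG t ht'
          _ = Real.exp (|w.im| * (x₁ - t)) * Real.exp (|w.im| * t) * (K * G) / ‖w‖ := by ring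
          _ = _ := by rw [← Real.exp_add]; ring_nf)
    rwa [sub_zero, abs_of_nonneg hx₁.1] at this
  have hGle : G ≤ 2 * c := by
    have e1 : ‖y x₁‖ ≤ c * Real.exp (|w.im| * x₁) +
        Real.exp (|w.im| * x₁) * (K * G) / ‖w‖ * x₁ := by
      rw [(h.volterra hq hw x₁).1]
      exact (norm_add_le _ _).trans (add_le_add (hc x₁ hx₁.1) hint)
    have e2 : K * x₁ / ‖w‖ ≤ 1 / 2 := by
      rw [div_le_iff₀ hw0]
      nlinarith [mul_le_mul_of_nonneg_left hx₁.2 hK0]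
    have e3 : G ≤ c + K * x₁ / ‖w‖ * G := by
      calc G ≤ (c * Real.exp (|w.im| * x₁) + Real.exp (|w.im| * x₁) * (K * G) / ‖w‖ * x₁) *
            Real.exp (-(|w.im| * x₁)) := by
              rw [hG]; gcongr
        _ = (c + K * x₁ / ‖w‖ * G) * (Real.exp (|w.im| * x₁) * Real.exp (-(|w.im| * x₁))) := by
              ring
        _ = _ := by rw [← Real.exp_add]; simp
    have e4 : K * x₁ / ‖w‖ * G ≤ 1 / 2 * G := by gcongr
    linarith
  exact (hyG x hx).trans (by gcongr)

/-- The integral terms of the Volterra equation at `2π`, for a solution of size `2c`. -/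
theorem norm_volterra_integral_le {K c : ℝ} (hK : ∀ x, ‖q x‖ ≤ K)
    (hy : ∀ x ∈ Icc 0 (2 * Real.pi), ‖y x‖ ≤ 2 * c * Real.exp (|w.im| * x)) {k : ℂ → ℂ}
    (hk : ∀ z, ‖k z‖ ≤ Real.exp |z.im|) :
    ‖∫ t in (0 : ℝ)..2 * Real.pi, k (w * ((2 * Real.pi : ℝ) - t)) * (q t * y t)‖ ≤
      4 * Real.pi * K * c * Real.exp (|w.im| * (2 * Real.pi)) := by
  have hK0 : 0 ≤ K := (norm_nonneg _).trans (hK 0)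
  have := norm_integral_le_of_norm_le_const (a := (0 : ℝ)) (b := 2 * Real.pi)
    (C := 2 * K * c * Real.exp (|w.im| * (2 * Real.pi)))
    (f := fun t : ℝ => k (w * ((2 * Real.pi : ℝ) - t)) * (q t * y t)) (fun t ht => by
      rw [uIoc_of_le Real.two_pi_pos.le] at ht
      have ht' : t ∈ Icc 0 (2 * Real.pi) := ⟨ht.1.le, ht.2⟩
      have e1 : ‖k (w * ((2 * Real.pi : ℝ) - t))‖ ≤ Real.exp (|w.im| * (2 * Real.pi - t)) := by
        rw [← abs_im_mul_real w (sub_nonneg.2 ht.2)]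
        rw [Complex.ofReal_sub]
        exact hk _
      rw [norm_mul, norm_mul]
      calc _ ≤ Real.exp (|w.im| * (2 * Real.pi - t)) *
            (K * (2 * c * Real.exp (|w.im| * t))) := by
              gcongr
              · exact hK t
              · exact hy t ht'
        _ = Real.exp (|w.im| * (2 * Real.pi - t)) * Real.exp (|w.im| * t) * (2 * K * c) := by ring
        _ = _ := by rw [← Real.exp_add]; ring_nf)
  rw [sub_zero, abs_of_nonneg Real.two_pi_pos.le] at this
  refine this.trans (le_of_eq ?_)
  ring

theorem IsSol.norm_sub_cos_le (hq : Continuous q) {K : ℝ} (hK : ∀ x, ‖q x‖ ≤ K) (hw : w ≠ 0)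
    (hwK : 4 * Real.pi * K ≤ ‖w‖) (h : IsSol q (w ^ 2) y p) (h0 : y 0 = 1) (h1 : p 0 = 0) :
    ‖y (2 * Real.pi) - Complex.cos (w * (2 * Real.pi : ℝ))‖ ≤
      4 * Real.pi * K / ‖w‖ * Real.exp (|w.im| * (2 * Real.pi)) := by
  have hb : ∀ x ∈ Icc 0 (2 * Real.pi), ‖y x‖ ≤ 2 * 1 * Real.exp (|w.im| * x) := fun x hx =>
    h.norm_le hq hK hw hwK (fun x hx => by
      rw [h0, h1, ← abs_im_mul_real w hx]
      simpa using norm_cos_le (w * x)) hx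
  have := norm_volterra_integral_le (w := w) hK hb norm_sin_le
  rw [(h.volterra hq hw (2 * Real.pi)).1, h0, h1, mul_one, mul_zero, add_zero, add_sub_cancel_left]
  simp_rw [div_mul_eq_mul_div]
  rw [intervalIntegral.integral_div, norm_div]
  gcongr
  linarith

theorem IsSol.norm_sub_sin_le (hq : Continuous q) {K : ℝ} (hK : ∀ x, ‖q x‖ ≤ K) (hw : w ≠ 0)
    (hwK : 4 * Real.pi * K ≤ ‖w‖) (h : IsSol q (w ^ 2) y p) (h0 : y 0 = 0) (h1 : p 0 = 1) :
    ‖y (2 * Real.pi) - Complex.sin (w * (2 * Real.pi : ℝ)) / w‖ ≤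
        4 * Real.pi * K / ‖w‖ ^ 2 * Real.exp (|w.im| * (2 * Real.pi)) ∧
      ‖p (2 * Real.pi) - Complex.cos (w * (2 * Real.pi : ℝ))‖ ≤
        4 * Real.pi * K / ‖w‖ * Real.exp (|w.im| * (2 * Real.pi)) := by
  have hb : ∀ x ∈ Icc 0 (2 * Real.pi), ‖y x‖ ≤ 2 * (1 / ‖w‖) * Real.exp (|w.im| * x) :=
    fun x hx => h.norm_le hq hK hw hwK (fun x hx => by
      rw [h0, h1, ← abs_im_mul_real w hx, mul_zero, zero_add, mul_one, norm_div,
        one_div_mul_eq_div]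
      gcongr
      exact norm_sin_le (w * x)) hx
  have e1 := norm_volterra_integral_le (w := w) hK hb norm_sin_le
  have e2 := norm_volterra_integral_le (w := w) hK hb norm_cos_le
  have hv := h.volterra hq hw (2 * Real.pi)
  constructor
  · rw [hv.1, h0, h1, mul_one, mul_zero, zero_add, add_sub_cancel_left]
    simp_rw [div_mul_eq_mul_div]
    rw [intervalIntegral.integral_div, norm_div, div_le_iff₀ (norm_pos_iff.2 hw)]
    refine e1.trans (le_of_eq ?_)
    field_simp
  · rw [hv.2, h0, h1, mul_one, mul_zero, zero_add, add_sub_cancel_left]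
    refine e2.trans (le_of_eq ?_)
    ring

theorem norm_discriminant_sub_le (hq : Continuous q) (hper : Function.Periodic q (2 * Real.pi))
    {K : ℝ} (hK : ∀ x, ‖q x‖ ≤ K) (hw : w ≠ 0) (hwK : 4 * Real.pi * K ≤ ‖w‖) :
    ‖discriminant q (w ^ 2) - 2 * Complex.cos (w * (2 * Real.pi : ℝ))‖ ≤
      8 * Real.pi * K / ‖w‖ * Real.exp (|w.im| * (2 * Real.pi)) := by
  have h1 := (isSol_cosSol hq hper (w ^ 2)).norm_sub_cos_le hq hK hw hwK
    (cosSol_zero hq hper _) (cosSolDeriv_zero hq hper _)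
  have h2 := ((isSol_sinSol hq hper (w ^ 2)).norm_sub_sin_le hq hK hw hwK
    (sinSol_zero hq hper _) (sinSolDeriv_zero hq hper _)).2
  calc _ = ‖(cosSol q (w ^ 2) (2 * Real.pi) - Complex.cos (w * (2 * Real.pi : ℝ))) +
        (sinSolDeriv q (w ^ 2) (2 * Real.pi) - Complex.cos (w * (2 * Real.pi : ℝ)))‖ := by
        rw [discriminant]; ring_nf
    _ ≤ _ := (norm_add_le _ _).trans (add_le_add h1 h2)
    _ = _ := by ring

end

/-! ### Entire functions on expanding squares -/

/-- `w` lies on the boundary of the square with half-side `k + 1/4` centred at `0`. These squares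
stay away from the zeros `n / 2` of `sin (2πw)`. -/
def OnSquare (k : ℕ) (w : ℂ) : Prop := max |w.re| |w.im| = k + 1 / 4

theorem OnSquare.le_norm {k : ℕ} {w : ℂ} (h : OnSquare k w) : (k : ℝ) + 1 / 4 ≤ ‖w‖ := by
  rw [← h]
  exact max_le w.abs_re_le_norm w.abs_im_le_norm

theorem norm_sin_sq (z : ℂ) :
    ‖Complex.sin z‖ ^ 2 = Real.sin z.re ^ 2 + Real.sinh z.im ^ 2 ∧
    ‖Complex.sin z‖ ^ 2 = Real.sin z.re ^ 2 * Real.cosh z.im ^ 2 +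
      Real.cos z.re ^ 2 * Real.sinh z.im ^ 2 := by
  have h : ‖Complex.sin z‖ ^ 2 = Real.sin z.re ^ 2 * Real.cosh z.im ^ 2 +
      Real.cos z.re ^ 2 * Real.sinh z.im ^ 2 := by
    rw [Complex.sin_eq, ← Complex.normSq_eq_norm_sq, ← Complex.ofReal_sin, ← Complex.ofReal_cos,
      ← Complex.ofReal_cosh, ← Complex.ofReal_sinh, ← Complex.ofReal_mul, ← Complex.ofReal_mul,
      Complex.normSq_add_mul_I]
    ring
  refine ⟨?_, h⟩
  have h1 := Real.cosh_sq z.im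
  have h2 := Real.sin_sq_add_cos_sq z.re
  rw [h]
  linear_combination Real.sin z.re ^ 2 * h1 + Real.sinh z.im ^ 2 * h2

/-- On the squares `sin (2πw)` is as large as `e^{2π |Im w|}`, up to a constant. -/
theorem OnSquare.le_norm_sin {k : ℕ} {w : ℂ} (h : OnSquare k w) :
    Real.exp (|w.im| * (2 * Real.pi)) / 4 ≤ ‖Complex.sin (w * (2 * Real.pi : ℝ))‖ := by
  set z : ℂ := w * (2 * Real.pi : ℝ) with hz
  have him : |w.im| * (2 * Real.pi) = |z.im| := (abs_im_mul_real w Real.two_pi_pos.le).symm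
  have hre : z.re = w.re * (2 * Real.pi) := by simp [hz]
  rw [him]
  refine le_of_sq_le_sq ?_ (norm_nonneg _)
  have hpos := Real.exp_pos |z.im|
  have hpos' := Real.exp_pos (-|z.im|)
  rcases max_choice |w.re| |w.im| with hm | hm
  · -- on the vertical sides `sin (2π Re w) = ± 1`
    have hs : Real.sin z.re ^ 2 = 1 := by
      have h1 : |w.re| = k + 1 / 4 := by rw [← hm]; exact h
      have h2 : Real.sin ((k + 1 / 4) * (2 * Real.pi)) = 1 := by
        rw [show ((k : ℝ) + 1 / 4) * (2 * Real.pi) = Real.pi / 2 + k * (2 * Real.pi) by ring,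
          Real.sin_add_nat_mul_two_pi, Real.sin_pi_div_two]
      rw [hre]
      rcases abs_cases w.re with ⟨h3, -⟩ | ⟨h3, -⟩
      · rw [← h3, h1, h2]; norm_num
      · rw [show w.re = -(k + 1 / 4) by linarith, neg_mul, Real.sin_neg, h2]; norm_num
    have hc : Real.exp |z.im| / 2 ≤ Real.cosh z.im := by
      rw [← Real.cosh_abs, Real.cosh_eq]; linarith
    rw [(norm_sin_sq z).2, hs, one_mul]
    nlinarith [sq_nonneg (Real.cos z.re * Real.sinh z.im)]
  · have h1 : |w.im| = k + 1 / 4 := by rw [← hm]; exact h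
    have h2 : 1 ≤ |z.im| := by
      rw [← him, h1]
      nlinarith [Real.pi_gt_three, (Nat.cast_nonneg k : (0 : ℝ) ≤ k), Real.pi_pos]
    have h3 : Real.exp (-|z.im|) ≤ 1 := Real.exp_le_one_iff.2 (by linarith)
    have h4 : 2 ≤ Real.exp |z.im| := by linarith [Real.add_one_le_exp |z.im|]
    have hsh : Real.exp |z.im| / 4 ≤ |Real.sinh z.im| := by
      rw [Real.abs_sinh, Real.sinh_eq]; linarith
    rw [(norm_sin_sq z).1, ← sq_abs (Real.sinh z.im)]
    nlinarith [sq_nonneg (Real.sin z.re)]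

/-- The maximum principle on the squares: an entire function that decays on them vanishes. -/
theorem eq_zero_of_bound_onSquare {h : ℂ → ℂ} (hd : Differentiable ℂ h) {C r : ℝ}
    (hb : ∀ k w, OnSquare k w → r ≤ ‖w‖ → ‖h w‖ ≤ C / ‖w‖) (z : ℂ) : h z = 0 := by
  have key : ∀ᶠ k : ℕ in atTop, ‖h z‖ ≤ |C| / (k + 1 / 4) := by
    obtain ⟨k₀, hk₀⟩ := exists_nat_ge (max r ‖z‖)
    filter_upwards [eventually_ge_atTop k₀] with k hk
    have hk' : (k₀ : ℝ) ≤ k := by exact_mod_cast hk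
    set R : ℝ := k + 1 / 4 with hR
    have hR0 : 0 < R := by positivity
    have hzR : ‖z‖ < R := by linarith [le_max_right r ‖z‖]
    have hrR : r ≤ R := by linarith [le_max_left r ‖z‖]
    refine Complex.norm_le_of_forall_mem_frontier_norm_le
      (U := Ioo (-R) R ×ℂ Ioo (-R) R)
      ((Metric.isBounded_Ioo _ _).reProdIm (Metric.isBounded_Ioo _ _))
      hd.diffContOnCl (fun w hw => ?_) (subset_closure ?_)
    · have hlt : -R < R := by linarith
      rw [Complex.frontier_reProdIm, closure_Ioo hlt.ne, frontier_Ioo hlt] at hw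
      have hsq : OnSquare k w := by
        unfold OnSquare
        rw [← hR]
        rcases hw with ⟨h1, h2⟩ | ⟨h1, h2⟩
        · have h1' : |w.re| ≤ R := abs_le.2 h1
          have h2' : |w.im| = R := by
            have h3 : w.im = -R ∨ w.im = R := h2
            rcases h3 with h3 | h3 <;> simp [h3, abs_of_pos hR0]
          rw [h2', max_eq_right h1']
        · have h1' : |w.im| ≤ R := abs_le.2 h2
          have h2' : |w.re| = R := by
            have h3 : w.re = -R ∨ w.re = R := h1
            rcases h3 with h3 | h3 <;> simp [h3, abs_of_pos hR0]
          rw [h2', max_eq_left h1']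
      have hw := hsq.le_norm
      refine (hb k w hsq (hrR.trans hw)).trans ?_
      exact div_le_div₀ (abs_nonneg _) (le_abs_self C) hR0 hw
    · exact ⟨abs_lt.1 (z.abs_re_le_norm.trans_lt hzR), abs_lt.1 (z.abs_im_le_norm.trans_lt hzR)⟩
  have hlim : Tendsto (fun k : ℕ => |C| / ((k : ℝ) + 1 / 4)) atTop (𝓝 0) :=
    tendsto_const_nhds.div_atTop
      (tendsto_atTop_add_const_right _ _ tendsto_natCast_atTop_atTop)
  exact norm_le_zero_iff.1 (ge_of_tendsto hlim key)

/-- Division of entire functions: local analytic quotients glue. -/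
theorem exists_entire_quotient {f g : ℂ → ℂ} (hg : ∀ z, ∀ᶠ u in 𝓝[≠] z, g u ≠ 0)
    (hloc : ∀ z, ∃ k : ℂ → ℂ, AnalyticAt ℂ k z ∧ ∀ᶠ u in 𝓝 z, f u = g u * k u) :
    ∃ h : ℂ → ℂ, Differentiable ℂ h ∧ ∀ z, f z = g z * h z := by
  choose k hk hfk using hloc
  refine ⟨fun z => k z z, fun z => ?_, fun z => (hfk z).self_of_nhds⟩
  have : (fun u => k u u) =ᶠ[𝓝 z] k z := by
    have h1 : ∀ᶠ u in 𝓝[≠] z, k u u = k z u := by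
      filter_upwards [hg z, (hfk z).filter_mono nhdsWithin_le_nhds] with u hu hfu
      exact mul_left_cancel₀ hu ((hfk u).self_of_nhds.symm.trans hfu)
    have h2 := eventually_nhdsWithin_iff.1 h1
    filter_upwards [h2] with u hu
    by_cases huz : u = z
    · rw [huz]
    · exact hu huz
  exact ((hk z).congr this.symm).differentiableAt

theorem deriv_zero_of_even {h : ℂ → ℂ} (hd : Differentiable ℂ h) (heven : ∀ z, h (-z) = h z) :
    deriv h 0 = 0 := by
  have h1 : HasDerivAt (fun z => h (-z)) (-deriv h 0) 0 := by
    have := HasDerivAt.comp (h := fun z : ℂ => -z) (h₂ := h) (h₂' := deriv h 0) 0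
      (by simpa using (hd 0).hasDerivAt) (hasDerivAt_neg (0 : ℂ))
    simpa [Function.comp_def] using this
  rw [show (fun z => h (-z)) = h from funext heven] at h1
  have h2 := h1.unique (hd 0).hasDerivAt
  linear_combination (-1 / 2) * h2

/-- An even entire function of at most linear growth on the squares is constant. -/
theorem eq_const_of_even_of_bound_onSquare {h : ℂ → ℂ} (hd : Differentiable ℂ h)
    (heven : ∀ z, h (-z) = h z) {C r : ℝ}
    (hb : ∀ k w, OnSquare k w → r ≤ ‖w‖ → ‖h w‖ ≤ C * ‖w‖) (z : ℂ) : h z = h 0 := by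
  have hd1 : Differentiable ℂ (dslope h 0) := fun z =>
    ((Complex.differentiableOn_dslope (c := 0) (s := univ) (f := h) univ_mem).2
      hd.differentiableOn).differentiableAt univ_mem
  have hd2 : Differentiable ℂ (dslope (dslope h 0) 0) := fun z =>
    ((Complex.differentiableOn_dslope (c := 0) (s := univ) (f := dslope h 0) univ_mem).2
      hd1.differentiableOn).differentiableAt univ_mem
  have h0 : dslope h 0 0 = 0 := by
    rw [dslope_same, deriv_zero_of_even hd heven]
  -- `h` even makes `h - h 0` divisible by `w²`, and the quotient decays on the squares
  have hfac : ∀ w, h w - h 0 = w ^ 2 * dslope (dslope h 0) 0 w := by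
    intro w
    have e1 := sub_smul_dslope h 0 w
    have e2 := sub_smul_dslope (dslope h 0) 0 w
    simp only [sub_zero, smul_eq_mul, h0] at e1 e2
    rw [← e1, ← e2]
    ring
  have hz := eq_zero_of_bound_onSquare hd2 (C := |C| + ‖h 0‖) (r := max r 1)
    (fun k w hw hr => by
      have hw1 : 1 ≤ ‖w‖ := (le_max_right _ _).trans hr
      have hw0 : 0 < ‖w‖ := by linarith
      have e1 : ‖w‖ ^ 2 * ‖dslope (dslope h 0) 0 w‖ ≤ (|C| + ‖h 0‖) * ‖w‖ := by
        rw [← norm_pow, ← norm_mul, ← hfac]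
        refine (norm_sub_le _ _).trans ?_
        have e2 := hb k w hw ((le_max_left _ _).trans hr)
        nlinarith [le_abs_self C, norm_nonneg (h 0)]
      rw [le_div_iff₀ hw0]
      have e3 : ‖w‖ * (‖dslope (dslope h 0) 0 w‖ * ‖w‖) ≤ ‖w‖ * (|C| + ‖h 0‖) := by
        nlinarith
      exact le_of_mul_le_mul_left e3 hw0) z
  have := hfac z
  rw [hz, mul_zero] at this
  exact sub_eq_zero.1 this

theorem eventually_ne_zero_of_entire {g : ℂ → ℂ} (hg : Differentiable ℂ g) {z₁ : ℂ}
    (h1 : g z₁ ≠ 0) (z : ℂ) : ∀ᶠ u in 𝓝[≠] z, g u ≠ 0 := by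
  rcases (hg.analyticAt z).eventually_eq_zero_or_eventually_ne_zero with h | h
  · have ha : AnalyticOnNhd ℂ g univ := fun u _ => hg.analyticAt u
    exact absurd (ha.eqOn_zero_of_preconnected_of_eventuallyEq_zero isPreconnected_univ
      (mem_univ z) h (mem_univ z₁)) h1
  · exact h

/-- If every zero of `4 - D²` is also a zero of `D'`, then `D'² / (4 - D²)` is entire. -/
theorem exists_entire_quotient_deriv_sq {D : ℂ → ℂ} (hD : Differentiable ℂ D) {z₁ : ℂ}
    (hz₁ : 4 - D z₁ ^ 2 ≠ 0) (hzero : ∀ w, D w ^ 2 = 4 → deriv D w = 0) :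
    ∃ h : ℂ → ℂ, Differentiable ℂ h ∧ ∀ z, deriv D z ^ 2 = (4 - D z ^ 2) * h z := by
  have hg : Differentiable ℂ fun z => 4 - D z ^ 2 := (hD.pow 2).const_sub 4
  have hD' : Differentiable ℂ (deriv D) := hD.deriv
  refine exists_entire_quotient (fun z => eventually_ne_zero_of_entire hg hz₁ z) fun z => ?_
  by_cases hz : D z ^ 2 = 4
  · -- near `z`, `D - D z` has order `n ≥ 2` and `D'` has order `n - 1`, with `2 (n - 1) ≥ n`
    have ho := (hD.analyticAt z).analyticOrderAt_deriv_add_one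
    have h1 : analyticOrderAt (deriv D) z ≠ 0 := by
      rw [(hD'.analyticAt z).analyticOrderAt_ne_zero]
      exact hzero z hz
    have htop : analyticOrderAt (deriv D) z ≠ ⊤ := by
      intro ht
      rw [ht, top_add, eq_comm, analyticOrderAt_eq_top] at ho
      have hne := eventually_ne_zero_of_entire hg hz₁ z
      have := (hne.and (ho.filter_mono nhdsWithin_le_nhds)).exists
      obtain ⟨u, hu1, hu2⟩ := this
      rw [sub_eq_zero.1 hu2, hz] at hu1
      simp at hu1
    obtain ⟨n, hn⟩ := ENat.ne_top_iff_exists.1 htop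
    rw [← hn] at ho h1
    have hn1 : 1 ≤ n := Nat.one_le_iff_ne_zero.2 (by exact_mod_cast h1)
    obtain ⟨a, ha, ha0, hae⟩ := ((hD'.analyticAt z).analyticOrderAt_eq_natCast).1 hn.symm
    obtain ⟨b, hb, hb0, hbe⟩ := (((hD.sub_const (D z)).analyticAt z).analyticOrderAt_eq_natCast
      (n := n + 1)).1 (by rw [← ho]; push_cast; rfl)
    have hDz : D z ≠ 0 := by
      rintro h0
      rw [h0] at hz
      norm_num at hz
    have hne : -(b z * (D z + D z)) ≠ 0 := by
      rw [← two_mul]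
      exact neg_ne_zero.2 (mul_ne_zero hb0 (mul_ne_zero two_ne_zero hDz))
    have hden : AnalyticAt ℂ (fun u => -(b u * (D u + D z))) z :=
      (hb.mul ((hD.analyticAt z).add analyticAt_const)).neg
    refine ⟨fun u => (u - z) ^ (n - 1) * a u ^ 2 / (-(b u * (D u + D z))),
      ((((analyticAt_id.sub analyticAt_const).pow _).mul (ha.pow 2)).div hden hne), ?_⟩
    filter_upwards [hae, hbe, hden.continuousAt.eventually_ne hne] with u hu1 hu2 hu3
    rw [smul_eq_mul] at hu1 hu2
    have e1 : 4 - D u ^ 2 = (u - z) ^ (n + 1) * (-(b u * (D u + D z))) := by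
      linear_combination -hz - (D u + D z) * hu2
    obtain ⟨j, rfl⟩ : ∃ j, n = j + 1 := ⟨n - 1, by omega⟩
    rw [e1, hu1, Nat.add_sub_cancel]
    generalize -(b u * (D u + D z)) = d at hu3
    field_simp
    ring
  · have hne : 4 - D z ^ 2 ≠ 0 := fun h => hz (sub_eq_zero.1 h).symm
    refine ⟨fun u => deriv D u ^ 2 / (4 - D u ^ 2),
      ((hD'.analyticAt z).pow 2).div (hg.analyticAt z) hne, ?_⟩
    filter_upwards [(hg z).continuousAt.eventually_ne hne] with u hu
    rw [mul_div_cancel₀ _ hu]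

/-! ### Entire functions asymptotic to a cosine -/

/-- Cauchy's estimate on the unit circle around `w`. -/
theorem norm_deriv_le_of_exp_bound {E : ℂ → ℂ} (hE : Differentiable ℂ E) {C r : ℝ} (hC : 0 ≤ C)
    (hb : ∀ w, r ≤ ‖w‖ → ‖E w‖ ≤ C / ‖w‖ * Real.exp (|w.im| * (2 * Real.pi))) {w : ℂ}
    (hw : max r 1 + 1 ≤ ‖w‖) :
    ‖deriv E w‖ ≤ 2 * C * Real.exp (2 * Real.pi) / ‖w‖ * Real.exp (|w.im| * (2 * Real.pi)) := by
  have hr := le_max_left r 1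
  have h1 := le_max_right r 1
  have hw0 : 0 < ‖w‖ := by linarith
  have hb' : ∀ z ∈ Metric.sphere w 1, ‖E z‖ ≤
      2 * C * Real.exp (2 * Real.pi) / ‖w‖ * Real.exp (|w.im| * (2 * Real.pi)) := by
    intro z hz
    have hz' : ‖z - w‖ = 1 := mem_sphere_iff_norm.1 hz
    have e1 : ‖w‖ - 1 ≤ ‖z‖ := by
      have := norm_sub_norm_le w z
      rw [norm_sub_rev, hz'] at this
      linarith
    have e2 : |z.im| ≤ |w.im| + 1 := by
      have := (z - w).abs_im_le_norm
      rw [hz', Complex.sub_im] at this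
      have := abs_sub_abs_le_abs_sub z.im w.im
      linarith
    have hz0 : 0 < ‖z‖ := by linarith
    have e3 : C / ‖z‖ ≤ 2 * C / ‖w‖ := by
      rw [div_le_div_iff₀ hz0 hw0]
      nlinarith
    calc ‖E z‖ ≤ C / ‖z‖ * Real.exp (|z.im| * (2 * Real.pi)) := hb z (by linarith)
      _ ≤ 2 * C / ‖w‖ * Real.exp ((|w.im| + 1) * (2 * Real.pi)) := by
          have := Real.pi_pos
          gcongr
      _ = _ := by rw [add_mul, one_mul, Real.exp_add]; ring
  simpa using Complex.norm_deriv_le_of_forall_mem_sphere_norm_le one_pos hE.diffContOnCl hb'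

/-- The bounds behind `differential_identity`: with `D = 2c + E`, `D' = -4πs + F`, the quotient of
`D'² - 4π² (4 - D²)` by `4 - D²` is `O (1 / ‖w‖)`. Here `X` stands for `e^{2π |Im w|}`. -/
theorem quotient_bound {c s E F h : ℂ} {X δ C : ℝ} (hX0 : 0 < X) (hδ0 : 0 ≤ δ) (hδ : δ ≤ 1)
    (hcs : s ^ 2 + c ^ 2 = 1) (hc : ‖c‖ ≤ X) (hs : ‖s‖ ≤ X) (hs' : X / 4 ≤ ‖s‖)
    (hE : ‖E‖ ≤ C * δ * X) (hF : ‖F‖ ≤ C * δ * X) (hδC : δ * (8 * (4 * C + C ^ 2)) ≤ 1)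
    (hh : (-(4 * Real.pi * s) + F) ^ 2 = (4 - (2 * c + E) ^ 2) * (h + 4 * Real.pi ^ 2)) :
    4 - (2 * c + E) ^ 2 ≠ 0 ∧
    ‖h‖ ≤ 8 * (8 * Real.pi * C + C ^ 2 + 16 * Real.pi ^ 2 * C + 4 * Real.pi ^ 2 * C ^ 2) * δ := by
  have hδ2 : δ ^ 2 ≤ δ := by nlinarith
  have e1 : X ^ 2 / 8 ≤ ‖4 - (2 * c + E) ^ 2‖ := by
    have e2 : 4 - (2 * c + E) ^ 2 = 4 * s ^ 2 - (4 * c * E + E ^ 2) := by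
      linear_combination (-4) * hcs
    have e3 : ‖4 * c * E + E ^ 2‖ ≤ δ * (4 * C + C ^ 2) * X ^ 2 := by
      refine (norm_add_le _ _).trans ?_
      rw [norm_mul, norm_mul, norm_pow, Complex.norm_ofNat]
      calc 4 * ‖c‖ * ‖E‖ + ‖E‖ ^ 2 ≤ 4 * X * (C * δ * X) + (C * δ * X) ^ 2 := by gcongr
        _ = (4 * C * δ + C ^ 2 * δ ^ 2) * X ^ 2 := by ring
        _ ≤ (4 * C * δ + C ^ 2 * δ) * X ^ 2 := by gcongr
        _ = _ := by ring
    have e4 : X ^ 2 / 4 ≤ ‖4 * s ^ 2‖ := by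
      rw [norm_mul, norm_pow, Complex.norm_ofNat]
      nlinarith
    rw [e2]
    have e5 := norm_sub_norm_le (4 * s ^ 2) (4 * c * E + E ^ 2)
    nlinarith [sq_nonneg X]
  have hpos : 0 < ‖4 - (2 * c + E) ^ 2‖ := lt_of_lt_of_le (by positivity) e1
  refine ⟨norm_pos_iff.1 hpos, ?_⟩
  have e6 : (4 - (2 * c + E) ^ 2) * h =
      -(8 * Real.pi * s * F) + F ^ 2 + (16 * Real.pi ^ 2 * c * E + 4 * Real.pi ^ 2 * E ^ 2) := by
    linear_combination -hh + 16 * (Real.pi : ℂ) ^ 2 * hcs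
  set B : ℝ := 8 * Real.pi * C + C ^ 2 + 16 * Real.pi ^ 2 * C + 4 * Real.pi ^ 2 * C ^ 2 with hB
  have e7 : ‖(4 - (2 * c + E) ^ 2) * h‖ ≤ B * δ * X ^ 2 := by
    rw [e6]
    have hpi : ‖(Real.pi : ℂ)‖ = Real.pi := by
      rw [Complex.norm_real, Real.norm_of_nonneg Real.pi_pos.le]
    calc _ ≤ 8 * Real.pi * ‖s‖ * ‖F‖ + ‖F‖ ^ 2 +
          (16 * Real.pi ^ 2 * ‖c‖ * ‖E‖ + 4 * Real.pi ^ 2 * ‖E‖ ^ 2) := by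
          refine (norm_add_le _ _).trans (add_le_add ((norm_add_le _ _).trans ?_)
            ((norm_add_le _ _).trans ?_))
          · simp [abs_of_pos Real.pi_pos]
          · simp
      _ ≤ 8 * Real.pi * X * (C * δ * X) + (C * δ * X) ^ 2 +
          (16 * Real.pi ^ 2 * X * (C * δ * X) + 4 * Real.pi ^ 2 * (C * δ * X) ^ 2) := by
          have := Real.pi_pos
          gcongr
      _ = (8 * Real.pi * C * δ + C ^ 2 * δ ^ 2 + 16 * Real.pi ^ 2 * C * δ +
          4 * Real.pi ^ 2 * C ^ 2 * δ ^ 2) * X ^ 2 := by ring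
      _ ≤ (8 * Real.pi * C * δ + C ^ 2 * δ + 16 * Real.pi ^ 2 * C * δ +
          4 * Real.pi ^ 2 * C ^ 2 * δ) * X ^ 2 := by
          gcongr
      _ = _ := by rw [hB]; ring
  rw [norm_mul] at e7
  have e8 : X ^ 2 / 8 * ‖h‖ ≤ X ^ 2 / 8 * (8 * B * δ) :=
    (mul_le_mul_of_nonneg_right e1 (norm_nonneg _)).trans (e7.trans (le_of_eq (by ring)))
  exact le_of_mul_le_mul_left e8 (by positivity)

/-- An entire function asymptotic to `2 cos (2πw)` whose derivative vanishes wherever it equals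
`± 2` satisfies the differential equation of `2 cos (2πw)`. -/
theorem differential_identity {D : ℂ → ℂ} (hD : Differentiable ℂ D) {C r : ℝ} (hC : 0 ≤ C)
    (hb : ∀ w, r ≤ ‖w‖ → ‖D w - 2 * Complex.cos (w * (2 * Real.pi : ℝ))‖ ≤
      C / ‖w‖ * Real.exp (|w.im| * (2 * Real.pi)))
    (hzero : ∀ w, D w ^ 2 = 4 → deriv D w = 0) :
    (∃ z, 4 - D z ^ 2 ≠ 0) ∧ ∀ z, deriv D z ^ 2 = 4 * Real.pi ^ 2 * (4 - D z ^ 2) := by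
  set E : ℂ → ℂ := fun w => D w - 2 * Complex.cos (w * (2 * Real.pi : ℝ)) with hEdef
  have hE : Differentiable ℂ E := by fun_prop
  have hDE : ∀ w, D w = 2 * Complex.cos (w * (2 * Real.pi : ℝ)) + E w := fun w => by
    simp [hEdef]
  have hD' : ∀ w, deriv D w = -(4 * Real.pi * Complex.sin (w * (2 * Real.pi : ℝ))) + deriv E w := by
    intro w
    have h1 : HasDerivAt (fun w : ℂ => 2 * Complex.cos (w * (2 * Real.pi : ℝ)))
        (-(4 * Real.pi * Complex.sin (w * (2 * Real.pi : ℝ)))) w := by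
      have := ((Complex.hasDerivAt_cos (w * (2 * Real.pi : ℝ))).comp w
        ((hasDerivAt_id w).mul_const ((2 * Real.pi : ℝ) : ℂ))).const_mul 2
      refine this.congr_deriv ?_
      push_cast
      ring
    have h2 := h1.add (hE w).hasDerivAt
    rw [← h2.deriv]
    congr 1
    exact funext hDE
  -- `C'` serves the bounds of both `E` and its derivative
  set C' : ℝ := max C (2 * C * Real.exp (2 * Real.pi)) with hC'
  have hC'0 : 0 ≤ C' := hC.trans (le_max_left _ _)
  set r' : ℝ := max (max r 1 + 1) (8 * (4 * C' + C' ^ 2)) with hr'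
  -- on the squares the estimates of `quotient_bound` apply
  have hest : ∀ k w, OnSquare k w → r' ≤ ‖w‖ → ∀ h : ℂ,
      deriv D w ^ 2 = (4 - D w ^ 2) * (h + 4 * Real.pi ^ 2) → 4 - D w ^ 2 ≠ 0 ∧
      ‖h‖ ≤ 8 * (8 * Real.pi * C' + C' ^ 2 + 16 * Real.pi ^ 2 * C' + 4 * Real.pi ^ 2 * C' ^ 2) *
        (1 / ‖w‖) := by
    intro k w hk hw h hh
    have hw1 : max r 1 + 1 ≤ ‖w‖ := (le_max_left _ _).trans hw
    have hw2 : 8 * (4 * C' + C' ^ 2) ≤ ‖w‖ := (le_max_right _ _).trans hw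
    have hwr := le_max_left r 1
    have hw1' := le_max_right r 1
    have hw0 : 0 < ‖w‖ := by linarith
    rw [hD', hDE] at hh
    rw [hDE]
    have him := abs_im_mul_real w Real.two_pi_pos.le
    refine quotient_bound (X := Real.exp (|w.im| * (2 * Real.pi))) (Real.exp_pos _)
      (by positivity) ?_ (Complex.sin_sq_add_cos_sq _) ?_ ?_ hk.le_norm_sin ?_ ?_ ?_ hh
    · rw [div_le_one hw0]; linarith
    · rw [← him]; exact norm_cos_le _
    · rw [← him]; exact norm_sin_le _
    · refine (hb w (by linarith)).trans ?_
      rw [mul_one_div]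
      gcongr
      exact le_max_left _ _
    · refine (norm_deriv_le_of_exp_bound hE hC hb hw1).trans ?_
      rw [mul_one_div]
      gcongr
      exact le_max_right _ _
    · rw [one_div_mul_eq_div, div_le_one hw0]; exact hw2
  -- otherwise `D' = 0` everywhere, and the first part of `hest` applies with `h = 0`
  have hex : ∃ z, 4 - D z ^ 2 ≠ 0 := by
    by_contra! hall
    obtain ⟨k, hk⟩ := exists_nat_ge r'
    have hsq : OnSquare k ((k : ℝ) + 1 / 4 : ℝ) := by
      unfold OnSquare
      rw [Complex.ofReal_re, Complex.ofReal_im, abs_zero,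
        abs_of_pos (by positivity : (0 : ℝ) < k + 1 / 4), max_eq_left (by positivity)]
    refine (hest k _ hsq (hk.trans (by linarith [hsq.le_norm])) 0 ?_).1 (hall _)
    rw [hzero _ (by linear_combination -hall ((k : ℝ) + 1 / 4 : ℝ)), hall]
    ring
  refine ⟨hex, ?_⟩
  obtain ⟨z₁, hz₁⟩ := hex
  obtain ⟨h, hh, hfac⟩ := exists_entire_quotient_deriv_sq hD hz₁ hzero
  intro z
  have := eq_zero_of_bound_onSquare (hh.sub_const (4 * (Real.pi : ℂ) ^ 2)) (r := r')
    (C := 8 * (8 * Real.pi * C' + C' ^ 2 + 16 * Real.pi ^ 2 * C' + 4 * Real.pi ^ 2 * C' ^ 2))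
    (fun k w hk hw => by
      have := (hest k w hk hw (h w - 4 * (Real.pi : ℂ) ^ 2) (by rw [hfac, sub_add_cancel])).2
      rwa [mul_one_div] at this) z
  rw [hfac, sub_eq_zero.1 this]
  ring

/-- An even entire solution of `D'² = 4π² (4 - D²)` other than a constant is `± 2 cos (2πw)`. -/
theorem four_sub_sq_eq_of_differential_identity {D : ℂ → ℂ} (hD : Differentiable ℂ D)
    (heven : ∀ w, D (-w) = D w) (hex : ∃ z, 4 - D z ^ 2 ≠ 0)
    (hid : ∀ z, deriv D z ^ 2 = 4 * Real.pi ^ 2 * (4 - D z ^ 2)) (z : ℂ) :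
    4 - D z ^ 2 = 4 * Complex.sin (z * (2 * Real.pi : ℝ)) ^ 2 := by
  have hD1 := hD.deriv
  have hD2 := hD1.deriv
  have hode : ∀ z, deriv (deriv D) z = -(4 * Real.pi ^ 2 * D z) := by
    have h1 : ∀ z, deriv D z * (deriv (deriv D) z + 4 * Real.pi ^ 2 * D z) = 0 := by
      intro z
      have e1 := ((hD1 z).hasDerivAt.pow 2)
      have e2 := ((((hD z).hasDerivAt.pow 2).const_sub 4).const_mul (4 * (Real.pi : ℂ) ^ 2))
      rw [show (deriv D) ^ 2 = fun z => 4 * (Real.pi : ℂ) ^ 2 * (4 - (D ^ 2) z) from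
        funext fun z => hid z] at e1
      have e3 := e1.unique e2
      simp only [Nat.cast_ofNat, Nat.add_one_sub_one, pow_one] at e3
      linear_combination (1 / 2) * e3
    -- the case `D' = 0` identically would give `D² = 4`
    rcases AnalyticOnNhd.eq_zero_or_eq_zero_of_mul_eq_zero (U := univ)
      (f := deriv D) (g := fun z => deriv (deriv D) z + 4 * (Real.pi : ℂ) ^ 2 * D z)
      (fun z _ => hD1.analyticAt z)
      (fun z _ => (hD2.add (hD.const_mul _)).analyticAt z) (fun z _ => h1 z) isPreconnected_univ
      with h2 | h2
    · obtain ⟨z₁, hz₁⟩ := hex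
      have := hid z₁
      rw [h2 z₁ (mem_univ _), zero_pow two_ne_zero, eq_comm] at this
      have hpi : (4 : ℂ) * (Real.pi : ℂ) ^ 2 ≠ 0 := by
        simp [Real.pi_ne_zero]
      exact absurd ((mul_eq_zero.1 this).resolve_left hpi) hz₁
    · intro z
      linear_combination h2 z (mem_univ _)
  have hD0' := deriv_zero_of_even hD heven
  have hD0 : D 0 ^ 2 = 4 := by
    have := hid 0
    rw [hD0', zero_pow two_ne_zero, eq_comm] at this
    have hpi : (4 : ℂ) * (Real.pi : ℂ) ^ 2 ≠ 0 := by simp [Real.pi_ne_zero]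
    linear_combination -((mul_eq_zero.1 this).resolve_left hpi)
  -- the first-order factors `(D' ± 2πi D) e^{∓ 2πi w}` are constant
  have hfac : ∀ c : ℂ, c ^ 2 = -(4 * (Real.pi : ℂ) ^ 2) → ∀ z,
      deriv D z + c * D z = c * D 0 * Complex.exp (c * z) := by
    intro c hc z
    have h1 : ∀ z, HasDerivAt (fun z => (deriv D z + c * D z) * Complex.exp (-(c * z))) 0 z := by
      intro z
      refine (((hD1 z).hasDerivAt.add ((hD z).hasDerivAt.const_mul c)).mul
        ((((hasDerivAt_id z).const_mul c).neg).cexp)).congr_deriv ?_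
      simp only [hode, Pi.add_apply, id_eq, Pi.neg_apply]
      linear_combination (-(D z) * Complex.exp (-(c * z))) * hc
    have h2 := is_const_of_deriv_eq_zero (fun z => (h1 z).differentiableAt)
      (fun z => (h1 z).deriv) z 0
    simp only [hD0', zero_add, mul_zero, neg_zero, Complex.exp_zero, mul_one] at h2
    rw [← h2, mul_assoc, ← Complex.exp_add, neg_add_cancel, Complex.exp_zero, mul_one]
  have hI : (2 * Real.pi * Complex.I) ^ 2 = -(4 * (Real.pi : ℂ) ^ 2) := by
    rw [mul_pow, Complex.I_sq]
    ring
  have f1 := hfac (2 * Real.pi * Complex.I) hI z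
  have f2 := hfac (-(2 * Real.pi * Complex.I)) (by rw [neg_sq, hI]) z
  have hDz : D z = D 0 * Complex.cos (z * (2 * Real.pi : ℝ)) := by
    have hne : (2 * Real.pi * Complex.I : ℂ) ≠ 0 := by simp [Real.pi_ne_zero]
    refine mul_left_cancel₀ hne ?_
    rw [Complex.cos]
    push_cast
    rw [show z * (2 * (Real.pi : ℂ)) * Complex.I = 2 * Real.pi * Complex.I * z by ring,
      show -(z * (2 * (Real.pi : ℂ))) * Complex.I = -(2 * Real.pi * Complex.I) * z by ring]
    linear_combination (1 / 2) * f1 - (1 / 2) * f2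
  have hcs := Complex.sin_sq_add_cos_sq (z * (2 * Real.pi : ℝ))
  rw [hDz]
  linear_combination (-Complex.cos (z * (2 * Real.pi : ℝ)) ^ 2) * hD0 - 4 * hcs

/-! ### Floquet solutions with unimodular multiplier produce spectrum -/

/-- The resolvent bound in terms of the relation `H f = g`. -/
theorem exists_norm_le_of_mem_resolventSet {q : ℝ → ℂ} {lam : ℂ}
    (h : lam ∈ resolventSet (hillOperator q)) :
    ∃ C : ℝ, ∀ f g : L2, HillRel q f g → ‖f‖ ≤ C * ‖g - lam • f‖ := by
  obtain ⟨R, hR, -⟩ := h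
  refine ⟨‖R‖, fun f g hfg => ?_⟩
  obtain ⟨x, hx, hx'⟩ := (LinearPMap.mem_graph_iff _).1 ((mem_graph_hillOperator q f g).2 hfg)
  simp only at hx hx'
  have h1 := hR x
  rw [hx, hx'] at h1
  calc ‖f‖ = ‖R (g - lam • f)‖ := by rw [h1]
    _ ≤ _ := R.le_opNorm _

theorem eLpNorm_two_sq (f : ℝ → ℂ) :
    eLpNorm f 2 volume ^ 2 = ∫⁻ x, ‖f x‖ₑ ^ 2 := by
  have := eLpNorm_nnreal_pow_eq_lintegral (f := f) (μ := (volume : Measure ℝ))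
    (p := (2 : NNReal)) two_ne_zero
  simpa using this

/-- A `C²` function with continuous data lies in the domain of `H`. -/
theorem hillRel_of_hasDerivAt {q u u' u'' : ℝ → ℂ}
    (hu : ∀ x, HasDerivAt u (u' x) x) (hu' : ∀ x, HasDerivAt u' (u'' x) x)
    (hu'' : Continuous u'') {f g : L2} (hf : (f : ℝ → ℂ) =ᵐ[volume] u)
    (hg : (g : ℝ → ℂ) =ᵐ[volume] fun x => q x * u x - u'' x) : HillRel q f g := by
  have h : u'' =ᵐ[volume] fun t => q t * u t - g t := by
    filter_upwards [hg] with t ht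
    rw [ht]
    ring
  refine ⟨u, u', hf, hu, fun a b => ⟨?_, ?_⟩⟩
  · exact (hu''.intervalIntegrable a b).congr_ae (ae_restrict_of_ae h)
  · rw [← integral_eq_sub_of_hasDerivAt (fun x _ => hu' x) (hu''.intervalIntegrable a b)]
    exact intervalIntegral.integral_congr_ae (h.mono fun t ht _ => ht)

theorem exists_smoothTransition_deriv :
    ∃ s' s'' : ℝ → ℝ, ∃ c : ℝ, (∀ x, HasDerivAt Real.smoothTransition (s' x) x) ∧
      (∀ x, HasDerivAt s' (s'' x) x) ∧ Continuous s'' ∧ (∀ x, |s' x| ≤ c) ∧ (∀ x, |s'' x| ≤ c) ∧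
      ∀ x, x ∉ Icc (0 : ℝ) 1 → s' x = 0 ∧ s'' x = 0 := by
  have hs : ContDiff ℝ 2 Real.smoothTransition := Real.smoothTransition.contDiff (n := 2)
  have hs1 : ContDiff ℝ 1 (deriv Real.smoothTransition) := hs.deriv' (n := 1)
  have hs2 : Continuous (deriv (deriv Real.smoothTransition)) := hs1.continuous_deriv le_rfl
  have hzero : ∀ x, x ∉ Icc (0 : ℝ) 1 → ∃ a : ℝ, Real.smoothTransition =ᶠ[𝓝 x] fun _ => a := by
    intro x hx
    rw [mem_Icc, not_and_or, not_le, not_le] at hx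
    rcases hx with hx | hx
    · exact ⟨0, (eventually_lt_nhds hx).mono fun t ht => Real.smoothTransition.zero_of_nonpos ht.le⟩
    · exact ⟨1, (eventually_gt_nhds hx).mono fun t ht => Real.smoothTransition.one_of_one_le ht.le⟩
  have h0 : ∀ x, x ∉ Icc (0 : ℝ) 1 →
      deriv Real.smoothTransition x = 0 ∧ deriv (deriv Real.smoothTransition) x = 0 := by
    intro x hx
    obtain ⟨a, ha⟩ := hzero x hx
    have h1 := ha.deriv
    simp only [deriv_const'] at h1
    have h2 := h1.deriv
    simp only [deriv_const'] at h2
    exact ⟨h1.eq_of_nhds, h2.eq_of_nhds⟩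
  obtain ⟨c₁, hc₁⟩ := isCompact_Icc.exists_bound_of_continuousOn (s := Icc (0 : ℝ) 1)
    hs1.continuous.continuousOn
  obtain ⟨c₂, hc₂⟩ := isCompact_Icc.exists_bound_of_continuousOn (s := Icc (0 : ℝ) 1)
    hs2.continuousOn
  have hc₁0 : 0 ≤ c₁ := (norm_nonneg _).trans (hc₁ 0 ⟨le_rfl, zero_le_one⟩)
  refine ⟨_, _, max c₁ c₂, fun x => ((hs.differentiable two_ne_zero) x).hasDerivAt,
    fun x => ((hs1.differentiable one_ne_zero) x).hasDerivAt, hs2, fun x => ?_, fun x => ?_, h0⟩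
  · by_cases hx : x ∈ Icc (0 : ℝ) 1
    · exact (hc₁ x hx).trans (le_max_left _ _)
    · rw [(h0 x hx).1, abs_zero]
      exact hc₁0.trans (le_max_left _ _)
  · by_cases hx : x ∈ Icc (0 : ℝ) 1
    · exact (hc₂ x hx).trans (le_max_right _ _)
    · rw [(h0 x hx).2, abs_zero]
      exact hc₁0.trans (le_max_left _ _)

/-- A nonzero solution `y` with `y (x + 2π) = ρ y x`, `|ρ| = 1`, puts `lam` into the spectrum: cut
off smoothly outside `[0, 2πN + 2]`, it has norm growing with `N`, while the error made by the
cutoff stays bounded. -/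
theorem mem_spectrum_of_floquet {q : ℝ → ℂ} (hq : Continuous q) {lam ρ : ℂ} {y p : ℝ → ℂ}
    (h : IsSol q lam y p) (hne : ∃ x, y x ≠ 0) (hρ : ‖ρ‖ = 1)
    (hfl : ∀ x, y (x + 2 * Real.pi) = ρ * y x) :
    lam ∈ spectrum (hillOperator q) := by
  intro hres
  obtain ⟨C, hC⟩ := exists_norm_le_of_mem_resolventSet hres
  obtain ⟨s', s'', c, hs, hs', hs''c, hs'b, hs''b, hs0⟩ := exists_smoothTransition_deriv
  have hc0 : 0 ≤ c := (abs_nonneg _).trans (hs'b 0)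
  have hflp : ∀ x, p (x + 2 * Real.pi) = ρ * p x := by
    intro x
    have h1 := (h.hasDerivAt (x + 2 * Real.pi)).comp_add_const x (2 * Real.pi)
    rw [show (fun x => y (x + 2 * Real.pi)) = fun x => ρ * y x from funext hfl] at h1
    exact h1.unique ((h.hasDerivAt x).const_mul ρ)
  have hper : Function.Periodic (fun x => ‖y x‖) (2 * Real.pi) := fun x => by
    simp [hfl, hρ]
  have hperp : Function.Periodic (fun x => ‖p x‖) (2 * Real.pi) := fun x => by
    simp [hflp, hρ]
  have hyc := h.continuous
  have hpc := h.continuous_deriv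
  obtain ⟨K₁, hK₁⟩ := (hper.isBounded_of_continuous Real.two_pi_pos.ne'
    hyc.norm).exists_norm_le
  obtain ⟨K₂, hK₂⟩ := (hperp.isBounded_of_continuous Real.two_pi_pos.ne'
    hpc.norm).exists_norm_le
  have hK₁' : ∀ x, ‖y x‖ ≤ K₁ := fun x => by simpa using hK₁ _ (mem_range_self x)
  have hK₂' : ∀ x, ‖p x‖ ≤ K₂ := fun x => by simpa using hK₂ _ (mem_range_self x)
  have hsb : ∀ x, |Real.smoothTransition x| ≤ 1 := fun x => by
    rw [abs_of_nonneg (Real.smoothTransition.nonneg x)]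
    exact Real.smoothTransition.le_one x
  set B : ℝ := (c + 2 * c ^ 2 + c) * K₁ + 2 * (c + c) * K₂ with hB
  set J : ℝ := ∫ x in (1 : ℝ)..1 + 2 * Real.pi, ‖y x‖ ^ 2 with hJ
  have hJ0 : 0 < J := by
    obtain ⟨x, hx⟩ := hne
    obtain ⟨t, ht, hxt⟩ := hper.exists_mem_Ico Real.two_pi_pos x 1
    refine intervalIntegral.integral_pos (by linarith [Real.pi_pos]) (by fun_prop)
      (fun x _ => by positivity) ⟨t, ⟨ht.1, ht.2.le⟩, ?_⟩
    have h1 : 0 < ‖y t‖ := hxt ▸ norm_pos_iff.2 hx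
    positivity
  -- the estimate for the cutoff at `2πN + 2`
  have key : ∀ N : ℕ, N * J ≤ (|C| * (2 * B)) ^ 2 := by
    intro N
    set T : ℝ := 2 + 2 * Real.pi * N with hT
    have hT2 : 2 ≤ T := by
      have : 0 ≤ 2 * Real.pi * N := by positivity
      linarith
    set χ : ℝ → ℝ := fun x => Real.smoothTransition x * Real.smoothTransition (T - x) with hχ
    set χ' : ℝ → ℝ := fun x => s' x * Real.smoothTransition (T - x) -
      Real.smoothTransition x * s' (T - x) with hχ'
    set χ'' : ℝ → ℝ := fun x => s'' x * Real.smoothTransition (T - x) - 2 * (s' x * s' (T - x)) +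
      Real.smoothTransition x * s'' (T - x) with hχ''
    have hsc : Continuous Real.smoothTransition := Real.smoothTransition.continuous
    have hs'c : Continuous s' := continuous_iff_continuousAt.2 fun x => (hs' x).continuousAt
    have hχd : ∀ x, HasDerivAt χ (χ' x) x := fun x =>
      ((hs x).mul ((hs (T - x)).comp_const_sub T x)).congr_deriv (by simp only [hχ']; ring)
    have hχd' : ∀ x, HasDerivAt χ' (χ'' x) x := fun x =>
      (((hs' x).mul ((hs (T - x)).comp_const_sub T x)).sub
        ((hs x).mul ((hs' (T - x)).comp_const_sub T x))).congr_deriv (by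
          simp only [hχ'']; ring)
    have hχc : Continuous χ := by fun_prop
    have hχ'c : Continuous χ' := by fun_prop
    have hχ''c : Continuous χ'' := by fun_prop
    have hχ0 : ∀ x, x ∉ Icc 0 T → χ x = 0 := by
      intro x hx
      rw [mem_Icc, not_and_or, not_le, not_le] at hx
      rcases hx with hx | hx
      · simp [hχ, Real.smoothTransition.zero_of_nonpos hx.le]
      · simp [hχ, Real.smoothTransition.zero_of_nonpos (by linarith : T - x ≤ 0)]
    have hχ1 : ∀ x ∈ Icc 1 (T - 1), χ x = 1 := by
      intro x hx
      simp [hχ, Real.smoothTransition.one_of_one_le hx.1,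
        Real.smoothTransition.one_of_one_le (by linarith [hx.2] : 1 ≤ T - x)]
    set S : Set ℝ := Icc 0 1 ∪ Icc (T - 1) T with hS
    have hχS : ∀ x, x ∉ S → χ' x = 0 ∧ χ'' x = 0 := by
      intro x hx
      rw [hS, mem_union, not_or] at hx
      have h1 := hs0 x hx.1
      have h2 := hs0 (T - x) (fun h => hx.2 ⟨by linarith [h.2], by linarith [h.1]⟩)
      simp [hχ', hχ'', h1, h2]
    have hχ'b : ∀ x, |χ' x| ≤ c + c := by
      intro x
      refine (abs_sub _ _).trans (add_le_add ?_ ?_) <;> rw [abs_mul]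
      · exact (mul_le_of_le_one_right (abs_nonneg _) (hsb _)).trans (hs'b x)
      · exact (mul_le_of_le_one_left (abs_nonneg _) (hsb _)).trans (hs'b _)
    have hχ''b : ∀ x, |χ'' x| ≤ c + 2 * c ^ 2 + c := by
      intro x
      refine (abs_add_le _ _).trans (add_le_add ((abs_sub _ _).trans (add_le_add ?_ ?_)) ?_) <;>
        rw [abs_mul]
      · exact (mul_le_of_le_one_right (abs_nonneg _) (hsb _)).trans (hs''b x)
      · rw [abs_mul, abs_two, sq]
        exact mul_le_mul_of_nonneg_left (mul_le_mul (hs'b _) (hs'b _) (abs_nonneg _) hc0) two_pos.le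
      · exact (mul_le_of_le_one_left (abs_nonneg _) (hsb _)).trans (hs''b _)
    set u : ℝ → ℂ := fun x => (χ x : ℂ) * y x with hu
    set e : ℝ → ℂ := fun x => (χ'' x : ℂ) * y x + 2 * χ' x * p x with he
    have huc : Continuous u := by fun_prop
    have hec : Continuous e := by fun_prop
    have husupp : HasCompactSupport u := HasCompactSupport.intro (isCompact_Icc (a := 0) (b := T))
      fun x hx => by simp [hu, hχ0 x hx]
    have hesupp : HasCompactSupport e := HasCompactSupport.intro
      ((isCompact_Icc (a := (0 : ℝ)) (b := 1)).union (isCompact_Icc (a := T - 1) (b := T)))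
      fun x hx => by simp [he, hχS x hx]
    have hum : MemLp u 2 (volume : Measure ℝ) := huc.memLp_of_hasCompactSupport husupp
    have hem : MemLp e 2 (volume : Measure ℝ) := hec.memLp_of_hasCompactSupport hesupp
    have hrel : HillRel q hum.toLp (lam • hum.toLp - hem.toLp) := by
      refine hillRel_of_hasDerivAt (u := u) (u' := fun x => (χ' x : ℂ) * y x + χ x * p x)
        (u'' := fun x => e x + χ x * ((q x - lam) * y x)) (fun x => ?_) (fun x => ?_)
        (by fun_prop) hum.coeFn_toLp ?_
      · exact (hχd x).ofReal_comp.mul (h.hasDerivAt x)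
      · refine (((hχd' x).ofReal_comp.mul (h.hasDerivAt x)).add
          ((hχd x).ofReal_comp.mul (h.hasDerivAt_deriv x))).congr_deriv ?_
        simp only [he]
        ring
      · filter_upwards [Lp.coeFn_sub (lam • hum.toLp) hem.toLp, Lp.coeFn_smul lam hum.toLp,
          hum.coeFn_toLp, hem.coeFn_toLp] with x h1 h2 h3 h4
        rw [h1, Pi.sub_apply, h2, Pi.smul_apply, h3, h4, smul_eq_mul]
        simp only [hu]
        ring
    have h1 := hC _ _ hrel
    rw [sub_sub_cancel_left, norm_neg, Lp.norm_toLp, Lp.norm_toLp] at h1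
    have hB0 : 0 ≤ B := by
      have := (norm_nonneg _).trans (hK₁' 0)
      have := (norm_nonneg _).trans (hK₂' 0)
      positivity
    have hele : (eLpNorm e 2 volume).toReal ≤ 2 * B := by
      refine ENNReal.toReal_le_of_le_ofReal (by positivity) ?_
      refine (ENNReal.pow_le_pow_left_iff two_ne_zero).1 ?_
      rw [eLpNorm_two_sq]
      calc ∫⁻ x, ‖e x‖ₑ ^ 2 ≤ ∫⁻ x, S.indicator (fun _ => ENNReal.ofReal B ^ 2) x := by
            refine lintegral_mono fun x => ?_
            by_cases hx : x ∈ S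
            · rw [indicator_of_mem hx]
              gcongr
              rw [← ofReal_norm]
              refine ENNReal.ofReal_le_ofReal ((norm_add_le _ _).trans ?_)
              rw [norm_mul, norm_mul, norm_mul, Complex.norm_real, Complex.norm_real,
                Complex.norm_ofNat, hB]
              have e1 := hχ'b x
              have e2 := hχ''b x
              have e3 := hK₁' x
              have e4 := hK₂' x
              rw [← Real.norm_eq_abs] at e1 e2
              gcongr
            · simp [indicator_of_notMem hx, he, hχS x hx]
        _ = ENNReal.ofReal B ^ 2 * volume S := by
            rw [lintegral_indicator_const (measurableSet_Icc.union measurableSet_Icc)]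
        _ ≤ ENNReal.ofReal B ^ 2 * 2 := by
            gcongr
            refine (measure_union_le _ _).trans ?_
            rw [Real.volume_Icc, Real.volume_Icc, sub_zero, sub_sub_cancel, ENNReal.ofReal_one]
            norm_num
        _ ≤ ENNReal.ofReal (2 * B) ^ 2 := by
            rw [ENNReal.ofReal_mul two_pos.le, mul_pow, mul_comm]
            gcongr
            norm_num
    have hlow : N * J ≤ (eLpNorm u 2 volume).toReal ^ 2 := by
      rw [← ENNReal.toReal_pow, eLpNorm_two_sq]
      have hfin : ∫⁻ x, ‖u x‖ₑ ^ 2 ≠ ⊤ := by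
        rw [← eLpNorm_two_sq]
        exact ENNReal.pow_ne_top hum.2.ne
      rw [← ENNReal.ofReal_le_iff_le_toReal hfin]
      have hle : (1 : ℝ) ≤ 1 + N * (2 * Real.pi) := by
        have : 0 ≤ N * (2 * Real.pi) := by positivity
        linarith
      have hsum : N * J = ∫ x in Ioc 1 (1 + N * (2 * Real.pi)), ‖y x‖ ^ 2 := by
        have hper2 : Function.Periodic (fun x => ‖y x‖ ^ 2) (2 * Real.pi) := fun x => by
          simp [hfl, hρ]
        have := hper2.intervalIntegral_add_zsmul_eq N 1
          (fun a b => (by fun_prop : Continuous fun x => ‖y x‖ ^ 2).intervalIntegrable a b)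
        rw [zsmul_eq_mul, zsmul_eq_mul, Int.cast_natCast] at this
        rw [hJ, ← this, intervalIntegral.integral_of_le hle]
      rw [hsum, ofReal_integral_eq_lintegral_ofReal
        ((by fun_prop : Continuous fun x => ‖y x‖ ^ 2).integrableOn_Ioc)
        (Eventually.of_forall fun x => by positivity)]
      refine (lintegral_mono_ae ?_).trans (setLIntegral_le_lintegral (Ioc 1 (1 + N * (2 * Real.pi)))
        fun x => ‖u x‖ₑ ^ 2)
      refine (ae_restrict_iff' measurableSet_Ioc).2 (Eventually.of_forall fun x hx => ?_)
      have : χ x = 1 := hχ1 x ⟨hx.1.le, by rw [hT]; linarith [hx.2]⟩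
      rw [ENNReal.ofReal_pow (norm_nonneg _), ofReal_norm]
      simp [hu, this]
    refine hlow.trans (pow_le_pow_left₀ ENNReal.toReal_nonneg ?_ 2)
    calc _ ≤ C * (eLpNorm e 2 volume).toReal := h1
      _ ≤ |C| * (2 * B) :=
        mul_le_mul (le_abs_self C) hele ENNReal.toReal_nonneg (abs_nonneg C)
  obtain ⟨N, hN⟩ := exists_nat_gt ((|C| * (2 * B)) ^ 2 / J)
  rw [div_lt_iff₀ hJ0] at hN
  exact absurd (key N) (not_le.2 hN)

/-! ### Integration by parts against primitives, and Schur's test -/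

theorem intervalIntegrable_of_locallyIntegrable {f : ℝ → ℂ} (hf : LocallyIntegrable f volume)
    (a b : ℝ) : IntervalIntegrable f volume a b :=
  intervalIntegrable_iff.2 ((hf.integrableOn_isCompact isCompact_uIcc).mono_set uIoc_subset_uIcc)

theorem absolutelyContinuousOnInterval_primitive {f : ℝ → ℂ} (hf : LocallyIntegrable f volume)
    (a b : ℝ) : AbsolutelyContinuousOnInterval (fun x => ∫ t in a..x, f t) a b := by
  have hint : ∀ x y, IntervalIntegrable f volume x y := fun x y =>
    intervalIntegrable_of_locallyIntegrable hf x y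
  have hre : ∀ x y, IntervalIntegrable (fun t => (f t).re) volume x y := fun x y =>
    ⟨(hint x y).1.re, (hint x y).2.re⟩
  have him : ∀ x y, IntervalIntegrable (fun t => (f t).im) volume x y := fun x y =>
    ⟨(hint x y).1.im, (hint x y).2.im⟩
  have h1 := ((hre a b).absolutelyContinuousOnInterval_intervalIntegral (c := a) left_mem_uIcc)
  have h2 := ((him a b).absolutelyContinuousOnInterval_intervalIntegral (c := a) left_mem_uIcc)
  have hc : ∀ z : ℂ, AbsolutelyContinuousOnInterval (fun _ : ℝ => z) a b := fun z =>
    (LipschitzWith.const z).lipschitzOnWith.absolutelyContinuousOnInterval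
  have h3 := (h1.smul (hc 1)).add (h2.smul (hc Complex.I))
  refine (congrArg (AbsolutelyContinuousOnInterval · a b) (funext fun x => ?_)).mp h3
  simp only [Pi.add_apply, Pi.smul_apply', Complex.real_smul, mul_one]
  have e1 : IntervalIntegrable (fun t => ((f t).re : ℂ)) volume a x :=
    ⟨(hre a x).1.ofReal, (hre a x).2.ofReal⟩
  have e2 : IntervalIntegrable (fun t => ((f t).im : ℂ)) volume a x :=
    ⟨(him a x).1.ofReal, (him a x).2.ofReal⟩
  rw [← intervalIntegral.integral_ofReal, ← intervalIntegral.integral_ofReal,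
    ← intervalIntegral.integral_mul_const, ← intervalIntegral.integral_add e1 (e2.mul_const _)]
  simp only [Complex.re_add_im]

/-- Integration by parts of a `C¹` function against a primitive of a locally integrable one. -/
theorem mul_sub_mul_eq_integral {f F g g' : ℝ → ℂ} (hf : LocallyIntegrable f volume)
    (hF : ∀ x, F x = F 0 + ∫ t in (0 : ℝ)..x, f t) (hg : ∀ x, HasDerivAt g (g' x) x)
    (hg' : Continuous g') (a b : ℝ) :
    IntervalIntegrable (fun t => g' t * F t + g t * f t) volume a b ∧
    g b * F b - g a * F a = ∫ t in a..b, (g' t * F t + g t * f t) := by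
  have hint : ∀ x y, IntervalIntegrable f volume x y := fun x y =>
    intervalIntegrable_of_locallyIntegrable hf x y
  have hFc : Continuous F := by
    rw [show F = fun x => F 0 + ∫ t in (0 : ℝ)..x, f t from funext hF]
    exact continuous_const.add (intervalIntegral.continuous_primitive hint 0)
  have hgc : Continuous g := continuous_iff_continuousAt.2 fun x => (hg x).continuousAt
  have hloc : LocallyIntegrable (fun t => g' t * F t + g t * f t) volume :=
    (hg'.mul hFc).locallyIntegrable.add
      ((locallyIntegrableOn_univ.1 ((locallyIntegrableOn_univ.2 hf).continuousOn_mul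
        hgc.continuousOn isOpen_univ.isLocallyClosed)))
  have hFd : ∀ᵐ x, HasDerivAt F (f x) x := by
    filter_upwards [LocallyIntegrable.ae_hasDerivAt_integral hf] with x hx
    rw [show F = fun x => F 0 + ∫ t in (0 : ℝ)..x, f t from funext hF]
    exact (hx 0).const_add _
  have hFac : AbsolutelyContinuousOnInterval F a b := by
    have h1 := absolutelyContinuousOnInterval_primitive hf a b
    have h2 : AbsolutelyContinuousOnInterval (fun _ : ℝ => F a) a b :=
      (LipschitzWith.const _).lipschitzOnWith.absolutelyContinuousOnInterval
    refine (congrArg (AbsolutelyContinuousOnInterval · a b) (funext fun x => ?_)).mp (h2.add h1)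
    simp only [Pi.add_apply]
    rw [hF x, hF a, add_assoc, integral_add_adjacent_intervals (hint _ _) (hint _ _)]
  have hgC : ContDiff ℝ 1 g := contDiff_one_iff_deriv.2
    ⟨fun x => (hg x).differentiableAt, by
      rwa [show deriv g = g' from funext fun x => (hg x).deriv]⟩
  have hac := (hgC.contDiffOn.absolutelyContinuousOnInterval (a := a) (b := b)).smul hFac
  obtain ⟨C, hC⟩ := (hac.sub
      (absolutelyContinuousOnInterval_primitive hloc a b)).const_of_ae_hasDerivAt_zero (by
    filter_upwards [hFd, LocallyIntegrable.ae_hasDerivAt_integral hloc] with x h1 h2 _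
    refine (((hg x).mul h1).sub (h2 a)).congr_deriv ?_
    ring)
  have h1 := hC a left_mem_uIcc
  have h2 := hC b right_mem_uIcc
  simp only [Pi.sub_apply, smul_eq_mul, Pi.mul_apply, intervalIntegral.integral_same,
    sub_zero] at h1 h2
  refine ⟨intervalIntegrable_of_locallyIntegrable hloc a b, ?_⟩
  linear_combination h2 - h1

/-- Schur's test for a convolution kernel on `ℝ`: `‖k ⋆ F‖₂ ≤ ‖k‖₁ ‖F‖₂`. -/
theorem lintegral_convolution_sq_le {k F : ℝ → ENNReal} (hk : Measurable k) (hF : Measurable F) :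
    ∫⁻ x, (∫⁻ t, k (x - t) * F t) ^ 2 ≤ (∫⁻ x, k x) ^ 2 * ∫⁻ x, F x ^ 2 := by
  have hroot : ∀ a : ENNReal, (a ^ (1 / 2 : ℝ)) ^ 2 = a := fun a => by
    rw [← ENNReal.rpow_natCast, ← ENNReal.rpow_mul]
    norm_num
  have hroot' : ∀ a : ENNReal, (a ^ (1 / 2 : ℝ)) ^ (2 : ℝ) = a := fun a => by
    rw [← ENNReal.rpow_mul]
    norm_num
  have htrans : ∀ x, ∫⁻ t, k (x - t) = ∫⁻ x, k x := fun x => lintegral_sub_left_eq_self k x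
  -- the Cauchy-Schwarz inequality, applied to `k = √k √k`
  have hCS : ∀ x, (∫⁻ t, k (x - t) * F t) ^ 2 ≤ (∫⁻ x, k x) * ∫⁻ t, k (x - t) * F t ^ 2 := by
    intro x
    have hkx : Measurable fun t => k (x - t) := hk.comp (measurable_const.sub measurable_id)
    have h := ENNReal.lintegral_mul_le_Lp_mul_Lq volume (p := 2) (q := 2)
      (Real.holderConjugate_iff.2 ⟨by norm_num, by norm_num⟩)
      (f := fun t => k (x - t) ^ (1 / 2 : ℝ)) (g := fun t => k (x - t) ^ (1 / 2 : ℝ) * F t)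
      (hkx.pow_const _).aemeasurable ((hkx.pow_const _).mul hF).aemeasurable
    have e1 : ∀ t, ((fun t => k (x - t) ^ (1 / 2 : ℝ)) *
        fun t => k (x - t) ^ (1 / 2 : ℝ) * F t) t = k (x - t) * F t := fun t => by
      rw [Pi.mul_apply, ← mul_assoc, ← sq, hroot]
    have e2 : ∀ t, (k (x - t) ^ (1 / 2 : ℝ) * F t) ^ (2 : ℝ) = k (x - t) * F t ^ 2 := fun t => by
      rw [ENNReal.mul_rpow_of_nonneg _ _ two_pos.le, hroot']
      norm_num
    simp_rw [e1, e2, hroot'] at h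
    calc _ ≤ _ := pow_le_pow_left₀ zero_le h 2
      _ = _ := by rw [mul_pow, hroot, hroot, htrans]
  calc _ ≤ ∫⁻ x, (∫⁻ x, k x) * ∫⁻ t, k (x - t) * F t ^ 2 := lintegral_mono hCS
    _ = (∫⁻ x, k x) * ∫⁻ x, ∫⁻ t, k (x - t) * F t ^ 2 := by
        rw [lintegral_const_mul]
        exact Measurable.lintegral_prod_right (by fun_prop)
    _ = (∫⁻ x, k x) * ∫⁻ t, ∫⁻ x, k (x - t) * F t ^ 2 := by
        rw [lintegral_lintegral_swap]
        exact Measurable.aemeasurable (by fun_prop)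
    _ = (∫⁻ x, k x) * ∫⁻ t, (∫⁻ x, k x) * F t ^ 2 := by
        congr 2
        ext t
        rw [lintegral_mul_const _ (by fun_prop), lintegral_sub_right_eq_self k t]
    _ = _ := by
        rw [lintegral_const_mul _ (by fun_prop)]
        ring

theorem lintegral_exp_neg_abs_lt_top {κ : ℝ} (hκ : 0 < κ) :
    ∫⁻ x : ℝ, ENNReal.ofReal (Real.exp (-(κ * |x|))) < ⊤ := by
  rw [← lintegral_add_compl _ (measurableSet_Iic (a := (0 : ℝ))), compl_Iic]
  refine ENNReal.add_lt_top.2 ⟨?_, ?_⟩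
  · rw [setLIntegral_congr_fun (g := fun x : ℝ => ENNReal.ofReal (Real.exp (κ * x)))
      measurableSet_Iic fun x hx => by simp [abs_of_nonpos (mem_Iic.1 hx)] ]
    exact (integrableOn_exp_mul_Iic hκ 0).lintegral_lt_top
  · rw [setLIntegral_congr_fun (g := fun x : ℝ => ENNReal.ofReal (Real.exp (-κ * x)))
      measurableSet_Ioi fun x hx => by simp [abs_of_pos (mem_Ioi.1 hx)] ]
    exact (integrableOn_exp_mul_Ioi (neg_lt_zero.2 hκ) 0).lintegral_lt_top

/-! ### The Green operator -/

/-- Two solutions of `-y'' + q y = z y`, one exponentially small at `+∞` and the other at `-∞`,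
with nonzero Wronskian. -/
structure DecayingPair (q : ℝ → ℂ) (z : ℂ) where
  /-- the solution that is small at `+∞` -/
  yp : ℝ → ℂ
  /-- the derivative of `yp` -/
  pp : ℝ → ℂ
  /-- the solution that is small at `-∞` -/
  ym : ℝ → ℂ
  /-- the derivative of `ym` -/
  pm : ℝ → ℂ
  isSol_p : IsSol q z yp pp
  isSol_m : IsSol q z ym pm
  /-- the rate of decay -/
  κ : ℝ
  /-- the constant in the bounds -/
  C : ℝ
  κ_pos : 0 < κ
  bound_p : ∀ x, ‖yp x‖ ≤ C * Real.exp (-κ * x)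
  bound_m : ∀ x, ‖ym x‖ ≤ C * Real.exp (κ * x)
  wronskian_ne : yp 0 * pm 0 - pp 0 * ym 0 ≠ 0

namespace DecayingPair

variable {q : ℝ → ℂ} {z : ℂ} (P : DecayingPair q z)

/-- The Wronskian of the pair. -/
noncomputable def W : ℂ := P.yp 0 * P.pm 0 - P.pp 0 * P.ym 0

/-- The integral operator whose kernel is the Green function of `H - z`. -/
noncomputable def green (f : ℝ → ℂ) (x : ℝ) : ℂ :=
  P.W⁻¹ * (P.yp x * (∫ t in Iic x, P.ym t * f t) + P.ym x * ∫ t in Ioi x, P.yp t * f t)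

theorem C_nonneg : 0 ≤ P.C := by
  have := (norm_nonneg _).trans (P.bound_p 0)
  simpa using this

theorem integrableOn_Iic (f : L2) (x : ℝ) : IntegrableOn (fun t => P.ym t * f t) (Iic x) := by
  have h1 : MemLp P.ym 2 (volume.restrict (Iic x)) := by
    rw [memLp_two_iff_integrable_sq_norm P.isSol_m.continuous.aestronglyMeasurable]
    refine Integrable.mono' ((integrableOn_exp_mul_Iic (mul_pos two_pos P.κ_pos) x).const_mul
      (P.C ^ 2)) (P.isSol_m.continuous.norm.pow 2).aestronglyMeasurable
      (Eventually.of_forall fun t => ?_)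
    rw [Real.norm_of_nonneg (by positivity), mul_assoc, mul_comm 2, Real.exp_mul, Real.rpow_two,
      ← mul_pow]
    exact pow_le_pow_left₀ (norm_nonneg _) (P.bound_m t) 2
  exact h1.integrable_mul ((Lp.memLp f).restrict _)

theorem integrableOn_Ioi (f : L2) (x : ℝ) : IntegrableOn (fun t => P.yp t * f t) (Ioi x) := by
  have h1 : MemLp P.yp 2 (volume.restrict (Ioi x)) := by
    rw [memLp_two_iff_integrable_sq_norm P.isSol_p.continuous.aestronglyMeasurable]
    refine Integrable.mono' ((integrableOn_exp_mul_Ioi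
      (mul_neg_of_pos_of_neg two_pos (neg_lt_zero.2 P.κ_pos)) x).const_mul
      (P.C ^ 2)) (P.isSol_p.continuous.norm.pow 2).aestronglyMeasurable
      (Eventually.of_forall fun t => ?_)
    rw [Real.norm_of_nonneg (by positivity), mul_assoc, mul_comm 2, Real.exp_mul, Real.rpow_two,
      ← mul_pow]
    exact pow_le_pow_left₀ (norm_nonneg _) (P.bound_p t) 2
  exact h1.integrable_mul ((Lp.memLp f).restrict _)

/-- The Green kernel is at most a multiple of `e^{-κ |x - t|}`. -/
theorem enorm_green_le (f : ℝ → ℂ) (x : ℝ) :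
    ‖P.green f x‖ₑ ≤ ENNReal.ofReal (‖P.W⁻¹‖ * P.C ^ 2) *
      ∫⁻ t, ENNReal.ofReal (Real.exp (-(P.κ * |x - t|))) * ‖f t‖ₑ := by
  have hC := P.C_nonneg
  -- both halves of the kernel are at most `C² e^{-κ |x - t|}`
  have hhalf : ∀ (a : ℂ) (b : ℝ → ℂ) (S : Set ℝ), MeasurableSet S →
      (∀ t ∈ S, ‖a‖ * ‖b t‖ ≤ P.C ^ 2 * Real.exp (-(P.κ * |x - t|))) →
      ‖a * ∫ t in S, b t * f t‖ₑ ≤ ENNReal.ofReal (P.C ^ 2) *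
        ∫⁻ t in S, ENNReal.ofReal (Real.exp (-(P.κ * |x - t|))) * ‖f t‖ₑ := by
    intro a b S hS hab
    rw [enorm_mul]
    calc ‖a‖ₑ * ‖∫ t in S, b t * f t‖ₑ ≤ ‖a‖ₑ * ∫⁻ t in S, ‖b t * f t‖ₑ := by
          gcongr
          exact enorm_integral_le_lintegral_enorm _
      _ = ∫⁻ t in S, ‖a‖ₑ * ‖b t * f t‖ₑ := (lintegral_const_mul' _ _ enorm_ne_top).symm
      _ ≤ ∫⁻ t in S, ENNReal.ofReal (P.C ^ 2) *
          (ENNReal.ofReal (Real.exp (-(P.κ * |x - t|))) * ‖f t‖ₑ) := by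
          refine setLIntegral_mono' hS fun t ht => ?_
          rw [enorm_mul, ← mul_assoc, ← mul_assoc, ← enorm_mul,
            ← ENNReal.ofReal_mul (by positivity)]
          gcongr
          rw [← ofReal_norm, norm_mul]
          exact ENNReal.ofReal_le_ofReal (hab t ht)
      _ = _ := lintegral_const_mul' _ _ ENNReal.ofReal_ne_top
  have h1 := hhalf (P.yp x) P.ym (Iic x) measurableSet_Iic fun t ht => by
    calc _ ≤ P.C * Real.exp (-P.κ * x) * (P.C * Real.exp (P.κ * t)) :=
          mul_le_mul (P.bound_p x) (P.bound_m t) (norm_nonneg _) (by positivity)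
      _ = P.C ^ 2 * (Real.exp (-P.κ * x) * Real.exp (P.κ * t)) := by ring
      _ = _ := by
          rw [← Real.exp_add, abs_of_nonneg (sub_nonneg.2 (mem_Iic.1 ht))]
          ring_nf
  have h2 := hhalf (P.ym x) P.yp (Ioi x) measurableSet_Ioi fun t ht => by
    calc _ ≤ P.C * Real.exp (P.κ * x) * (P.C * Real.exp (-P.κ * t)) :=
          mul_le_mul (P.bound_m x) (P.bound_p t) (norm_nonneg _) (by positivity)
      _ = P.C ^ 2 * (Real.exp (P.κ * x) * Real.exp (-P.κ * t)) := by ring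
      _ = _ := by
          rw [← Real.exp_add, abs_of_neg (sub_neg.2 (mem_Ioi.1 ht))]
          ring_nf
  rw [green, enorm_mul, ENNReal.ofReal_mul (norm_nonneg _), ofReal_norm, mul_assoc]
  gcongr
  refine (enorm_add_le _ _).trans ((add_le_add h1 h2).trans (le_of_eq ?_))
  rw [← mul_add, ← compl_Iic, lintegral_add_compl _ measurableSet_Iic]

/-- `u = green f` solves `-u'' + q u - z u = f`, with `u'` absolutely continuous. -/
theorem exists_hasDerivAt_green (hq : Continuous q) (f : L2) :
    ∃ p : ℝ → ℂ, (∀ x, HasDerivAt (P.green f) (p x) x) ∧ ∀ a b : ℝ,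
      IntervalIntegrable (fun t => (q t - z) * P.green f t - f t) volume a b ∧
      p b - p a = ∫ t in a..b, ((q t - z) * P.green f t - f t) := by
  have hW : P.W ≠ 0 := P.wronskian_ne
  have hw : ∀ t, P.yp t * P.pm t - P.pp t * P.ym t = P.W := P.isSol_p.wronskian P.isSol_m
  set A : ℝ → ℂ := fun x => ∫ t in Iic x, P.ym t * f t with hA
  set B : ℝ → ℂ := fun x => ∫ t in Ioi x, P.yp t * f t with hB
  have hfl : LocallyIntegrable (f : ℝ → ℂ) volume := (Lp.memLp f).locallyIntegrable (by norm_num)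
  have hloc : ∀ {y : ℝ → ℂ}, Continuous y → LocallyIntegrable (fun t => y t * f t) volume :=
    fun hy => locallyIntegrableOn_univ.1 ((locallyIntegrableOn_univ.2 hfl).continuousOn_mul
      hy.continuousOn isOpen_univ.isLocallyClosed)
  have hma := hloc P.isSol_m.continuous
  have hpa : LocallyIntegrable (fun t => -(P.yp t * f t)) volume :=
    (hloc P.isSol_p.continuous).neg
  have hAF : ∀ x, A x = A 0 + ∫ t in (0 : ℝ)..x, P.ym t * f t := fun x => by
    rw [← integral_Iic_sub_Iic (P.integrableOn_Iic f 0) (P.integrableOn_Iic f x)]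
    simp [hA]
  have hBF : ∀ x, B x = B 0 + ∫ t in (0 : ℝ)..x, -(P.yp t * f t) := fun x => by
    rw [intervalIntegral.integral_neg,
      ← integral_Ioi_sub_Ioi' (P.integrableOn_Ioi f 0) (P.integrableOn_Ioi f x)]
    simp [hB]
  have hAc : Continuous A := by
    rw [show A = fun x => A 0 + ∫ t in (0 : ℝ)..x, P.ym t * f t from funext hAF]
    exact continuous_const.add (intervalIntegral.continuous_primitive
      (intervalIntegrable_of_locallyIntegrable hma) 0)
  have hBc : Continuous B := by
    rw [show B = fun x => B 0 + ∫ t in (0 : ℝ)..x, -(P.yp t * f t) from funext hBF]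
    exact continuous_const.add (intervalIntegral.continuous_primitive
      (intervalIntegrable_of_locallyIntegrable hpa) 0)
  have hpc := P.isSol_p.continuous_deriv
  have hmc := P.isSol_m.continuous_deriv
  set p : ℝ → ℂ := fun x => P.W⁻¹ * (P.pp x * A x + P.pm x * B x) with hp
  have hpcont : Continuous p := by fun_prop
  have hgreen : ∀ x, P.green f x = P.W⁻¹ * (P.yp x * A x + P.ym x * B x) := fun x => rfl
  -- the terms containing `f` cancel, so `p` is the derivative of `green f` everywhere
  have hinc : ∀ a b, P.green f b - P.green f a = ∫ t in a..b, p t := by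
    intro a b
    have h1 := mul_sub_mul_eq_integral hma hAF P.isSol_p.hasDerivAt hpc a b
    have h2 := mul_sub_mul_eq_integral hpa hBF P.isSol_m.hasDerivAt hmc a b
    calc P.green f b - P.green f a = P.W⁻¹ * ((P.yp b * A b - P.yp a * A a) +
          (P.ym b * B b - P.ym a * B a)) := by rw [hgreen, hgreen]; ring
      _ = _ := by
          rw [h1.2, h2.2, ← intervalIntegral.integral_add h1.1 h2.1,
            ← intervalIntegral.integral_const_mul]
          congr 1
          ext t
          simp only [hp]
          ring
  refine ⟨p, fun x => ?_, fun a b => ?_⟩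
  · have h1 : P.green f = fun x => P.green f 0 + ∫ t in (0 : ℝ)..x, p t :=
      funext fun x => by rw [← hinc 0 x]; ring
    rw [h1]
    exact (hpcont.integral_hasStrictDerivAt 0 x).hasDerivAt.const_add _
  · have hyp := P.isSol_p.continuous
    have hym := P.isSol_m.continuous
    have h1 := mul_sub_mul_eq_integral hma hAF P.isSol_p.hasDerivAt_deriv (by fun_prop) a b
    have h2 := mul_sub_mul_eq_integral hpa hBF P.isSol_m.hasDerivAt_deriv (by fun_prop) a b
    have h3 : ∀ t, (q t - z) * P.green f t - f t = P.W⁻¹ *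
        (((q t - z) * P.yp t * A t + P.pp t * (P.ym t * f t)) +
          ((q t - z) * P.ym t * B t + P.pm t * -(P.yp t * f t))) := by
      intro t
      have h4 : f t = P.W⁻¹ * ((P.yp t * P.pm t - P.pp t * P.ym t) * f t) := by
        rw [hw t, inv_mul_cancel_left₀ hW]
      rw [hgreen]
      linear_combination -h4
    simp_rw [h3]
    refine ⟨(h1.1.add h2.1).const_mul _, ?_⟩
    rw [intervalIntegral.integral_const_mul, intervalIntegral.integral_add h1.1 h2.1, ← h1.2,
      ← h2.2]
    simp only [hp]
    ring

/-- The constant in the bound `‖green f‖₂ ≤ c ‖f‖₂`. -/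
noncomputable def opBound : ENNReal :=
  ENNReal.ofReal (‖P.W⁻¹‖ * P.C ^ 2) * ∫⁻ x : ℝ, ENNReal.ofReal (Real.exp (-(P.κ * |x|)))

theorem opBound_lt_top : P.opBound < ⊤ :=
  ENNReal.mul_lt_top ENNReal.ofReal_lt_top (lintegral_exp_neg_abs_lt_top P.κ_pos)

theorem eLpNorm_green_le (f : L2) :
    eLpNorm (P.green f) 2 volume ≤ P.opBound * eLpNorm f 2 volume := by
  rw [← ENNReal.pow_le_pow_left_iff two_ne_zero, mul_pow, eLpNorm_two_sq, eLpNorm_two_sq, opBound,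
    mul_pow, mul_assoc]
  refine le_trans ?_ (mul_le_mul_right (lintegral_convolution_sq_le
    (k := fun s => ENNReal.ofReal (Real.exp (-(P.κ * |s|)))) (F := fun t => ‖f t‖ₑ) (by fun_prop)
    (Lp.stronglyMeasurable f).measurable.enorm) _)
  rw [← lintegral_const_mul' _ _ (ENNReal.pow_ne_top ENNReal.ofReal_ne_top)]
  refine lintegral_mono fun x => ?_
  rw [← mul_pow]
  exact pow_le_pow_left₀ zero_le (P.enorm_green_le f x) 2

theorem memLp_green (hq : Continuous q) (f : L2) : MemLp (P.green f) 2 volume := by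
  obtain ⟨p, hp, -⟩ := P.exists_hasDerivAt_green hq f
  have hc : Continuous (P.green f) := continuous_iff_continuousAt.2 fun x => (hp x).continuousAt
  exact ⟨hc.aestronglyMeasurable, (P.eLpNorm_green_le f).trans_lt
    (ENNReal.mul_lt_top P.opBound_lt_top (Lp.memLp f).2)⟩

/-- The Green operator on `L²(ℝ)`. -/
noncomputable def greenL (hq : Continuous q) : L2 →L[ℂ] L2 :=
  LinearMap.mkContinuous
    { toFun := fun f => (P.memLp_green hq f).toLp
      map_add' := fun f g => by
        rw [← MemLp.toLp_add]
        refine MemLp.toLp_congr _ _ (Eventually.of_forall fun x => ?_)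
        have h1 : ∀ y : ℝ → ℂ, (fun t => y t * (f + g : L2) t) =ᵐ[volume]
            fun t => y t * f t + y t * g t := fun y => by
          filter_upwards [Lp.coeFn_add f g] with t ht
          rw [ht, Pi.add_apply, mul_add]
        simp only [Pi.add_apply, green]
        rw [integral_congr_ae (ae_restrict_of_ae (h1 P.ym)),
          integral_congr_ae (ae_restrict_of_ae (h1 P.yp)),
          integral_add (P.integrableOn_Iic f x) (P.integrableOn_Iic g x),
          integral_add (P.integrableOn_Ioi f x) (P.integrableOn_Ioi g x)]
        ring
      map_smul' := fun c f => by
        rw [RingHom.id_apply, ← MemLp.toLp_const_smul]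
        refine MemLp.toLp_congr _ _ (Eventually.of_forall fun x => ?_)
        have h1 : ∀ y : ℝ → ℂ, (fun t => y t * (c • f : L2) t) =ᵐ[volume]
            fun t => c * (y t * f t) := fun y => by
          filter_upwards [Lp.coeFn_smul c f] with t ht
          rw [ht, Pi.smul_apply, smul_eq_mul]
          ring
        simp only [Pi.smul_apply, green, smul_eq_mul]
        rw [integral_congr_ae (ae_restrict_of_ae (h1 P.ym)),
          integral_congr_ae (ae_restrict_of_ae (h1 P.yp)), MeasureTheory.integral_const_mul,
          MeasureTheory.integral_const_mul]
        ring }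
    P.opBound.toReal fun f => by
      change ‖(P.memLp_green hq f).toLp‖ ≤ _
      rw [Lp.norm_toLp, Lp.norm_def, ← ENNReal.toReal_mul]
      exact ENNReal.toReal_mono (ENNReal.mul_lt_top P.opBound_lt_top (Lp.memLp f).2).ne
        (P.eLpNorm_green_le f)

theorem hillRel_greenL (hq : Continuous q) (f : L2) :
    HillRel q (P.greenL hq f) (f + z • P.greenL hq f) := by
  obtain ⟨p, hp, hinc⟩ := P.exists_hasDerivAt_green hq f
  have hae : (P.greenL hq f : ℝ → ℂ) =ᵐ[volume] P.green f := (P.memLp_green hq f).coeFn_toLp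
  have h : (fun t => (q t - z) * P.green f t - f t) =ᵐ[volume]
      fun t => q t * P.green f t - (f + z • P.greenL hq f : L2) t := by
    filter_upwards [hae, Lp.coeFn_add f (z • P.greenL hq f), Lp.coeFn_smul z (P.greenL hq f)]
      with t h1 h2 h3
    rw [h2, Pi.add_apply, h3, Pi.smul_apply, h1, smul_eq_mul]
    ring
  refine ⟨P.green f, p, hae, hp, fun a b => ⟨(hinc a b).1.congr_ae (ae_restrict_of_ae h), ?_⟩⟩
  rw [(hinc a b).2]
  exact intervalIntegral.integral_congr_ae (h.mono fun t ht _ => ht)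

end DecayingPair

/-- An `L²` function multiplied by a constant of modulus `≠ 1` under a translation vanishes. -/
theorem eq_zero_of_memLp_of_translate {h : ℝ → ℂ} (hc : Continuous h) (hm : MemLp h 2 volume)
    {T : ℝ} {c : ℂ} (hcn : ‖c‖ ≠ 1) (hT : ∀ x, h (x + T) = c * h x) (x : ℝ) : h x = 0 := by
  have h1 : ∫⁻ x, ‖h x‖ₑ ^ 2 = ‖c‖ₑ ^ 2 * ∫⁻ x, ‖h x‖ₑ ^ 2 := by
    rw [← lintegral_const_mul' _ _ (ENNReal.pow_ne_top enorm_ne_top),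
      ← lintegral_add_right_eq_self _ T]
    simp_rw [hT, enorm_mul, mul_pow]
  have hfin : ∫⁻ x, ‖h x‖ₑ ^ 2 ≠ ⊤ := by
    rw [← eLpNorm_two_sq]
    exact ENNReal.pow_ne_top hm.2.ne
  have h0 : ∫⁻ x, ‖h x‖ₑ ^ 2 = 0 := by
    by_contra hne
    have h2 := congrArg ENNReal.toReal h1
    rw [ENNReal.toReal_mul, ENNReal.toReal_pow, toReal_enorm] at h2
    have h3 : (∫⁻ x, ‖h x‖ₑ ^ 2).toReal ≠ 0 := ENNReal.toReal_ne_zero.2 ⟨hne, hfin⟩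
    have h4 : ‖c‖ ^ 2 = 1 := (mul_right_cancel₀ h3 ((one_mul _).trans h2)).symm
    exact hcn ((pow_eq_one_iff_of_nonneg (norm_nonneg c) two_ne_zero).1 h4)
  rw [lintegral_eq_zero_iff (by fun_prop)] at h0
  have h5 : h =ᵐ[volume] fun _ => (0 : ℂ) := by
    filter_upwards [h0] with x hx
    simpa using hx
  exact congrFun ((Continuous.ae_eq_iff_eq volume hc continuous_const).1 h5) x

/-! ### The discriminant and the spectrum -/

section

variable {q : ℝ → ℂ} {z : ℂ}

/-- A Floquet solution grows or decays exactly exponentially. -/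
theorem IsSol.exists_exp_bound {y p : ℝ → ℂ} (h : IsSol q z y p) {ρ : ℂ} {κ : ℝ}
    (hκ : Real.exp (κ * (2 * Real.pi)) * ‖ρ‖ = 1)
    (hfl : ∀ x, y (x + 2 * Real.pi) = ρ * y x) :
    ∃ C, ∀ x, ‖y x‖ ≤ C * Real.exp (-κ * x) := by
  have hyc := h.continuous
  have hper : Function.Periodic (fun x => Real.exp (κ * x) * ‖y x‖) (2 * Real.pi) := fun x => by
    simp only [hfl, norm_mul, mul_add, Real.exp_add]
    linear_combination Real.exp (κ * x) * ‖y x‖ * hκ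
  obtain ⟨C, hC⟩ := (hper.isBounded_of_continuous Real.two_pi_pos.ne'
    (by fun_prop)).exists_norm_le
  refine ⟨C, fun x => ?_⟩
  have h1 : Real.exp (κ * x) * ‖y x‖ ≤ C := by
    have := hC _ (mem_range_self x)
    rwa [Real.norm_of_nonneg (by positivity)] at this
  calc ‖y x‖ = Real.exp (κ * x) * ‖y x‖ * Real.exp (-κ * x) := by
        rw [mul_right_comm, ← Real.exp_add]
        simp
    _ ≤ _ := by gcongr

/-- If the monodromy matrix has an eigenvalue inside the unit disc, the Floquet solutions form a
decaying pair. -/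
theorem nonempty_decayingPair (hq : Continuous q) (hper : Function.Periodic q (2 * Real.pi))
    {ρ σ : ℂ} (hmul : ρ * σ = 1) (hadd : ρ + σ = discriminant q z) (hρ : ‖ρ‖ < 1) :
    Nonempty (DecayingPair q z) := by
  have hρ0 : ρ ≠ 0 := left_ne_zero_of_mul_eq_one hmul
  have hnρ : 0 < ‖ρ‖ := norm_pos_iff.2 hρ0
  have hnmul : ‖ρ‖ * ‖σ‖ = 1 := by rw [← norm_mul, hmul, norm_one]
  obtain ⟨y₁, p₁, h₁, ⟨x₁, hx₁⟩, hfl₁⟩ := exists_floquet hq hper hmul hadd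
  obtain ⟨y₂, p₂, h₂, ⟨x₂, hx₂⟩, hfl₂⟩ := exists_floquet (ρ := σ) (σ := ρ) hq hper
    (by rw [mul_comm, hmul]) (by rw [add_comm, hadd])
  set κ : ℝ := -Real.log ‖ρ‖ / (2 * Real.pi) with hκ
  have hκ0 : 0 < κ := div_pos (neg_pos.2 (Real.log_neg hnρ hρ)) Real.two_pi_pos
  have hexp : Real.exp (κ * (2 * Real.pi)) = ‖ρ‖⁻¹ := by
    rw [hκ, div_mul_cancel₀ _ Real.two_pi_pos.ne', Real.exp_neg, Real.exp_log hnρ]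
  obtain ⟨C₁, hC₁⟩ := h₁.exists_exp_bound (κ := κ) (by
    rw [hexp, inv_mul_cancel₀ hnρ.ne']) hfl₁
  obtain ⟨C₂, hC₂⟩ := h₂.exists_exp_bound (κ := -κ) (by
    rw [neg_mul, Real.exp_neg, hexp, inv_inv, hnmul]) hfl₂
  have hσρ : σ - ρ ≠ 0 := by
    intro h
    rw [sub_eq_zero.1 h] at hnmul
    nlinarith
  -- a vanishing combination of the two solutions is trivial, as their multipliers differ
  have hindep : ∀ a b : ℂ, a * y₁ 0 + b * y₂ 0 = 0 → a * p₁ 0 + b * p₂ 0 = 0 → a = 0 ∧ b = 0 := by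
    intro a b h0 h0'
    have hz := (h₁.comb h₂ a b).eq_zero hq hper h0 h0'
    have hz' : ∀ x, a * (ρ * y₁ x) + b * (σ * y₂ x) = 0 := fun x => by
      have := hz (x + 2 * Real.pi)
      simp only [hfl₁, hfl₂] at this
      exact this
    constructor
    · have h5 : (σ - ρ) * y₁ x₁ * a = 0 := by
        linear_combination σ * hz x₁ - hz' x₁
      exact (mul_eq_zero.1 h5).resolve_left (mul_ne_zero hσρ hx₁)
    · have h5 : (σ - ρ) * y₂ x₂ * b = 0 := by
        linear_combination hz' x₂ - ρ * hz x₂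
      exact (mul_eq_zero.1 h5).resolve_left (mul_ne_zero hσρ hx₂)
  refine ⟨{ yp := y₁, pp := p₁, ym := y₂, pm := p₂, isSol_p := h₁, isSol_m := h₂, κ := κ,
            C := max C₁ C₂, κ_pos := hκ0, bound_p := fun x => (hC₁ x).trans ?_,
            bound_m := fun x => (hC₂ x).trans ?_, wronskian_ne := fun hW => ?_ }⟩
  · gcongr
    exact le_max_left _ _
  · rw [neg_neg]
    gcongr
    exact le_max_right _ _
  · have e1 := hindep (y₂ 0) (-y₁ 0) (by ring) (by linear_combination -hW)
    have e2 := hindep (p₂ 0) (-p₁ 0) (by linear_combination hW) (by ring)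
    exact hx₁ (h₁.eq_zero hq hper (neg_eq_zero.1 e1.2) (neg_eq_zero.1 e2.2) x₁)

/-- `H - z` is injective if the monodromy matrix has no eigenvalue on the unit circle. -/
theorem eq_zero_of_hillRel (hq : Continuous q) (hper : Function.Periodic q (2 * Real.pi))
    {ρ σ : ℂ} (hmul : ρ * σ = 1) (hadd : ρ + σ = discriminant q z) (hρ : ‖ρ‖ < 1) {f : L2}
    (hf : HillRel q f (z • f)) : f = 0 := by
  obtain ⟨y, p, hfy, hy, hp⟩ := hf
  have hyc : Continuous y := continuous_iff_continuousAt.2 fun x => (hy x).continuousAt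
  have hae : (fun t => q t * y t - (z • f : L2) t) =ᵐ[volume] fun t => (q t - z) * y t := by
    filter_upwards [Lp.coeFn_smul z f, hfy] with t h1 h2
    rw [h1, Pi.smul_apply, h2, smul_eq_mul]
    ring
  have hpF : p = fun x => p 0 + ∫ t in (0 : ℝ)..x, (q t - z) * y t := funext fun x => by
    rw [← intervalIntegral.integral_congr_ae (hae.mono fun t ht _ => ht), ← (hp 0 x).2]
    ring
  have hsol : IsSol q z y p := ⟨hy, fun x => by
    rw [hpF]
    exact ((by fun_prop : Continuous fun t => (q t - z) * y t).integral_hasStrictDerivAt 0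
      x).hasDerivAt.const_add _⟩
  have hym : MemLp y 2 volume := (memLp_congr_ae hfy).1 (Lp.memLp f)
  have hys : MemLp (fun x => y (x + 2 * Real.pi)) 2 volume :=
    hym.comp_measurePreserving (measurePreserving_add_right volume _)
  have hnmul : ‖ρ‖ * ‖σ‖ = 1 := by rw [← norm_mul, hmul, norm_one]
  have hσ1 : ‖σ‖ ≠ 1 := fun h => by rw [h] at hnmul; linarith
  have hCH := hsol.cayleyHamilton hq hper
  rw [← hadd] at hCH
  -- by Cayley-Hamilton, `y (· + 2π) - ρ y` and `y (· + 2π) - σ y` have multipliers `σ` and `ρ`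
  have h1 := eq_zero_of_memLp_of_translate (h := fun x => y (x + 2 * Real.pi) - ρ * y x)
    (by fun_prop) (hys.sub (hym.const_mul ρ)) hσ1 fun x => by
      linear_combination hCH x + y x * hmul
  have h2 := eq_zero_of_memLp_of_translate (h := fun x => y (x + 2 * Real.pi) - σ * y x)
    (by fun_prop) (hys.sub (hym.const_mul σ)) hρ.ne fun x => by
      linear_combination hCH x + y x * hmul
  have hσρ : σ - ρ ≠ 0 := by
    intro h
    rw [sub_eq_zero.1 h] at hnmul
    nlinarith [norm_nonneg ρ]
  have hy0 : y = fun _ => 0 := funext fun x =>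
    (mul_eq_zero.1 (by linear_combination h1 x - h2 x : (σ - ρ) * y x = 0)).resolve_left hσρ
  rw [hy0] at hfy
  exact Lp.ext (hfy.trans (Lp.coeFn_zero ℂ 2 volume).symm)

/-- If the monodromy matrix has no eigenvalue on the unit circle, the Green operator is the
resolvent: a right inverse of `H - z` by construction, and a left inverse because `H - z` is
injective. -/
theorem mem_resolventSet_of_multiplier (hq : Continuous q)
    (hper : Function.Periodic q (2 * Real.pi)) {ρ σ : ℂ} (hmul : ρ * σ = 1)
    (hadd : ρ + σ = discriminant q z) (hρ : ‖ρ‖ < 1) : z ∈ resolventSet (hillOperator q) := by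
  obtain ⟨P⟩ := nonempty_decayingPair hq hper hmul hadd hρ
  have hmem : ∀ w, (P.greenL hq w, w + z • P.greenL hq w) ∈ (hillOperator q).graph := fun w =>
    (mem_graph_hillOperator _ _ _).2 (P.hillRel_greenL hq w)
  refine ⟨P.greenL hq, fun x => ?_, fun w => ?_⟩
  · set w : L2 := hillOperator q x - z • (x : L2) with hw
    have h1 := (hillOperator q).graph.sub_mem (hmem w) ((hillOperator q).mem_graph x)
    rw [Prod.mk_sub_mk, mem_graph_hillOperator] at h1
    refine sub_eq_zero.1 (eq_zero_of_hillRel hq hper hmul hadd hρ ?_)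
    convert h1 using 1
    rw [hw, smul_sub]
    abel
  · have hdom : P.greenL hq w ∈ (hillOperator q).domain :=
      LinearPMap.mem_domain_iff.2 ⟨_, hmem w⟩
    refine ⟨hdom, ?_⟩
    have := (hillOperator q).mem_graph_snd_inj ((hillOperator q).mem_graph ⟨_, hdom⟩) (hmem w) rfl
    rw [this, add_sub_cancel_right]

/-- The eigenvalues of the monodromy matrix: the roots of `ρ² - D ρ + 1`, the first in the closed
unit disc. -/
theorem exists_multipliers (D : ℂ) : ∃ ρ σ : ℂ, ρ * σ = 1 ∧ ρ + σ = D ∧ ‖ρ‖ ≤ 1 := by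
  obtain ⟨s, hs⟩ := IsAlgClosed.exists_pow_nat_eq (D ^ 2 - 4) two_pos
  have h1 : (D + s) / 2 * ((D - s) / 2) = 1 := by linear_combination (-1 / 4) * hs
  have h2 : ‖(D + s) / 2‖ * ‖(D - s) / 2‖ = 1 := by rw [← norm_mul, h1, norm_one]
  by_cases h : ‖(D + s) / 2‖ ≤ 1
  · exact ⟨_, _, h1, by ring, h⟩
  · exact ⟨(D - s) / 2, (D + s) / 2, by rw [mul_comm, h1], by ring, by
      push Not at h
      nlinarith [norm_nonneg ((D - s) / 2)]⟩

/-- On the spectrum the discriminant is real, between `-2` and `2`. -/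
theorem discriminant_of_mem_spectrum (hq : Continuous q)
    (hper : Function.Periodic q (2 * Real.pi)) (hz : z ∈ spectrum (hillOperator q)) :
    (discriminant q z).im = 0 ∧ |(discriminant q z).re| ≤ 2 := by
  obtain ⟨ρ, σ, hmul, hadd, hρ⟩ := exists_multipliers (discriminant q z)
  -- a multiplier of modulus one comes with its complex conjugate, so that `Δ = 2 Re ρ`
  rcases hρ.lt_or_eq with h | h
  · exact absurd (mem_resolventSet_of_multiplier hq hper hmul hadd h) hz
  · have hσ : σ = (starRingEnd ℂ) ρ := by
      rw [← Complex.inv_eq_conj h]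
      exact eq_inv_of_mul_eq_one_right hmul
    rw [← hadd, hσ, Complex.add_conj]
    refine ⟨Complex.ofReal_im _, ?_⟩
    rw [Complex.ofReal_re, abs_mul, abs_two]
    have := ρ.abs_re_le_norm
    linarith

/-- Where the discriminant is `± 2` there is spectrum. -/
theorem mem_spectrum_of_discriminant_sq (hq : Continuous q)
    (hper : Function.Periodic q (2 * Real.pi)) (hz : discriminant q z ^ 2 = 4) :
    z ∈ spectrum (hillOperator q) := by
  obtain ⟨y, p, h, hne, hfl⟩ := exists_floquet (lam := z) (ρ := discriminant q z / 2)
    (σ := discriminant q z / 2) hq hper (by linear_combination (1 / 4) * hz) (by ring)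
  refine mem_spectrum_of_floquet hq h hne ?_ hfl
  have : ‖discriminant q z‖ ^ 2 = 2 ^ 2 := by rw [← norm_pow, hz]; norm_num
  rw [norm_div, (pow_left_inj₀ (norm_nonneg _) two_pos.le two_ne_zero).1 this]
  norm_num

end

/-! ### The discriminant of an operator with spectrum `[0, ∞)` -/

section

variable {q : ℝ → ℂ}

/-- At a positive point where the discriminant is `± 2`, its restriction to the real axis has an
extremum, because it takes values in `[-2, 2]` on the spectrum. -/
theorem deriv_discriminant_eq_zero (hq : Continuous q) (hper : Function.Periodic q (2 * Real.pi))
    (hspec : spectrum (hillOperator q) = {z : ℂ | ∃ t : ℝ, 0 ≤ t ∧ z = t}) {t : ℝ} (ht : 0 < t)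
    (h4 : discriminant q t ^ 2 = 4) : deriv (discriminant q) t = 0 := by
  have hreal : ∀ s : ℝ, 0 ≤ s → (discriminant q s).im = 0 ∧ |(discriminant q s).re| ≤ 2 :=
    fun s hs => discriminant_of_mem_spectrum hq hper (by rw [hspec]; exact ⟨s, hs, rfl⟩)
  have hd : HasDerivAt (fun s : ℝ => discriminant q s) (deriv (discriminant q) t) t :=
    (differentiable_discriminant hq hper t).hasDerivAt.comp_ofReal
  have hre : HasDerivAt (fun s : ℝ => (discriminant q s).re) (deriv (discriminant q) t).re t :=
    Complex.reCLM.hasFDerivAt.comp_hasDerivAt t hd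
  have him : HasDerivAt (fun s : ℝ => (discriminant q s).im) (deriv (discriminant q) t).im t :=
    Complex.imCLM.hasFDerivAt.comp_hasDerivAt t hd
  have hev : ∀ᶠ s in 𝓝 t, 0 ≤ s := (eventually_gt_nhds ht).mono fun s hs => hs.le
  refine Complex.ext ?_ ?_
  · have hre2 : (discriminant q t).re ^ 2 = 4 := by
      have h1 := congrArg Complex.re h4
      rw [sq, Complex.mul_re, (hreal t ht.le).1] at h1
      simpa [sq] using h1
    have hextr : IsLocalExtr (fun s : ℝ => (discriminant q s).re) t := by
      rcases sq_eq_sq_iff_eq_or_eq_neg.1 (hre2.trans (by norm_num : (4 : ℝ) = 2 ^ 2)) with h2 | h2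
      · refine Or.inr (hev.mono fun s hs => ?_)
        simp only [h2]
        exact (abs_le.1 (hreal s hs).2).2
      · refine Or.inl (hev.mono fun s hs => ?_)
        simp only [h2]
        exact (abs_le.1 (hreal s hs).2).1
    simpa using hextr.hasDerivAt_eq_zero hre
  · have h0 : (fun s : ℝ => (discriminant q s).im) =ᶠ[𝓝 t] fun _ => 0 :=
      hev.mono fun s hs => (hreal s hs).1
    simpa using (him.congr_of_eventuallyEq h0.symm).unique (hasDerivAt_const t (0 : ℝ))

/-- If the spectrum is `[0, ∞)`, then `4 - Δ (w²)² = 4 sin² (2πw)`, as for the zero potential. -/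
theorem four_sub_discriminant_sq (hq : Continuous q) (hper : Function.Periodic q (2 * Real.pi))
    (hspec : spectrum (hillOperator q) = {z : ℂ | ∃ t : ℝ, 0 ≤ t ∧ z = t}) (w : ℂ) :
    4 - discriminant q (w ^ 2) ^ 2 = 4 * Complex.sin (w * (2 * Real.pi : ℝ)) ^ 2 := by
  obtain ⟨K, hK0, hK⟩ := exists_bound_of_continuous_periodic hq hper (by positivity)
  have hΔ := differentiable_discriminant hq hper
  have hD : Differentiable ℂ fun w => discriminant q (w ^ 2) :=
    hΔ.comp (differentiable_pow 2)
  have hderiv : ∀ w, deriv (fun w => discriminant q (w ^ 2)) w =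
      deriv (discriminant q) (w ^ 2) * (2 * w) := fun w => by
    have h1 := (hΔ (w ^ 2)).hasDerivAt.comp w (hasDerivAt_pow 2 w)
    simpa [Function.comp_def] using h1.deriv
  have hzero : ∀ w, discriminant q (w ^ 2) ^ 2 = 4 →
      deriv (fun w => discriminant q (w ^ 2)) w = 0 := by
    intro w hw
    rw [hderiv]
    -- at `w = 0` the derivative of `w²` vanishes
    by_cases hw0 : w = 0
    · simp [hw0]
    · have hmem := mem_spectrum_of_discriminant_sq hq hper hw
      rw [hspec] at hmem
      obtain ⟨t, ht, hwt⟩ := hmem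
      have ht0 : 0 < t := by
        refine lt_of_le_of_ne ht fun h => hw0 ?_
        rw [← h, Complex.ofReal_zero] at hwt
        exact pow_eq_zero_iff two_ne_zero |>.1 hwt
      rw [hwt] at hw ⊢
      rw [deriv_discriminant_eq_zero hq hper hspec ht0 hw, zero_mul]
  obtain ⟨hex, hid⟩ := differential_identity hD (C := 8 * Real.pi * K) (r := 4 * Real.pi * K)
    (by positivity) (fun w hw => norm_discriminant_sub_le hq hper hK
      (norm_pos_iff.1 (lt_of_lt_of_le (by positivity) hw)) hw) hzero
  exact four_sub_sq_eq_of_differential_identity hD (fun w => by rw [neg_sq]) hex hid w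

end

/-! ### The off-diagonal entry of the monodromy matrix -/

/-- The upper right entry of the monodromy matrix with base point `x`: the value at `x + 2π` of the
solution that vanishes at `x` with derivative `1`. -/
noncomputable def offDiag (q : ℝ → ℂ) (lam : ℂ) (x : ℝ) : ℂ :=
  sinSol q lam (x + 2 * Real.pi) * cosSol q lam x - cosSol q lam (x + 2 * Real.pi) * sinSol q lam x

section

variable {q : ℝ → ℂ} {lam : ℂ}

/-- `offDiag` at the base point `x` is the entry at base point `0` for the translated potential. -/
theorem offDiag_eq_sinSol (hq : Continuous q) (hper : Function.Periodic q (2 * Real.pi))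
    (lam : ℂ) (x : ℝ) : offDiag q lam x = sinSol (fun t => q (t + x)) lam (2 * Real.pi) := by
  have hq' : Continuous fun t => q (t + x) := by fun_prop
  have hper' : Function.Periodic (fun t => q (t + x)) (2 * Real.pi) := fun t => by
    simp only
    rw [add_right_comm, hper]
  have h := ((isSol_sinSol hq hper lam).comp_add x).comb ((isSol_cosSol hq hper lam).comp_add x)
    (cosSol q lam x) (-sinSol q lam x)
  have h1 := (h.eq_comb hq' hper' (2 * Real.pi)).1
  simp only [zero_add] at h1
  have h2 := cosSol_mul_sinSolDeriv_sub hq hper lam x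
  rw [offDiag, add_comm x]
  linear_combination h1 + sinSol (fun t => q (t + x)) lam (2 * Real.pi) * h2

theorem differentiable_offDiag (hq : Continuous q) (hper : Function.Periodic q (2 * Real.pi))
    (x : ℝ) : Differentiable ℂ fun lam => offDiag q lam x := by
  simp_rw [offDiag_eq_sinSol hq hper]
  refine (differentiable_initSol (q := fun t => q (t + x)) (by fun_prop) (fun t => ?_) 0 1
    Real.two_pi_pos.le).1
  simp only
  rw [add_right_comm, hper]

theorem norm_offDiag_sub_le (hq : Continuous q) (hper : Function.Periodic q (2 * Real.pi))
    {K : ℝ} (hK : ∀ x, ‖q x‖ ≤ K) (x : ℝ) {w : ℂ} (hw : w ≠ 0) (hwK : 4 * Real.pi * K ≤ ‖w‖) :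
    ‖offDiag q (w ^ 2) x - Complex.sin (w * (2 * Real.pi : ℝ)) / w‖ ≤
      4 * Real.pi * K / ‖w‖ ^ 2 * Real.exp (|w.im| * (2 * Real.pi)) := by
  have hq' : Continuous fun t => q (t + x) := by fun_prop
  have hper' : Function.Periodic (fun t => q (t + x)) (2 * Real.pi) := fun t => by
    simp only
    rw [add_right_comm, hper]
  rw [offDiag_eq_sinSol hq hper]
  exact ((isSol_sinSol hq' hper' _).norm_sub_sin_le hq' (fun t => hK _) hw hwK
    (sinSol_zero hq' hper' _) (sinSolDeriv_zero hq' hper' _)).1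

/-- Coexistence makes the monodromy matrix scalar. -/
theorem offDiag_eq_zero_of_coexistence (hq : Continuous q)
    (hper : Function.Periodic q (2 * Real.pi)) (h : Coexistence q lam) (x : ℝ) :
    offDiag q lam x = 0 := by
  obtain ⟨ρ, -, f₁, f₂, h₁, h₂, hf₁, hf₂, hli⟩ := h
  have hsol : ∀ f : ℝ → ℂ, IsSolution q lam f → IsSol q lam f (deriv f) := fun f hf =>
    ⟨fun x => (hf.1 x).hasDerivAt, fun x => by
      have := (hf.2.1 x).hasDerivAt
      rwa [show deriv (deriv f) x = (q x - lam) * f x by linear_combination -hf.2.2 x] at this⟩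
  have e₁ := fun x => ((hsol f₁ h₁).eq_comb hq hper x).1
  have e₂ := fun x => ((hsol f₂ h₂).eq_comb hq hper x).1
  set c₁ := f₁ 0
  set d₁ := deriv f₁ 0
  set c₂ := f₂ 0
  set d₂ := deriv f₂ 0
  rw [LinearIndependent.pair_iff] at hli
  -- independent solutions have independent initial data
  have hdet : c₁ * d₂ - c₂ * d₁ ≠ 0 := by
    intro h0
    have g1 := hli d₂ (-d₁) (funext fun x => by
      simp only [Pi.add_apply, Pi.smul_apply, smul_eq_mul, Pi.zero_apply]
      rw [e₁, e₂]
      linear_combination cosSol q lam x * h0)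
    have g2 := hli c₂ (-c₁) (funext fun x => by
      simp only [Pi.add_apply, Pi.smul_apply, smul_eq_mul, Pi.zero_apply]
      rw [e₁, e₂]
      linear_combination -sinSol q lam x * h0)
    have g3 := hli 1 0 (funext fun x => by
      simp only [Pi.add_apply, Pi.smul_apply, smul_eq_mul, Pi.zero_apply]
      rw [e₁, neg_eq_zero.1 g1.2, neg_eq_zero.1 g2.2]
      ring)
    exact one_ne_zero g3.1
  have hc : cosSol q lam (x + 2 * Real.pi) = ρ * cosSol q lam x := by
    refine mul_left_cancel₀ hdet ?_
    have a1 := hf₁ x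
    have a2 := hf₂ x
    rw [e₁, e₁] at a1
    rw [e₂, e₂] at a2
    linear_combination d₂ * a1 - d₁ * a2
  have hs : sinSol q lam (x + 2 * Real.pi) = ρ * sinSol q lam x := by
    refine mul_left_cancel₀ hdet ?_
    have a1 := hf₁ x
    have a2 := hf₂ x
    rw [e₁, e₁] at a1
    rw [e₂, e₂] at a2
    linear_combination c₁ * a2 - c₂ * a1
  rw [offDiag, hc, hs]
  ring

theorem exists_int_of_sin_eq_zero {w : ℂ} (h : Complex.sin (w * (2 * Real.pi : ℝ)) = 0) :
    ∃ n : ℤ, w = n / 2 := by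
  obtain ⟨n, hn⟩ := Complex.sin_eq_zero_iff.1 h
  refine ⟨n, ?_⟩
  have hpi : (Real.pi : ℂ) ≠ 0 := by simp [Real.pi_ne_zero]
  refine mul_right_cancel₀ hpi ?_
  push_cast at hn
  linear_combination (1 / 2) * hn

/-- The quotient of `w b (x, w²) (w² - m²/4)` by `sin (2πw)` is entire, even, and asymptotic to
`w²`, hence of the form `w² - μ`. -/
theorem exists_offDiag_eq (hq : Continuous q) (hper : Function.Periodic q (2 * Real.pi)) {m : ℕ}
    (hco : ∀ n : ℕ, 1 ≤ n → n ≠ m → Coexistence q ((n : ℂ) ^ 2 / 4)) (x : ℝ) :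
    ∃ μ : ℂ, ∀ w : ℂ, w * offDiag q (w ^ 2) x * (w ^ 2 - (m : ℂ) ^ 2 / 4) =
      Complex.sin (w * (2 * Real.pi : ℝ)) * (w ^ 2 - μ) := by
  obtain ⟨K, hK0, hK⟩ := exists_bound_of_continuous_periodic hq hper (by positivity)
  set e : ℂ := (m : ℂ) ^ 2 / 4 with he
  set f : ℂ → ℂ := fun w => w * offDiag q (w ^ 2) x * (w ^ 2 - e) with hf
  set g : ℂ → ℂ := fun w => Complex.sin (w * (2 * Real.pi : ℝ)) with hg
  have hfd : Differentiable ℂ f := (differentiable_id.mul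
    ((differentiable_offDiag hq hper x).comp (differentiable_pow 2))).mul
      ((differentiable_pow 2).sub_const e)
  have hgd : Differentiable ℂ g := by fun_prop
  have hg' : ∀ w, HasDerivAt g (Complex.cos (w * (2 * Real.pi : ℝ)) * (2 * Real.pi : ℝ)) w :=
    fun w => (Complex.hasDerivAt_sin _).comp w (hasDerivAt_mul_const _)
  have hfz : ∀ w, g w = 0 → f w = 0 := by
    intro w hw
    obtain ⟨n, rfl⟩ := exists_int_of_sin_eq_zero hw
    have hsq : ((n : ℂ) / 2) ^ 2 = (n.natAbs : ℂ) ^ 2 / 4 := by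
      have : ((n.natAbs : ℤ) : ℂ) ^ 2 = (n : ℂ) ^ 2 := by exact_mod_cast Int.natAbs_sq n
      rw [← Int.cast_natCast n.natAbs, this]
      ring
    simp only [hf]
    by_cases hn0 : n.natAbs = 0
    · simp [Int.natAbs_eq_zero.1 hn0]
    · rw [hsq]
      by_cases hnm : n.natAbs = m
      · rw [hnm]
        simp [he]
      · rw [offDiag_eq_zero_of_coexistence hq hper (hco _ (Nat.one_le_iff_ne_zero.2 hn0) hnm)]
        ring
  have hg1 : g (1 / 4) ≠ 0 := by
    simp only [hg]
    rw [show (1 / 4 : ℂ) * (2 * Real.pi : ℝ) = Real.pi / 2 by push_cast; ring,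
      Complex.sin_pi_div_two]
    exact one_ne_zero
  have hdsl : ∀ {F : ℂ → ℂ} (_ : Differentiable ℂ F) (z : ℂ), Differentiable ℂ (dslope F z) :=
    fun hF z u => ((Complex.differentiableOn_dslope (c := z) (s := univ) univ_mem).2
      hF.differentiableOn).differentiableAt univ_mem
  obtain ⟨h, hh, hfac⟩ := exists_entire_quotient (f := f) (g := g)
    (eventually_ne_zero_of_entire hgd hg1) fun z => by
      -- the zeros of `g` are simple, so the slopes of `f` and `g` have an analytic quotient
      by_cases hz : g z = 0
      · have hne : dslope g z z ≠ 0 := by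
          rw [dslope_same, (hg' z).deriv]
          refine mul_ne_zero (fun hc => ?_) (by simp [Real.pi_ne_zero])
          have := Complex.sin_sq_add_cos_sq (z * (2 * Real.pi : ℝ))
          rw [hc, show Complex.sin (z * (2 * Real.pi : ℝ)) = 0 from hz] at this
          norm_num at this
        refine ⟨fun u => dslope f z u / dslope g z u,
          ((hdsl hfd z).analyticAt z).div ((hdsl hgd z).analyticAt z) hne, ?_⟩
        filter_upwards [((hdsl hgd z) z).continuousAt.eventually_ne hne] with u hu
        have e1 := sub_smul_dslope f z u
        have e2 := sub_smul_dslope g z u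
        rw [hz, sub_zero, smul_eq_mul] at e2
        rw [hfz z hz, sub_zero, smul_eq_mul] at e1
        rw [← e1, ← e2]
        field_simp
      · refine ⟨fun u => f u / g u, (hfd.analyticAt z).div (hgd.analyticAt z) hz, ?_⟩
        filter_upwards [(hgd z).continuousAt.eventually_ne hz] with u hu
        rw [mul_div_cancel₀ _ hu]
  have heven : ∀ w, h (-w) = h w := by
    have h1 : ∀ w, g w * (h (-w) - h w) = 0 := by
      intro w
      have e1 := hfac w
      have e2 := hfac (-w)
      simp only [hf, hg, neg_sq, neg_mul, Complex.sin_neg] at e1 e2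
      simp only [hg]
      linear_combination e1 + e2
    rcases AnalyticOnNhd.eq_zero_or_eq_zero_of_mul_eq_zero (U := univ)
      (f := g) (g := fun w => h (-w) - h w) (fun z _ => hgd.analyticAt z)
      (fun z _ => ((hh.comp differentiable_neg).sub hh).analyticAt z) (fun z _ => h1 z)
      isPreconnected_univ with h2 | h2
    · exact absurd (h2 _ (mem_univ _)) hg1
    · exact fun w => sub_eq_zero.1 (h2 w (mem_univ w))
  have hconst := eq_const_of_even_of_bound_onSquare (h := fun w => h w - (w ^ 2 - e))
    (by fun_prop) (fun w => by rw [heven, neg_sq])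
    (C := 16 * Real.pi * K * (1 + ‖e‖)) (r := max (4 * Real.pi * K) 1) (fun k w hk hw => by
      have hw1 : 1 ≤ ‖w‖ := (le_max_right _ _).trans hw
      have hw0 : 0 < ‖w‖ := by linarith
      have hwne : w ≠ 0 := norm_pos_iff.1 hw0
      set X : ℝ := Real.exp (|w.im| * (2 * Real.pi)) with hX
      have hX0 : 0 < X := Real.exp_pos _
      have hgX : X / 4 ≤ ‖g w‖ := hk.le_norm_sin
      have e1 : g w * (h w - (w ^ 2 - e)) =
          (w ^ 2 - e) * (w * (offDiag q (w ^ 2) x - g w / w)) := by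
        have e2 := hfac w
        simp only [hf] at e2
        field_simp
        linear_combination -e2
      have e3 := norm_offDiag_sub_le hq hper hK x hwne ((le_max_left _ _).trans hw)
      have e4 : ‖w ^ 2 - e‖ ≤ (1 + ‖e‖) * ‖w‖ ^ 2 := by
        refine (norm_sub_le _ _).trans ?_
        rw [norm_pow]
        nlinarith [norm_nonneg e, mul_le_mul_of_nonneg_left (one_le_pow₀ hw1 (n := 2))
          (norm_nonneg e)]
      have e5 : X / 4 * ‖h w - (w ^ 2 - e)‖ ≤
          X / 4 * (16 * Real.pi * K * (1 + ‖e‖) * ‖w‖) := by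
        calc _ ≤ ‖g w‖ * ‖h w - (w ^ 2 - e)‖ := by gcongr
          _ = ‖w ^ 2 - e‖ * (‖w‖ * ‖offDiag q (w ^ 2) x - g w / w‖) := by
              rw [← norm_mul, e1, norm_mul, norm_mul]
          _ ≤ (1 + ‖e‖) * ‖w‖ ^ 2 * (‖w‖ * (4 * Real.pi * K / ‖w‖ ^ 2 * X)) := by gcongr
          _ = _ := by field_simp; ring
      exact le_of_mul_le_mul_left e5 (by positivity))
  refine ⟨e - (h 0 - (0 ^ 2 - e)), fun w => ?_⟩
  have e1 := hfac w
  have e2 := hconst w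
  simp only [hf] at e1
  rw [e1]
  linear_combination g w * e2

end

/-! ### Differential equations for the zero of the off-diagonal entry -/

section

variable {q : ℝ → ℂ} {lam : ℂ}

/-- The off-diagonal entry as a function of the base point: it is a quadratic form in `(θ, φ)` with
discriminant `Δ² - 4`, which gives a nonlinear second-order equation. -/
theorem exists_deriv_offDiag (hq : Continuous q) (hper : Function.Periodic q (2 * Real.pi))
    (lam : ℂ) : ∃ b₁ b₂ : ℝ → ℂ, (∀ x, HasDerivAt (offDiag q lam) (b₁ x) x) ∧
      (∀ x, HasDerivAt b₁ (b₂ x) x) ∧ ∀ x, b₁ x ^ 2 + 4 * (q x - lam) * offDiag q lam x ^ 2 -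
        2 * offDiag q lam x * b₂ x = discriminant q lam ^ 2 - 4 := by
  have hc := isSol_cosSol hq hper lam
  have hs := isSol_sinSol hq hper lam
  set c := cosSol q lam
  set c' := cosSolDeriv q lam
  set s := sinSol q lam
  set s' := sinSolDeriv q lam
  set A : ℂ := s (2 * Real.pi)
  set B : ℂ := s' (2 * Real.pi) - c (2 * Real.pi) with hB
  set C : ℂ := -c' (2 * Real.pi) with hC
  have hb : offDiag q lam = fun x => A * c x ^ 2 + B * (c x * s x) + C * s x ^ 2 := by
    funext x
    have e1 := ((hc.shift hper).eq_comb hq hper x).1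
    have e2 := ((hs.shift hper).eq_comb hq hper x).1
    simp only [zero_add] at e1 e2
    change c (x + 2 * Real.pi) = c (2 * Real.pi) * c x + c' (2 * Real.pi) * s x at e1
    change s (x + 2 * Real.pi) = A * c x + s' (2 * Real.pi) * s x at e2
    change s (x + 2 * Real.pi) * c x - c (x + 2 * Real.pi) * s x = _
    rw [e1, e2, hB, hC]
    ring
  rw [hb]
  refine ⟨fun x => 2 * A * (c x * c' x) + B * (c x * s' x + c' x * s x) + 2 * C * (s x * s' x),
    fun x => 2 * A * (c' x ^ 2 + (q x - lam) * c x ^ 2) +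
      B * (2 * (c' x * s' x) + 2 * (q x - lam) * (c x * s x)) +
      2 * C * (s' x ^ 2 + (q x - lam) * s x ^ 2), fun x => ?_, fun x => ?_, fun x => ?_⟩
  · refine (((((hc.hasDerivAt x).pow 2).const_mul A).add
      (((hc.hasDerivAt x).mul (hs.hasDerivAt x)).const_mul B)).add
      (((hs.hasDerivAt x).pow 2).const_mul C)).congr_deriv ?_
    push_cast
    ring
  · refine (((((hc.hasDerivAt x).mul (hc.hasDerivAt_deriv x)).const_mul (2 * A)).add
      ((((hc.hasDerivAt x).mul (hs.hasDerivAt_deriv x)).add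
        ((hc.hasDerivAt_deriv x).mul (hs.hasDerivAt x))).const_mul B)).add
      (((hs.hasDerivAt x).mul (hs.hasDerivAt_deriv x)).const_mul (2 * C))).congr_deriv ?_
    ring
  · have hw := cosSol_mul_sinSolDeriv_sub hq hper lam x
    have hw' := cosSol_mul_sinSolDeriv_sub hq hper lam (2 * Real.pi)
    change c x * s' x - c' x * s x = 1 at hw
    change c (2 * Real.pi) * s' (2 * Real.pi) - c' (2 * Real.pi) * A = 1 at hw'
    have hΔ : discriminant q lam = c (2 * Real.pi) + s' (2 * Real.pi) := rfl
    rw [hΔ]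
    linear_combination (B ^ 2 - 4 * A * C) * (c x * s' x - c' x * s x + 1) * hw - 4 * hw'

theorem sin_ne_zero_of_pos {k : ℝ} (hk : 0 < k) :
    Complex.sin (k * Complex.I * (2 * Real.pi : ℝ)) ≠ 0 := by
  intro h
  obtain ⟨n, hn⟩ := exists_int_of_sin_eq_zero h
  exact hk.ne' (by simpa using congrArg Complex.im hn)

/-- For a potential with spectrum `[0, ∞)` and coexistence at `n² / 4`, `n ≠ m`, the zero `μ` of the
off-diagonal entry satisfies first- and second-order differential equations that determine `q`. -/
theorem exists_mu (hq : Continuous q) (hper : Function.Periodic q (2 * Real.pi))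
    (hspec : spectrum (hillOperator q) = {z : ℂ | ∃ t : ℝ, 0 ≤ t ∧ z = t}) {m : ℕ}
    (hco : ∀ n : ℕ, 1 ≤ n → n ≠ m → Coexistence q ((n : ℂ) ^ 2 / 4)) :
    ∃ μ μ' μ'' : ℝ → ℂ, (∀ x, HasDerivAt μ (μ' x) x) ∧ (∀ x, HasDerivAt μ' (μ'' x) x) ∧
      ∀ x, q x = 2 * ((m : ℂ) ^ 2 / 4) - 2 * μ x ∧
        μ'' x = 4 * q x * μ x + 2 * μ x ^ 2 - 2 * ((m : ℂ) ^ 2 / 4) ^ 2 ∧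
        μ' x ^ 2 = -4 * μ x * (μ x - (m : ℂ) ^ 2 / 4) ^ 2 := by
  choose μ hμ using exists_offDiag_eq hq hper hco
  set e : ℂ := (m : ℂ) ^ 2 / 4 with he
  -- at `w = i k` the factor relating `b` and `μ` is a nonzero number `σ`
  have hσ : ∀ k : ℝ, 0 < k → ∃ σ : ℂ, σ ≠ 0 ∧
      (∀ x, offDiag q (-(k : ℂ) ^ 2) x = σ * (-(k : ℂ) ^ 2 - μ x)) ∧
      discriminant q (-(k : ℂ) ^ 2) ^ 2 - 4 =
        σ ^ 2 * (4 * (k : ℂ) ^ 2 * (-(k : ℂ) ^ 2 - e) ^ 2) := by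
    intro k hk
    have hs := sin_ne_zero_of_pos hk
    have hsq : (k * Complex.I) ^ 2 = -(k : ℂ) ^ 2 := by rw [mul_pow, Complex.I_sq]; ring
    have h1 : (k : ℂ) * Complex.I ≠ 0 := by simp [hk.ne']
    have h2 : -(k : ℂ) ^ 2 - e ≠ 0 := by
      have h3 : -(k : ℂ) ^ 2 - e = ((-k ^ 2 - (m : ℝ) ^ 2 / 4 : ℝ) : ℂ) := by
        rw [he]; push_cast; ring
      rw [h3, Complex.ofReal_ne_zero]
      nlinarith [sq_nonneg (m : ℝ)]
    refine ⟨Complex.sin (k * Complex.I * (2 * Real.pi : ℝ)) /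
      (k * Complex.I * (-(k : ℂ) ^ 2 - e)), div_ne_zero hs (mul_ne_zero h1 h2), fun x => ?_, ?_⟩
    · have h3 := hμ x (k * Complex.I)
      rw [hsq] at h3
      rw [div_mul_eq_mul_div, eq_div_iff (mul_ne_zero h1 h2)]
      linear_combination h3
    · have h3 := four_sub_discriminant_sq hq hper hspec (k * Complex.I)
      rw [hsq] at h3
      rw [div_pow, mul_pow, hsq, div_mul_eq_mul_div, eq_div_iff (by
        refine mul_ne_zero (neg_ne_zero.2 (pow_ne_zero 2 ?_)) (pow_ne_zero 2 h2)
        exact_mod_cast hk.ne')]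
      linear_combination ((k : ℂ) ^ 2 * (-(k : ℂ) ^ 2 - e) ^ 2) * h3
  -- `k = 1` shows that `μ` is twice differentiable
  obtain ⟨σ₁, hσ₁, hb₁, -⟩ := hσ 1 one_pos
  obtain ⟨b₁, b₂, hd₁, hd₂, -⟩ := exists_deriv_offDiag hq hper (-((1 : ℝ) : ℂ) ^ 2)
  have hμ1 : ∀ x, HasDerivAt μ (-σ₁⁻¹ * b₁ x) x := by
    intro x
    have h1 : μ = fun x => -σ₁⁻¹ * offDiag q (-((1 : ℝ) : ℂ) ^ 2) x - ((1 : ℝ) : ℂ) ^ 2 :=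
      funext fun x => by
        rw [hb₁]
        field_simp
        ring
    rw [h1]
    exact ((hd₁ x).const_mul _).sub_const _
  have hμ2 : ∀ x, HasDerivAt (fun x => -σ₁⁻¹ * b₁ x) (-σ₁⁻¹ * b₂ x) x := fun x =>
    (hd₂ x).const_mul _
  refine ⟨μ, _, _, hμ1, hμ2, fun x => ?_⟩
  -- the equation of `exists_deriv_offDiag` at `λ = -k²`, divided by `σ²`
  have hkey : ∀ k : ℝ, 0 < k → (-σ₁⁻¹ * b₁ x) ^ 2 + 4 * (q x + (k : ℂ) ^ 2) *
      ((k : ℂ) ^ 2 + μ x) ^ 2 - 2 * ((k : ℂ) ^ 2 + μ x) * (-σ₁⁻¹ * b₂ x) =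
        4 * (k : ℂ) ^ 2 * ((k : ℂ) ^ 2 + e) ^ 2 := by
    intro k hk
    obtain ⟨σ, hσ0, hb, hΔ⟩ := hσ k hk
    obtain ⟨d₁, d₂, hd₁', hd₂', hd⟩ := exists_deriv_offDiag hq hper (-(k : ℂ) ^ 2)
    rw [funext hb] at hd₁' hd
    have h1 : d₁ = fun t => σ * -(-σ₁⁻¹ * b₁ t) := funext fun t =>
      (hd₁' t).unique (((hμ1 t).const_sub _).const_mul σ)
    have h2 : d₂ x = σ * -(-σ₁⁻¹ * b₂ x) := by
      rw [h1] at hd₂'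
      exact (hd₂' x).unique ((hμ2 x).neg.const_mul σ)
    have h3 := hd x
    rw [hΔ, h2, h1] at h3
    refine mul_left_cancel₀ (pow_ne_zero 2 hσ0) ?_
    linear_combination h3
  -- three values of `k` separate the coefficients of a quadratic polynomial in `k ^ 2`
  have k1 := hkey 1 one_pos
  have k2 := hkey 2 two_pos
  have k3 := hkey 3 three_pos
  push_cast at k1 k2 k3
  clear_value e
  generalize -σ₁⁻¹ * b₁ x = ν₁ at *
  generalize -σ₁⁻¹ * b₂ x = ν₂ at *
  have hq1 : q x = 2 * e - 2 * μ x := by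
    linear_combination (1 / 4) * (k1 / 24 - k2 / 15 + k3 / 40)
  have hq2 : ν₂ = 4 * q x * μ x + 2 * μ x ^ 2 - 2 * e ^ 2 := by
    linear_combination (13 / 48) * k1 - (1 / 3) * k2 + (1 / 16) * k3
  refine ⟨hq1, hq2, ?_⟩
  rw [hq1] at k1 hq2
  rw [hq2] at k1
  linear_combination k1

end

/-! ### Solving the differential equation -/

/-- Grönwall's inequality in both directions. -/
theorem eq_zero_of_norm_deriv_le {f f' : ℝ → ℂ} {C x₀ : ℝ} (hf : ∀ x, HasDerivAt f (f' x) x)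
    (hbound : ∀ x, ‖f' x‖ ≤ C * ‖f x‖) (h₀ : f x₀ = 0) (x : ℝ) : f x = 0 := by
  have key : ∀ {g g' : ℝ → ℂ}, (∀ t, HasDerivAt g (g' t) t) → (∀ t, ‖g' t‖ ≤ C * ‖g t‖) →
      g 0 = 0 → ∀ t, 0 ≤ t → g t = 0 := fun {g g'} hg hb hg0 t ht =>
    eq_zero_of_abs_deriv_le_mul_abs_self_of_eq_zero_right (a := 0) (b := t)
      (fun s _ => (hg s).continuousAt.continuousWithinAt) (fun s _ => (hg s).hasDerivWithinAt)
      hg0 (fun s _ => hb s) t ⟨ht, le_rfl⟩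
  rcases le_total x₀ x with h | h
  · have := key (g := fun t => f (x₀ + t)) (g' := fun t => f' (x₀ + t))
      (fun t => (hf _).comp_const_add x₀ t) (fun t => hbound _) (by simpa using h₀) (x - x₀)
      (sub_nonneg.2 h)
    simpa using this
  · have := key (g := fun t => f (x₀ - t)) (g' := fun t => -f' (x₀ - t))
      (fun t => (hf _).comp_const_sub x₀ t) (fun t => by simpa using hbound (x₀ - t))
      (by simpa using h₀) (x₀ - x) (sub_nonneg.2 h)
    simpa using this

theorem hasDerivAt_exp_mul_ofReal (κ : ℂ) (x : ℝ) :
    HasDerivAt (fun t : ℝ => Complex.exp (κ * t)) (κ * Complex.exp (κ * x)) x := by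
  have h : HasDerivAt (fun t : ℝ => κ * (t : ℂ)) κ x := by
    simpa using (Complex.ofRealCLM.hasDerivAt (x := x)).const_mul κ
  simpa [mul_comm] using h.cexp

/-- For the zero potential all `m² / 4` with `m ≥ 1` are points of coexistence, the solutions being
`exp (± i m x / 2)`. -/
theorem coexistence_zero {m : ℕ} (hm : 1 ≤ m) : Coexistence (fun _ => 0) ((m : ℂ) ^ 2 / 4) := by
  have hm0 : (m : ℂ) ≠ 0 := by exact_mod_cast (by lia : m ≠ 0)
  set κ : ℂ := Complex.I * m / 2 with hκ
  have hκ2 : κ ^ 2 = -((m : ℂ) ^ 2 / 4) := by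
    rw [hκ, div_pow, mul_pow, Complex.I_sq]; ring
  have hsol : ∀ κ : ℂ, κ ^ 2 = -((m : ℂ) ^ 2 / 4) →
      IsSolution (fun _ => 0) ((m : ℂ) ^ 2 / 4) fun t : ℝ => Complex.exp (κ * t) := by
    intro κ h
    have hd : deriv (fun t : ℝ => Complex.exp (κ * t)) = fun t : ℝ => κ * Complex.exp (κ * t) :=
      funext fun t => (hasDerivAt_exp_mul_ofReal κ t).deriv
    refine ⟨fun t => (hasDerivAt_exp_mul_ofReal κ t).differentiableAt, ?_, fun x => ?_⟩
    · rw [hd]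
      exact fun t => ((hasDerivAt_exp_mul_ofReal κ t).const_mul κ).differentiableAt
    · rw [hd, ((hasDerivAt_exp_mul_ofReal κ x).const_mul κ).deriv]
      linear_combination -Complex.exp (κ * x) * h
  have h1 : Complex.exp (κ * (2 * Real.pi)) = (-1) ^ m := by
    rw [show κ * (2 * Real.pi) = m * (Real.pi * Complex.I) by rw [hκ]; ring, Complex.exp_nat_mul,
      Complex.exp_pi_mul_I]
  have h2 : Complex.exp (-κ * (2 * Real.pi)) = (-1) ^ m := by
    rw [neg_mul, Complex.exp_neg, h1]
    rcases neg_one_pow_eq_or ℂ m with h | h <;> rw [h] <;> norm_num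
  refine ⟨(-1) ^ m, neg_one_pow_eq_or ℂ m, _, _, hsol κ hκ2, hsol (-κ) (by rw [neg_sq, hκ2]),
    fun x => ?_, fun x => ?_, ?_⟩
  · push_cast
    rw [mul_add, Complex.exp_add, h1, mul_comm]
  · push_cast
    rw [mul_add, Complex.exp_add, h2, mul_comm]
  · refine LinearIndependent.pair_iff.2 fun s t hst => ?_
    have e0 := congrFun hst 0
    have e1 : s * κ + t * -κ = 0 := by
      have h := ((hasDerivAt_exp_mul_ofReal κ 0).const_mul s).add
        ((hasDerivAt_exp_mul_ofReal (-κ) 0).const_mul t)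
      have h' : HasDerivAt (fun _ : ℝ => (0 : ℂ)) _ 0 := h.congr_of_eventuallyEq
        (Eventually.of_forall fun x => (congrFun hst x).symm)
      simpa using h'.unique (hasDerivAt_const _ _)
    simp only [Pi.add_apply, Pi.smul_apply, smul_eq_mul, Complex.ofReal_zero, mul_zero,
      Complex.exp_zero, mul_one, Pi.zero_apply] at e0
    have hκ0 : κ ≠ 0 := by rw [hκ]; simp [hm0]
    have e2 : s = t := mul_right_cancel₀ hκ0 (by linear_combination e1)
    have e3 : t = 0 := by rw [e2] at e0; linear_combination e0 / 2
    exact ⟨e2.trans e3, e3⟩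

/-- The nonvanishing solutions of `r'' = 6 r² - m² r` on the level `r'² = 4 r³ - m² r²`: the inverse
`1 / r` satisfies a linear equation with constant coefficients. -/
theorem exists_eq_of_deriv_sq {m : ℕ} (hm : 1 ≤ m) {r r' r'' : ℝ → ℂ}
    (hr : ∀ x, HasDerivAt r (r' x) x) (hr' : ∀ x, HasDerivAt r' (r'' x) x)
    (h1 : ∀ x, r' x ^ 2 = 4 * r x ^ 3 - m ^ 2 * r x ^ 2)
    (h2 : ∀ x, r'' x = 6 * r x ^ 2 - m ^ 2 * r x) (h0 : ∀ x, r x ≠ 0) :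
    ∃ a : ℂ, a ≠ 0 ∧ ∀ x : ℝ, a * Complex.exp (Complex.I * m * x) + 1 ≠ 0 ∧
      2 * r x = gasymovExample m a x := by
  have hm0 : (m : ℂ) ≠ 0 := by exact_mod_cast (by lia : m ≠ 0)
  set κ : ℂ := Complex.I * m with hκ
  have hκ0 : κ ≠ 0 := mul_ne_zero Complex.I_ne_zero hm0
  have hκ2 : κ ^ 2 = -(m : ℂ) ^ 2 := by rw [hκ, mul_pow, Complex.I_sq]; ring
  clear_value κ
  -- `z = 1 / r - 2 / m²` satisfies `z'' = -m² z`
  set z : ℝ → ℂ := fun x => (r x)⁻¹ - 2 / (m : ℂ) ^ 2 with hz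
  set z' : ℝ → ℂ := fun x => -r' x / r x ^ 2 with hz'
  have hd : ∀ x, HasDerivAt z (z' x) x := fun x => ((hr x).fun_inv (h0 x)).sub_const _
  have hd' : ∀ x, HasDerivAt z' (κ ^ 2 * z x) x := fun x => by
    refine ((hr' x).neg.div ((hr x).pow 2) (pow_ne_zero 2 (h0 x))).congr_deriv ?_
    have := h0 x
    simp only [hz, hκ2, h2, Pi.neg_apply, Pi.pow_apply]
    field_simp
    push_cast
    linear_combination (2 * r x) * h1 x
  have hfirst : ∀ x, z' x ^ 2 - κ ^ 2 * z x ^ 2 = 4 / (m : ℂ) ^ 2 := fun x => by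
    have := h0 x
    simp only [hz, hz', hκ2]
    field_simp
    linear_combination (m : ℂ) ^ 2 * h1 x
  -- hence `z' ± κ z` are multiples of `exp (± κ x)`
  have hconst : ∀ κ' : ℂ, κ' ^ 2 = κ ^ 2 → ∃ c, ∀ x : ℝ,
      (z' x + κ' * z x) = c * Complex.exp (κ' * x) := by
    intro κ' hκ'
    have h : ∀ x : ℝ, HasDerivAt (fun x : ℝ => (z' x + κ' * z x) * Complex.exp (-κ' * x)) 0 x :=
      fun x => by
        refine (((hd' x).add ((hd x).const_mul κ')).mul
          (hasDerivAt_exp_mul_ofReal (-κ') x)).congr_deriv ?_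
        simp only [Pi.add_apply]
        linear_combination -z x * Complex.exp (-κ' * x) * hκ'
    refine ⟨z' 0 + κ' * z 0, fun x => ?_⟩
    have h3 := is_const_of_deriv_eq_zero (fun x => (h x).differentiableAt)
      (fun x => (h x).deriv) x 0
    simp only [Complex.ofReal_zero, mul_zero, Complex.exp_zero, mul_one] at h3
    rw [← h3, mul_assoc, ← Complex.exp_add]
    simp
  obtain ⟨c, hc⟩ := hconst κ rfl
  obtain ⟨d, hd⟩ := hconst (-κ) (neg_sq κ)
  have hcd : κ ^ 2 * (c * d) = -4 := by
    have e1 := hc 0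
    have e2 := hd 0
    simp only [Complex.ofReal_zero, mul_zero, Complex.exp_zero, mul_one] at e1 e2
    have e3 := hfirst 0
    rw [eq_div_iff (pow_ne_zero 2 hm0)] at e3
    rw [← e1, ← e2]
    linear_combination (z' 0 ^ 2 - κ ^ 2 * z 0 ^ 2) * hκ2 - e3
  have hc0 : c ≠ 0 := by
    rintro rfl
    norm_num at hcd
  have ha0 : -κ * c / 2 ≠ 0 := by simp [hκ0, hc0]
  refine ⟨-κ * c / 2, ha0, fun x => ?_⟩
  set a := -κ * c / 2 with ha
  rw [gasymovExample, ← hκ]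
  have hE0 := Complex.exp_ne_zero (κ * x)
  have e1 := hc x
  have e2 := hd x
  rw [neg_mul, neg_mul, Complex.exp_neg] at e2
  generalize Complex.exp (κ * x) = E at *
  have hzx : 2 * κ * z x = c * E - d * E⁻¹ := by linear_combination e1 - e2
  have hkey : (m : ℂ) ^ 2 * a * E = r x * (a * E + 1) ^ 2 := by
    have h3 : κ ^ 2 * (2 * E) + 4 * (r x * E) = κ * c * (r x * E ^ 2) - κ * d * r x := by
      have hrx := h0 x
      have h4 : z x * (r x * κ ^ 2) = κ ^ 2 + 2 * r x := by
        simp only [hz, hκ2]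
        field_simp
        ring
      have h5 : E⁻¹ * E = 1 := inv_mul_cancel₀ hE0
      linear_combination κ * r x * E * hzx - 2 * E * h4 - κ * d * r x * h5
    rw [ha]
    linear_combination κ * c / 4 * h3 + (-κ * c / 2) * E * hκ2 - r x / 4 * hcd
  have hne : a * E + 1 ≠ 0 := by
    intro h
    rw [h] at hkey
    simp [hm0, ha0, hE0] at hkey
  refine ⟨hne, ?_⟩
  rw [eq_div_iff (pow_ne_zero 2 hne)]
  linear_combination -2 * hkey

/-! ### One-sided Fourier series -/

/-- A power series in `exp (κ x)`, where `κ = s m`, rewritten as a series in `exp (s x)`. -/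
theorem exists_hasSum_exp_of_hasSum_pow {m : ℕ} (hm : 1 ≤ m) (s : ℂ) {c : ℕ → ℂ} {f : ℝ → ℂ}
    (h : ∀ x : ℝ, HasSum (fun n : ℕ => c n * Complex.exp (s * m * x) ^ (n + 1)) (f x)) :
    ∃ B : ℕ → ℂ, ∀ x : ℝ, HasSum (fun n : ℕ => B n * Complex.exp (s * (n + 1) * x)) (f x) := by
  -- the index `n + 1` of the power series becomes the frequency `m (n + 1)`
  have hg : ∀ n : ℕ, m * (n + 1) - 1 + 1 = m * (n + 1) := fun n =>
    Nat.sub_add_cancel (Nat.mul_pos hm n.succ_pos)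
  have hinj : Function.Injective fun n : ℕ => m * (n + 1) - 1 := fun i j hij => by
    have h2 : m * (i + 1) = m * (j + 1) := by rw [← hg, ← hg j]; exact congrArg (· + 1) hij
    exact Nat.succ_injective (Nat.eq_of_mul_eq_mul_left hm h2)
  refine ⟨Function.extend (fun n : ℕ => m * (n + 1) - 1) c 0, fun x => ?_⟩
  rw [← hinj.hasSum_iff]
  · convert! h x using 2 with n
    simp only [Function.comp_apply]
    have h2 : ((m * (n + 1) - 1 : ℕ) : ℂ) + 1 = m * (n + 1) := by exact_mod_cast hg n
    rw [hinj.extend_apply, h2, ← Complex.exp_nat_mul]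
    congr 2
    push_cast
    ring
  · intro n hn
    rw [Function.extend_apply' _ _ _ fun ⟨k, hk⟩ => hn ⟨k, hk⟩, Pi.zero_apply, zero_mul]

theorem hasSum_div_one_add_sq {u : ℂ} (hu : ‖u‖ < 1) :
    HasSum (fun n : ℕ => -((n : ℂ) + 1) * (-u) ^ (n + 1)) (u / (u + 1) ^ 2) := by
  have h := (hasSum_coe_mul_geometric_of_norm_lt_one (r := -u) (by rwa [norm_neg])).neg
  rw [← hasSum_nat_add_iff' 1] at h
  convert! h using 1
  · funext n
    push_cast
    ring
  · rw [Finset.sum_range_one, sub_neg_eq_add, neg_div, neg_neg, add_comm u]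
    simp

theorem norm_exp_I_mul (m : ℕ) (x : ℝ) : ‖Complex.exp (Complex.I * m * x)‖ = 1 := by
  rw [show Complex.I * m * x = ((m * x : ℝ) : ℂ) * Complex.I by push_cast; ring,
    Complex.norm_exp_ofReal_mul_I]

/-- If `‖a‖ < 1` the potential is expanded in powers of `a exp (i m x)`, and if `‖a‖ > 1` in powers
of the inverse. -/
theorem hasOneSidedFourierSeries_gasymovExample {m : ℕ} (hm : 1 ≤ m) {a : ℂ} (ha0 : a ≠ 0)
    (ha : ‖a‖ ≠ 1) : HasOneSidedFourierSeries (gasymovExample m a) := by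
  rcases lt_or_gt_of_ne ha with ha | ha
  · left
    refine exists_hasSum_exp_of_hasSum_pow hm Complex.I
      (c := fun n => 2 * (m : ℂ) ^ 2 * (-((n : ℂ) + 1) * (-a) ^ (n + 1))) fun x => ?_
    have hu : ‖a * Complex.exp (Complex.I * m * x)‖ < 1 := by
      rwa [norm_mul, norm_exp_I_mul, mul_one]
    convert! (hasSum_div_one_add_sq hu).mul_left (2 * (m : ℂ) ^ 2) using 1
    · funext n
      rw [← neg_mul, mul_pow]
      ring
    · rw [gasymovExample]
      ring
  · right
    have h := exists_hasSum_exp_of_hasSum_pow hm (-Complex.I) (f := gasymovExample m a)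
      (c := fun n => 2 * (m : ℂ) ^ 2 * (-((n : ℂ) + 1) * (-a⁻¹) ^ (n + 1))) fun x => by
        have hE : Complex.exp (-Complex.I * m * x) = (Complex.exp (Complex.I * m * x))⁻¹ := by
          rw [← Complex.exp_neg]
          congr 1
          ring
        have hu : ‖a⁻¹ * Complex.exp (-Complex.I * m * x)‖ < 1 := by
          rw [norm_mul, hE, norm_inv, norm_inv, norm_exp_I_mul, inv_one, mul_one]
          exact inv_lt_one_of_one_lt₀ ha
        convert! (hasSum_div_one_add_sq hu).mul_left (2 * (m : ℂ) ^ 2) using 1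
        · funext n
          rw [← neg_mul, mul_pow]
          ring
        · rw [gasymovExample, hE, ← mul_inv]
          have hE0 := Complex.exp_ne_zero (Complex.I * m * x)
          have hv : a * Complex.exp (Complex.I * m * x) ≠ 0 := mul_ne_zero ha0 hE0
          rw [mul_assoc (2 * (m : ℂ) ^ 2)]
          generalize a * Complex.exp (Complex.I * m * x) = v at *
          rw [mul_div_assoc]
          congr 1
          rw [show v⁻¹ + 1 = (v + 1) * v⁻¹ by field_simp; ring, mul_pow]
          -- for `v = -1` both sides are `0` by the convention on division by zero
          rcases eq_or_ne (v + 1) 0 with h0 | h0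
          · simp [h0]
          · field_simp
    simpa only [neg_mul] using h

/-- On the circle `‖a‖ = 1` the function `a exp (i m x)` takes the value `-1`. -/
theorem norm_ne_one_of_forall_ne_zero {m : ℕ} (hm : 1 ≤ m) {a : ℂ}
    (h : ∀ x : ℝ, a * Complex.exp (Complex.I * m * x) + 1 ≠ 0) : ‖a‖ ≠ 1 := by
  intro ha
  have hm0 : (m : ℂ) ≠ 0 := by exact_mod_cast (by lia : m ≠ 0)
  refine h ((Real.pi - a.arg) / m) ?_
  have e1 := Complex.norm_mul_exp_arg_mul_I a
  rw [ha, Complex.ofReal_one, one_mul] at e1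
  nth_rw 1 [← e1]
  rw [← Complex.exp_add, show (a.arg : ℂ) * Complex.I +
    Complex.I * m * (((Real.pi - a.arg) / m : ℝ) : ℂ) = Real.pi * Complex.I by
      push_cast; field_simp; ring, Complex.exp_pi_mul_I]
  ring

/-! ### Identification of the potential -/

theorem exists_eq_gasymovExample {q : ℝ → ℂ} (hq : Continuous q)
    (hper : Function.Periodic q (2 * Real.pi))
    (hspec : spectrum (hillOperator q) = {z : ℂ | ∃ t : ℝ, 0 ≤ t ∧ z = t}) {m : ℕ} (hm : 1 ≤ m)
    (hco : ∀ n : ℕ, 1 ≤ n → n ≠ m → Coexistence q ((n : ℂ) ^ 2 / 4))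
    (hno : ¬ Coexistence q ((m : ℂ) ^ 2 / 4)) :
    ∃ a : ℂ, a ≠ 0 ∧ ‖a‖ ≠ 1 ∧ ∀ x : ℝ, q x = gasymovExample m a x := by
  obtain ⟨μ, μ', μ'', hμ, hμ', h⟩ := exists_mu hq hper hspec hco
  set r : ℝ → ℂ := fun x => (m : ℂ) ^ 2 / 4 - μ x with hr
  have hqr : ∀ x, q x = 2 * r x := fun x => by rw [(h x).1, hr]; ring
  have hd : ∀ x, HasDerivAt r (-μ' x) x := fun x => (hμ x).const_sub _
  have h1 : ∀ x, (-μ' x) ^ 2 = 4 * r x ^ 3 - m ^ 2 * r x ^ 2 := fun x => by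
    rw [neg_sq, (h x).2.2, hr]
    ring
  have h2 : ∀ x, -μ'' x = 6 * r x ^ 2 - m ^ 2 * r x := fun x => by
    rw [(h x).2.1, (h x).1, hr]
    ring
  -- since `r'² = (4 r - m²) r²` with `r` bounded, a zero of `r` forces `r = 0`
  have h0 : ∀ x, r x ≠ 0 := by
    intro x₀ hx₀
    refine hno ?_
    obtain ⟨K, -, hK⟩ := exists_bound_of_continuous_periodic hq hper (by positivity)
    have hbound : ∀ x, ‖-μ' x‖ ≤ Real.sqrt (2 * K + m ^ 2) * ‖r x‖ := fun x => by
      have hle : ‖-μ' x‖ ^ 2 ≤ (2 * K + m ^ 2) * ‖r x‖ ^ 2 := by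
        rw [← norm_pow, h1, show 4 * r x ^ 3 - (m : ℂ) ^ 2 * r x ^ 2 =
          (2 * q x - m ^ 2) * r x ^ 2 by rw [hqr]; ring, norm_mul, norm_pow]
        gcongr
        refine (norm_sub_le _ _).trans ?_
        have := hK x
        simp only [norm_mul, norm_pow, Complex.norm_natCast, Complex.norm_ofNat]
        linarith
      calc ‖-μ' x‖ = Real.sqrt (‖-μ' x‖ ^ 2) := (Real.sqrt_sq (norm_nonneg _)).symm
        _ ≤ Real.sqrt ((2 * K + m ^ 2) * ‖r x‖ ^ 2) := Real.sqrt_le_sqrt hle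
        _ = _ := by rw [Real.sqrt_mul' _ (by positivity), Real.sqrt_sq (norm_nonneg _)]
    have hq0 : q = fun _ => 0 := funext fun x => by
      rw [hqr, eq_zero_of_norm_deriv_le hd hbound hx₀ x, mul_zero]
    rw [hq0]
    exact coexistence_zero hm
  obtain ⟨a, ha, hax⟩ := exists_eq_of_deriv_sq hm hd (fun x => (hμ' x).neg) h1 h2 h0
  exact ⟨a, ha, norm_ne_one_of_forall_ne_zero hm fun x => (hax x).1, fun x =>
    (hqr x).trans (hax x).2⟩

end ComplexHill

theorem mainTheorem4 (q : ℝ → ℂ) (hq : Continuous q) (hper : Function.Periodic q (2 * Real.pi))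
    (hspec : ComplexHill.spectrum (ComplexHill.hillOperator q) = {z : ℂ | ∃ t : ℝ, 0 ≤ t ∧ z = t})
    (m : ℕ) (hm : 1 ≤ m)
    (hco : ∀ n : ℕ, 1 ≤ n → n ≠ m → ComplexHill.Coexistence q ((n : ℂ) ^ 2 / 4))
    (hno : ¬ ComplexHill.Coexistence q ((m : ℂ) ^ 2 / 4)) :
    (∃ a : ℂ, a ≠ 0 ∧ ‖a‖ ≠ 1 ∧ ∀ x : ℝ, q x = ComplexHill.gasymovExample m a x) ∧
      ComplexHill.HasOneSidedFourierSeries q := by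
  obtain ⟨a, ha0, ha1, hqa⟩ := ComplexHill.exists_eq_gasymovExample hq hper hspec hm hco hno
  refine ⟨⟨a, ha0, ha1, hqa⟩, ?_⟩
  rw [funext hqa]
  exact ComplexHill.hasOneSidedFourierSeries_gasymovExample hm ha0 ha1
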